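/- Let $(M,g)$ be a surface, i.e. a connected, orientable, smooth Riemannian $2$-manifold with or without boundary, and let $X$ be a $C^r$ vector field on $M$ ($1\le r\le\infty$) that is a Killing field ($\mathcal L_Xg=0$) and satisfies the no-normal condition $X(p)\in T_p\partial M$ for every $p\in\partial M$. Suppose that $X$ has a zero. Call a point of $M$ periodic with period $\tau>0$ if the integral curve of $X$ through it is defined on all of $\mathbb R$, is not constant, and has least period $\tau$. Then: 1. Either $X\equiv 0$, or every zero $p$ of $X$ is an isolated center, that is: $p$ is an isolated zero of $X$; every neighbourhood of $p$ contains a neighbourhood $V$ of $p$ such that every point of $V\setminus\{p\}$ is periodic with orbit contained in $V$; and the eigenvalues of the linearization $X'(p)$ are purely imaginary and nonzero. 2. If $X\not\equiv 0$, then $X$ has a periodic point. Moreover, for every zero $p$ of $X$ there is $\tau>0$ such that (a) there is $\varepsilon>0$ such that for every $v\in T_pM$ with $0<|v|_g<\varepsilon$ the point $\exp_pv$ is defined and is periodic with period $\tau$; (b) if $X$ is complete (its flow $X_t$ is defined for all $t\in\mathbb R$), then for every $v\in T_pM\setminus\{0\}$ in the domain of $\exp_p$ the point $\exp_pv$ is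 either a zero of $X$ or periodic with period $\tau$. -/

import Mathlib

open Set Filter
open scoped Manifold ContDiff Topology

noncomputable section

/-- The model vector space `ℝ²` of a surface. -/
abbrev Plane : Type := EuclideanSpace ℝ (Fin 2)

section Surface

variable {M : Type*} [TopologicalSpace M] [ChartedSpace (EuclideanHalfSpace 2) M]

/-- A (not necessarily continuous) vector field on a surface, possibly with boundary. Mathlib's
`TangentSpace (𝓡∂ 2) x` is a copy of `ℝ²`, identified with the tangent space through the
preferred chart at `x`. -/
abbrev VField (M : Type*) [TopologicalSpace M] [ChartedSpace (EuclideanHalfSpace 2) M] : Type _ :=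
  (x : M) → TangentSpace (𝓡∂ 2) x

/-- A smooth Riemannian metric on a surface (smooth up to the boundary). -/
abbrev SurfaceMetric (M : Type*) [TopologicalSpace M] [ChartedSpace (EuclideanHalfSpace 2) M]
    [IsManifold (𝓡∂ 2) ∞ M] : Type _ :=
  Bundle.ContMDiffRiemannianMetric (𝓡∂ 2) ∞ Plane (fun x : M => TangentSpace (𝓡∂ 2) x)

/-- `X` is of class `C^r`. -/
def VField.IsC (r : ℕ∞) [IsManifold (𝓡∂ 2) ∞ M] (X : VField M) : Prop :=
  ContMDiff (𝓡∂ 2) (𝓡∂ 2).tangent r (fun x => (⟨x, X x⟩ : TangentBundle (𝓡∂ 2) M))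

/-- `M` is orientable: it is covered by smooth charts all of whose transition maps have
positive Jacobian determinant. -/
def IsOrientableSurface (M : Type*) [TopologicalSpace M]
    [ChartedSpace (EuclideanHalfSpace 2) M] : Prop :=
  ∃ A : Set (OpenPartialHomeomorph M (EuclideanHalfSpace 2)),
    A ⊆ IsManifold.maximalAtlas (𝓡∂ 2) ∞ M ∧
    (∀ x : M, ∃ e ∈ A, x ∈ e.source) ∧
    ∀ e ∈ A, ∀ e' ∈ A, ∀ x ∈ e.source ∩ e'.source,
      0 < (fderivWithin ℝ (e'.extend (𝓡∂ 2) ∘ (e.extend (𝓡∂ 2)).symm) (range (𝓡∂ 2))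
        (e.extend (𝓡∂ 2) x)).det

/-! ### Expressions in the preferred chart at `p`

In all of the following, `y` ranges over the image of the preferred chart at `p`, a relatively
open subset of the half plane. -/

section Chart

variable [IsManifold (𝓡∂ 2) ∞ M]

/-- The components of the vector field `X` in the chart at `p`. -/
def chartField (X : VField M) (p : M) (y : Plane) : Plane :=
  tangentCoordChange (𝓡∂ 2) ((extChartAt (𝓡∂ 2) p).symm y) p ((extChartAt (𝓡∂ 2) p).symm y)
    (X ((extChartAt (𝓡∂ 2) p).symm y))

/-- The differential of `chartField X p`; derivatives are taken within the closed half plane. -/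
def chartFieldDeriv (X : VField M) (p : M) (y : Plane) : Plane →L[ℝ] Plane :=
  fderivWithin ℝ (chartField X p) (range (𝓡∂ 2)) y

/-- The inner product `g_x` on `T_x M`, with `T_x M` written as `ℝ²`. -/
def innerAt (g : SurfaceMetric M) (x : M) : Plane →L[ℝ] Plane →L[ℝ] ℝ := g.inner x

/-- The matrix `(g_ij)` of the metric in the chart at `p`, as a bilinear form on `ℝ²`. -/
def chartMetric (g : SurfaceMetric M) (p : M) (y : Plane) : Plane →L[ℝ] Plane →L[ℝ] ℝ :=
  ContinuousLinearMap.bilinearComp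
    (innerAt g ((extChartAt (𝓡∂ 2) p).symm y))
    (tangentCoordChange (𝓡∂ 2) p ((extChartAt (𝓡∂ 2) p).symm y) ((extChartAt (𝓡∂ 2) p).symm y))
    (tangentCoordChange (𝓡∂ 2) p ((extChartAt (𝓡∂ 2) p).symm y) ((extChartAt (𝓡∂ 2) p).symm y))

/-- The derivatives of the metric coefficients: `chartMetricDeriv g p y w u v` is
`∑ wᵏ uⁱ vʲ ∂ₖ g_ij`. -/
def chartMetricDeriv (g : SurfaceMetric M) (p : M) (y : Plane) :
    Plane →L[ℝ] Plane →L[ℝ] Plane →L[ℝ] ℝ :=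
  fderivWithin ℝ (chartMetric g p) (range (𝓡∂ 2)) y

/-- The Lie derivative of the metric in the chart at `p`:
`(L_X g)_ij = Xᵏ ∂ₖ g_ij + g_kj ∂ᵢ Xᵏ + g_ik ∂ⱼ Xᵏ`, as a bilinear form. -/
def lieDerivMetric (g : SurfaceMetric M) (X : VField M) (p : M) (y u v : Plane) : ℝ :=
  chartMetricDeriv g p y (chartField X p y) u v
    + chartMetric g p y (chartFieldDeriv X p y u) v
    + chartMetric g p y u (chartFieldDeriv X p y v)

/-- `X` is a Killing field: `L_X g = 0`. -/
def IsKilling (g : SurfaceMetric M) (X : VField M) : Prop :=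
  ∀ (p : M), ∀ y ∈ (extChartAt (𝓡∂ 2) p).target, ∀ u v : Plane, lieDerivMetric g X p y u v = 0

/-- The linearization `X'(p)` of `X` at (a zero) `p`, as an endomorphism of `T_p M = ℝ²`. -/
def linearization (X : VField M) (p : M) : Plane →L[ℝ] Plane :=
  chartFieldDeriv X p (extChartAt (𝓡∂ 2) p p)

/-- `γ` is a geodesic on the set `s` of times: it is `C²`, and in every preferred chart it
satisfies the geodesic equation `∇_{γ'} γ' = 0`, written with the index lowered, that is
`g_il (cⁱ)'' + (∂ⱼ g_il - (1/2) ∂_l g_ij) (cⁱ)' (cʲ)' = 0`, where `c` is `γ` in the chart. -/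
structure IsGeodesicOn (g : SurfaceMetric M) (γ : ℝ → M) (s : Set ℝ) : Prop where
  continuousOn : ContinuousOn γ s
  contDiff : ∀ (p : M), ∀ t ∈ s, γ t ∈ (extChartAt (𝓡∂ 2) p).source →
    ContDiffWithinAt ℝ 2 (extChartAt (𝓡∂ 2) p ∘ γ) s t
  equation : ∀ (p : M), ∀ t ∈ s, γ t ∈ (extChartAt (𝓡∂ 2) p).source →
    ∀ c : ℝ → Plane, c = extChartAt (𝓡∂ 2) p ∘ γ → ∀ w : Plane,
      chartMetric g p (c t) (derivWithin (derivWithin c s) s t) w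
        + chartMetricDeriv g p (c t) (derivWithin c s t) (derivWithin c s t) w
        - (1 / 2) * chartMetricDeriv g p (c t) w (derivWithin c s t) (derivWithin c s t) = 0

/-- `q = exp_p v`: `v` lies in the domain of `exp_p`, and `q = γ 1` for the geodesic
`γ : [0, 1] → M` with `γ 0 = p` and `γ' 0 = v`. -/
def IsExp (g : SurfaceMetric M) (p : M) (v : TangentSpace (𝓡∂ 2) p) (q : M) : Prop :=
  ∃ γ : ℝ → M, IsGeodesicOn g γ (Icc 0 1) ∧ γ 0 = p ∧
    derivWithin (extChartAt (𝓡∂ 2) p ∘ γ) (Icc 0 1) 0 = (v : Plane) ∧ γ 1 = q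

/-- The no-normal condition `X(p) ∈ T_p ∂M` for `p ∈ ∂M`. In the preferred chart at `p`, the
boundary is the line where the coordinate `0` vanishes. -/
def IsTangentToBoundary (X : VField M) : Prop :=
  ∀ p ∈ (𝓡∂ 2).boundary M, chartField X p (extChartAt (𝓡∂ 2) p p) 0 = 0

end Chart

/-- `X` is complete: its flow `X_t` is defined for all `t ∈ ℝ`. -/
def VField.IsComplete (X : VField M) : Prop :=
  ∀ q : M, ∃ γ : ℝ → M, γ 0 = q ∧ IsMIntegralCurve γ X

/-- `q` is a periodic point of `X` with (least) period `τ > 0`. For a continuously differentiable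
field, this excludes zeros of `X`, whose orbits are constant. -/
def IsPeriodicPoint (X : VField M) (q : M) (τ : ℝ) : Prop :=
  0 < τ ∧ ∃ γ : ℝ → M, γ 0 = q ∧ IsMIntegralCurve γ X ∧ Function.Periodic γ τ ∧
    ∀ t ∈ Ioo 0 τ, γ t ≠ q

/-- `p` is an isolated center of `X`: an isolated zero, with arbitrarily small neighbourhoods
consisting of `p` and of periodic orbits, at which the linearization has nonzero purely
imaginary eigenvalues. -/
structure IsIsolatedCenter [IsManifold (𝓡∂ 2) ∞ M] (X : VField M) (p : M) : Prop where
  zero : X p = 0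
  isolated : ∀ᶠ q in 𝓝[≠] p, X q ≠ 0
  periodic : ∀ U ∈ 𝓝 p, ∃ V ∈ 𝓝 p, V ⊆ U ∧ ∀ q ∈ V, q ≠ p →
    ∃ T, IsPeriodicPoint X q T ∧
      ∀ γ : ℝ → M, γ 0 = q → IsMIntegralCurve γ X → ∀ t, γ t ∈ V
  eigenvalues : ∀ μ : ℂ,
    Polynomial.aeval μ (LinearMap.charpoly (linearization X p : Plane →ₗ[ℝ] Plane)) = 0 →
      μ.re = 0 ∧ μ ≠ 0

end Surface

end

/-! Let Y be X rotated by a right angle in the given orientation. A Killing field infinitesimally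
preserves both the metric and the orientation, hence commutes with Y (`IsKilling.exists_commute`).
The flow of X therefore carries curves tangent to Y to curves tangent to Y with the same
coefficient, and two such curves that meet at one parameter coincide. So an X-orbit closes up after
time t at one point of a Y-curve exactly when it does so at every other point: the least period is
constant along Y-curves (`IsPeriodicPoint.of_commute`).

At a zero p the linearization A is skew for g. If A = 0, then X vanishes near p
(`IsKilling.eventually_eq_zero`); as X is only C¹, the usual second order equation for Killing
fields is replaced by Lipschitz estimates (`norm_fderiv_le_of_killing`). Connectedness then gives X
= 0. At a zero on the boundary, tangency to the boundary and skewness force A = 0, so the zeros of a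
nontrivial X are interior and have A ≠ 0.

There A is conjugate to multiplication by i·l on the complex plane, with l = √(det A). The function
|X|² is a first integral which increases along short rays from p, so an orbit that has turned once
around p is back at its starting point. Nearby orbits are thus periodic, with period between 2π/(l +
ε) and 2π/(l - ε) for any prescribed ε close enough to p (`IsKilling.exists_periodic_nhds`).
Moreover the linearization of Y at p is a nonzero multiple of the identity, so some multiple of Y
flows every nearby point into p. Along this curve the period is constant, and in the limit it is
2π/l (`IsKilling.exists_common_period`).

Finally, g(X, γ') is constant along a geodesic γ. If γ starts at a zero, γ' is orthogonal to X and
hence a multiple of Y wherever X ≠ 0. The period is then locally constant along γ off the zeros, and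
it does not change across a zero because a punctured neighbourhood of the zero has one common period
(`IsGeodesicOn.zero_or_periodic`). -/

set_option linter.unusedSectionVars false

/-! ### Fields, metrics and velocities expressed in charts -/

section ChartBasics

variable {M : Type*} [TopologicalSpace M] [ChartedSpace (EuclideanHalfSpace 2) M]
  [IsManifold (𝓡∂ 2) ∞ M]

theorem tangentCoordChange_comp_inverse {x y z : M} (hx : z ∈ (extChartAt (𝓡∂ 2) x).source)
    (hy : z ∈ (extChartAt (𝓡∂ 2) y).source) (v : Plane) :
    tangentCoordChange (𝓡∂ 2) x y z (tangentCoordChange (𝓡∂ 2) y x z v) = v := by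
  rw [tangentCoordChange_comp ⟨⟨hy, hx⟩, hy⟩, tangentCoordChange_self hy]

/-- The value of a vector field, as an element of `ℝ²`. -/
def fieldAt (X : VField M) (x : M) : Plane := X x

theorem chartField_apply (X : VField M) {p x : M} (hx : x ∈ (extChartAt (𝓡∂ 2) p).source) :
    chartField X p (extChartAt (𝓡∂ 2) p x) = tangentCoordChange (𝓡∂ 2) x p x (fieldAt X x) := by
  unfold chartField fieldAt
  rw [(extChartAt (𝓡∂ 2) p).left_inv hx]

theorem chartField_self (X : VField M) (p : M) :
    chartField X p (extChartAt (𝓡∂ 2) p p) = X p := by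
  rw [chartField_apply X (mem_extChartAt_source p)]
  exact tangentCoordChange_self (mem_extChartAt_source p)

theorem chartField_eq_zero_iff (X : VField M) {p x : M}
    (hx : x ∈ (extChartAt (𝓡∂ 2) p).source) :
    chartField X p (extChartAt (𝓡∂ 2) p x) = 0 ↔ X x = 0 := by
  rw [chartField_apply X hx]
  constructor
  · intro h
    have h2 := tangentCoordChange_comp_inverse hx (mem_extChartAt_source (I := 𝓡∂ 2) x)
      (fieldAt X x)
    rw [h, map_zero] at h2
    exact h2.symm
  · intro h
    have h' : fieldAt X x = 0 := h
    rw [h', map_zero]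

theorem chartMetric_apply (g : SurfaceMetric M) {p x : M}
    (hx : x ∈ (extChartAt (𝓡∂ 2) p).source) (u v : Plane) :
    chartMetric g p (extChartAt (𝓡∂ 2) p x) u v =
      innerAt g x (tangentCoordChange (𝓡∂ 2) p x x u) (tangentCoordChange (𝓡∂ 2) p x x v) := by
  unfold chartMetric
  rw [(extChartAt (𝓡∂ 2) p).left_inv hx]
  rfl

theorem chartMetric_self (g : SurfaceMetric M) (p : M) (u v : Plane) :
    chartMetric g p (extChartAt (𝓡∂ 2) p p) u v = innerAt g p u v := by
  rw [chartMetric_apply g (mem_extChartAt_source p),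
    tangentCoordChange_self (mem_extChartAt_source p),
    tangentCoordChange_self (mem_extChartAt_source p)]

theorem chartMetric_symm (g : SurfaceMetric M) (p : M) (y : Plane) (u v : Plane) :
    chartMetric g p y u v = chartMetric g p y v u := by
  unfold chartMetric
  exact g.symm _ _ _

theorem chartMetric_pos (g : SurfaceMetric M) {p : M} {y : Plane}
    (hy : y ∈ (extChartAt (𝓡∂ 2) p).target) {u : Plane} (hu : u ≠ 0) :
    0 < chartMetric g p y u u := by
  obtain ⟨x, hx, rfl⟩ : ∃ x ∈ (extChartAt (𝓡∂ 2) p).source, extChartAt (𝓡∂ 2) p x = y :=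
    ⟨_, (extChartAt (𝓡∂ 2) p).map_target hy, (extChartAt (𝓡∂ 2) p).right_inv hy⟩
  rw [chartMetric_apply g hx]
  refine g.pos x _ fun h => hu ?_
  have h2 := tangentCoordChange_comp_inverse (mem_extChartAt_source (I := 𝓡∂ 2) x) hx u
  have h3 : tangentCoordChange (𝓡∂ 2) p x x u = 0 := h
  rw [h3, map_zero] at h2
  exact h2.symm

/-- Compatibility of the expressions of the metric in two charts. -/
theorem chartMetric_tangentCoordChange (g : SurfaceMetric M) {p p' x : M}
    (hx : x ∈ (extChartAt (𝓡∂ 2) p).source) (hx' : x ∈ (extChartAt (𝓡∂ 2) p').source)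
    (u v : Plane) :
    chartMetric g p' (extChartAt (𝓡∂ 2) p' x) (tangentCoordChange (𝓡∂ 2) p p' x u)
      (tangentCoordChange (𝓡∂ 2) p p' x v) = chartMetric g p (extChartAt (𝓡∂ 2) p x) u v := by
  rw [chartMetric_apply g hx, chartMetric_apply g hx',
    tangentCoordChange_comp ⟨⟨hx, hx'⟩, mem_extChartAt_source x⟩,
    tangentCoordChange_comp ⟨⟨hx, hx'⟩, mem_extChartAt_source x⟩]

/-- The components of X in the chart at p are its fibre coordinate in the trivialization of the
tangent bundle at p, so their regularity is that of the section. -/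
theorem contDiffOn_chartField {r : ℕ∞} {X : VField M} (hX : X.IsC r) (hr : 1 ≤ r) (p : M) :
    ContDiffOn ℝ 1 (chartField X p) (extChartAt (𝓡∂ 2) p).target := by
  have h1 : ContMDiff (𝓡∂ 2) (𝓡∂ 2).tangent 1
      (fun x => (⟨x, X x⟩ : TangentBundle (𝓡∂ 2) M)) :=
    ContMDiff.of_le hX (by exact_mod_cast hr)
  rw [← contMDiffOn_iff_contDiffOn]
  have h2 : ContMDiffOn (𝓡∂ 2) 𝓘(ℝ, Plane) 1
      (fun x => tangentCoordChange (𝓡∂ 2) x p x (X x)) (extChartAt (𝓡∂ 2) p).source := by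
    intro x hx
    rw [extChartAt_source] at hx
    have := ((trivializationAt Plane (TangentSpace (𝓡∂ 2)) p).contMDiffAt_section_iff
      (IB := 𝓡∂ 2) (n := 1) (s := X) (x₀ := x) hx).1 (h1 x)
    exact this.contMDiffWithinAt
  exact h2.comp (contMDiffOn_extChartAt_symm p) (extChartAt (𝓡∂ 2) p).symm.mapsTo

theorem contDiffOn_chartMetric (g : SurfaceMetric M) (p : M) :
    ContDiffOn ℝ ∞ (chartMetric g p) (extChartAt (𝓡∂ 2) p).target := by
  rw [contDiffOn_clm_apply]
  intro u
  rw [contDiffOn_clm_apply]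
  intro v
  rw [← contMDiffOn_iff_contDiffOn]
  -- The field with constant components w in the chart at p is a smooth section; the metric
  -- coefficients are the metric evaluated on two such sections.
  have hs : ∀ w : Plane, ContMDiffOn (𝓡∂ 2) (𝓡∂ 2).tangent ∞
      (fun x => (⟨x, tangentCoordChange (𝓡∂ 2) p x x w⟩ : TangentBundle (𝓡∂ 2) M))
      (extChartAt (𝓡∂ 2) p).source := by
    intro w x hx
    have hx' := hx
    rw [extChartAt_source] at hx
    apply ContMDiffAt.contMDiffWithinAt
    let sec : VField M := fun x => tangentCoordChange (𝓡∂ 2) p x x w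
    refine ((trivializationAt Plane (TangentSpace (𝓡∂ 2)) p).contMDiffAt_section_iff
      (IB := 𝓡∂ 2) (n := ∞) (s := sec) (x₀ := x) hx).2 ?_
    refine (contMDiffAt_const (c := w)).congr_of_eventuallyEq ?_
    filter_upwards [(isOpen_extChartAt_source (I := 𝓡∂ 2) p).mem_nhds hx'] with z hz
    exact tangentCoordChange_comp_inverse (mem_extChartAt_source z) hz w
  have h2 : ContMDiffOn (𝓡∂ 2) 𝓘(ℝ, ℝ) ∞
      (fun x => innerAt g x (tangentCoordChange (𝓡∂ 2) p x x u)
        (tangentCoordChange (𝓡∂ 2) p x x v)) (extChartAt (𝓡∂ 2) p).source := by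
    intro x hx
    have : ContMDiffWithinAt (𝓡∂ 2) ((𝓡∂ 2).prod 𝓘(ℝ)) ∞
      (fun m ↦ Bundle.TotalSpace.mk' ℝ (E := Bundle.Trivial M ℝ) m
        (g.inner m (tangentCoordChange (𝓡∂ 2) p m m u) (tangentCoordChange (𝓡∂ 2) p m m v)))
        (extChartAt (𝓡∂ 2) p).source x := by
      apply ContMDiffWithinAt.clm_bundle_apply₂ (F₁ := Plane) (F₂ := Plane)
        (E₁ := fun x : M => TangentSpace (𝓡∂ 2) x) (E₂ := fun x : M => TangentSpace (𝓡∂ 2) x)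
        (v := fun m => (tangentCoordChange (𝓡∂ 2) p m m u : TangentSpace (𝓡∂ 2) m))
        (w := fun m => (tangentCoordChange (𝓡∂ 2) p m m v : TangentSpace (𝓡∂ 2) m))
      · exact g.contMDiff.contMDiffAt.contMDiffWithinAt
      · exact hs u x hx
      · exact hs v x hx
    simp only [Bundle.contMDiffWithinAt_totalSpace] at this
    exact this.2
  exact h2.comp (contMDiffOn_extChartAt_symm p) (extChartAt (𝓡∂ 2) p).symm.mapsTo

/-- The velocities of a curve in two charts. -/
theorem hasDerivWithinAt_chart_change {γ : ℝ → M} {S : Set ℝ} {s : ℝ} {p p' : M} {v : Plane}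
    (hp : γ s ∈ (extChartAt (𝓡∂ 2) p).source) (hp' : γ s ∈ (extChartAt (𝓡∂ 2) p').source)
    (hc : ContinuousWithinAt γ S s) (hd : HasDerivWithinAt (extChartAt (𝓡∂ 2) p ∘ γ) v S s) :
    HasDerivWithinAt (extChartAt (𝓡∂ 2) p' ∘ γ) (tangentCoordChange (𝓡∂ 2) p p' (γ s) v) S s := by
  have h1 := hasFDerivWithinAt_tangentCoordChange (I := 𝓡∂ 2) ⟨hp, hp'⟩
  have h2 := h1.comp_hasDerivWithinAt (t := range (𝓡∂ 2)) s hd (fun t _ => by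
    simp only [Function.comp, extChartAt_coe]; exact mem_range_self _)
  refine h2.congr_of_eventuallyEq ?_ ?_
  · filter_upwards [hc.preimage_mem_nhdsWithin (extChartAt_source_mem_nhds' hp)] with t ht
    simp only [Function.comp]
    rw [(extChartAt (𝓡∂ 2) p).left_inv ht]
  · simp only [Function.comp]
    rw [(extChartAt (𝓡∂ 2) p).left_inv hp]

/-- A curve in a surface has velocity `c • Z` at time `s` iff this holds in a chart. -/
theorem hasMFDerivWithinAt_iff_chart (Z : VField M) {γ : ℝ → M} {S : Set ℝ} {s c : ℝ} {p : M}
    (hp : γ s ∈ (extChartAt (𝓡∂ 2) p).source) :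
    HasMFDerivWithinAt 𝓘(ℝ, ℝ) (𝓡∂ 2) γ S s
      ((1 : ℝ →L[ℝ] ℝ).smulRight (c • Z (γ s) : TangentSpace (𝓡∂ 2) (γ s))) ↔
    ContinuousWithinAt γ S s ∧ HasDerivWithinAt (extChartAt (𝓡∂ 2) p ∘ γ)
      (c • chartField Z p (extChartAt (𝓡∂ 2) p (γ s))) S s := by
  have hself := mem_extChartAt_source (I := 𝓡∂ 2) (γ s)
  -- The manifold derivative is defined through the preferred chart at γ s; any other chart is then
  -- reached by a change of coordinates.
  have e1 : HasMFDerivWithinAt 𝓘(ℝ, ℝ) (𝓡∂ 2) γ S s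
      ((1 : ℝ →L[ℝ] ℝ).smulRight (c • Z (γ s) : TangentSpace (𝓡∂ 2) (γ s))) ↔
      ContinuousWithinAt γ S s ∧ HasDerivWithinAt (extChartAt (𝓡∂ 2) (γ s) ∘ γ)
      (c • fieldAt Z (γ s)) S s := by
    unfold HasMFDerivWithinAt
    refine and_congr_right fun _ => ?_
    have h2 : extChartAt 𝓘(ℝ, ℝ) s = PartialEquiv.refl ℝ := extChartAt_model_space_eq_id ℝ s
    have h0 : (extChartAt 𝓘(ℝ, ℝ) s).symm ⁻¹' S ∩ range 𝓘(ℝ, ℝ) = S := by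
      rw [h2]
      simp
    have h1 : writtenInExtChartAt 𝓘(ℝ, ℝ) (𝓡∂ 2) s γ = extChartAt (𝓡∂ 2) (γ s) ∘ γ := by
      unfold writtenInExtChartAt
      rw [h2]
      rfl
    have h3 : HasFDerivWithinAt (extChartAt (𝓡∂ 2) (γ s) ∘ γ)
        ((1 : ℝ →L[ℝ] ℝ).smulRight (c • fieldAt Z (γ s))) S s ↔
        HasDerivWithinAt (extChartAt (𝓡∂ 2) (γ s) ∘ γ) (c • fieldAt Z (γ s)) S s :=
      hasDerivWithinAt_iff_hasFDerivWithinAt.symm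
    rw [h0, h1, h2]
    exact h3
  rw [e1, chartField_apply Z hp]
  refine and_congr_right fun hc => ⟨fun h => ?_, fun h => ?_⟩
  · have := hasDerivWithinAt_chart_change hself hp hc h
    rwa [map_smul] at this
  · have := hasDerivWithinAt_chart_change hp hself hc h
    rwa [map_smul, tangentCoordChange_comp_inverse hp hself] at this

end ChartBasics

/-! ### Ordinary differential equations in normed spaces -/

section Ode

variable {E : Type*} [NormedAddCommGroup E] [NormedSpace ℝ E]

/-- A short-time form of Gronwall's inequality, valid in both directions of time. -/
theorem norm_le_two_mul_of_norm_deriv_le {D D' : ℝ → E} {J : Set ℝ} (hJ : Convex ℝ J)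
    {t₁ h K e B : ℝ} (ht₁ : t₁ ∈ J) (hh : ∀ t ∈ J, |t - t₁| ≤ h) (hK : 0 ≤ K)
    (hKh : K * h ≤ 1 / 2) (he : 0 ≤ e) (hd : ∀ t ∈ J, HasDerivWithinAt D (D' t) J t)
    (hb : ∀ t ∈ J, ‖D' t‖ ≤ K * ‖D t‖ + e) (hB : ∀ t ∈ J, ‖D t‖ ≤ B) :
    ∀ t ∈ J, ‖D t‖ ≤ 2 * (‖D t₁‖ + h * e) := by
  -- With m the supremum of ‖D‖, the mean value inequality gives m ≤ ‖D t₁‖ + h e + m / 2, and the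
  -- last term is absorbed. The bound B only serves to make m finite.
  set m := sSup ((fun t => ‖D t‖) '' J) with hm
  have hbdd : BddAbove ((fun t => ‖D t‖) '' J) := ⟨B, by rintro _ ⟨t, ht, rfl⟩; exact hB t ht⟩
  have hle : ∀ t ∈ J, ‖D t‖ ≤ m := fun t ht => le_csSup hbdd ⟨t, ht, rfl⟩
  have h0 : 0 ≤ h := (abs_nonneg _).trans (hh t₁ ht₁)
  have hm0 : 0 ≤ m := (norm_nonneg _).trans (hle t₁ ht₁)
  have hstep : ∀ t ∈ J, ‖D t‖ ≤ ‖D t₁‖ + h * e + m / 2 := by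
    intro t ht
    have h1 := hJ.norm_image_sub_le_of_norm_hasDerivWithin_le (C := K * m + e) hd
      (fun s hs => (hb s hs).trans (by gcongr; exact hle s hs)) ht₁ ht
    have h2 : ‖D t‖ ≤ ‖D t₁‖ + ‖D t - D t₁‖ := by
      have := norm_add_le (D t₁) (D t - D t₁)
      rwa [add_sub_cancel] at this
    have h3 : (K * m + e) * ‖t - t₁‖ ≤ (K * m + e) * h := by
      gcongr
      exact hh t ht
    nlinarith
  have hm2 : m ≤ ‖D t₁‖ + h * e + m / 2 :=
    csSup_le ⟨_, t₁, ht₁, rfl⟩ (by rintro _ ⟨t, ht, rfl⟩; exact hstep t ht)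
  intro t ht
  linarith [hle t ht]

/-- The first variation of a family of integral curves of `X`: if `Y` commutes with `X` and the
family has velocity `k • Y` with respect to the parameter at time `t₁`, then so it does later. -/
theorem hasDerivWithinAt_param_of_commute {X Y : E → E} {DX DY : E → E →L[ℝ] E} {B : Set E}
    (hB : IsCompact B) (hBc : Convex ℝ B) (hX : ∀ y ∈ B, HasFDerivWithinAt X (DX y) B y)
    (hY : ∀ y ∈ B, HasFDerivWithinAt Y (DY y) B y) (hDX : ContinuousOn DX B)
    (hXY : ∀ y ∈ B, DX y (Y y) = DY y (X y)) {K t₁ h : ℝ} (hK : ∀ y ∈ B, ‖DX y‖ ≤ K)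
    (hK0 : 0 ≤ K) (hh : 0 ≤ h) (hKh : K * h ≤ 1 / 2) {F : ℝ → ℝ → E} {S : Set ℝ} {s₀ k : ℝ}
    (hs₀ : s₀ ∈ S)
    (hF : ∀ᶠ s in 𝓝[S] s₀, ∀ t ∈ Icc t₁ (t₁ + h), F t s ∈ B ∧
      HasDerivWithinAt (fun t => F t s) (X (F t s)) (Icc t₁ (t₁ + h)) t)
    (h₁ : HasDerivWithinAt (F t₁) (k • Y (F t₁ s₀)) S s₀) {t : ℝ} (ht : t ∈ Icc t₁ (t₁ + h)) :
    HasDerivWithinAt (F t) (k • Y (F t s₀)) S s₀ := by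
  set J := Icc t₁ (t₁ + h) with hJ
  have hJc : Convex ℝ J := convex_Icc _ _
  have ht₁ : t₁ ∈ J := ⟨le_rfl, by linarith⟩
  have hJh : ∀ t ∈ J, |t - t₁| ≤ h := fun t ht => abs_le.2 ⟨by linarith [ht.1], by linarith [ht.2]⟩
  have hF₀ := hF.self_of_nhdsWithin hs₀
  obtain ⟨R, hR⟩ := hB.isBounded.exists_norm_le
  -- Lipschitz dependence on the parameter
  obtain ⟨C, hC0, hC⟩ : ∃ C : ℝ, 0 < C ∧ ∀ᶠ s in 𝓝[S] s₀, ‖F t₁ s - F t₁ s₀‖ ≤ C * ‖s - s₀‖ := by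
    obtain ⟨C, hC0, hC⟩ := h₁.hasFDerivWithinAt.isBigO_sub.exists_pos
    exact ⟨C, hC0, hC.bound⟩
  have hlip : ∀ᶠ s in 𝓝[S] s₀, ∀ t ∈ J, ‖F t s - F t s₀‖ ≤ 2 * C * ‖s - s₀‖ := by
    filter_upwards [hF, hC] with s hs hCs t ht
    have := norm_le_two_mul_of_norm_deriv_le hJc ht₁ hJh hK0 hKh le_rfl
      (D := fun t => F t s - F t s₀) (D' := fun t => X (F t s) - X (F t s₀)) (B := R + R)
      (fun t ht => (hs t ht).2.sub (hF₀ t ht).2)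
      (fun t ht => by
        rw [add_zero]
        exact hBc.norm_image_sub_le_of_norm_hasFDerivWithin_le hX hK (hF₀ t ht).1 (hs t ht).1)
      (fun t ht => (norm_sub_le _ _).trans (add_le_add (hR _ (hs t ht).1) (hR _ (hF₀ t ht).1))) t ht
    rw [mul_zero, add_zero] at this
    linarith
  rw [hasDerivWithinAt_iff_isLittleO, Asymptotics.isLittleO_iff]
  intro ε hε
  -- The denominator is the factor that the final Gronwall bound produces.
  set ε' := ε / (2 * (1 + 2 * h * C)) with hε'
  have hden : 0 < 2 * (1 + 2 * h * C) := by positivity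
  have hε'0 : 0 < ε' := by positivity
  obtain ⟨η, hη, hunif⟩ := Metric.uniformContinuousOn_iff.1
    (hB.uniformContinuousOn_of_continuous hDX) ε' hε'0
  have hsmall : ∀ᶠ s in 𝓝[S] s₀, 2 * C * ‖s - s₀‖ < η := by
    have : Tendsto (fun s => 2 * C * ‖s - s₀‖) (𝓝[S] s₀) (𝓝 (2 * C * ‖s₀ - s₀‖)) :=
      Continuous.tendsto' (by fun_prop) _ _ rfl |>.mono_left nhdsWithin_le_nhds
    rw [sub_self, norm_zero, mul_zero] at this
    exact this.eventually_lt_const hη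
  have hinit := Asymptotics.isLittleO_iff.1 (hasDerivWithinAt_iff_isLittleO.1 h₁) hε'0
  filter_upwards [hF, hlip, hsmall, hinit] with s hs hls hss his
  have hYc : ∀ t ∈ J, HasDerivWithinAt (fun t => Y (F t s₀)) (DY (F t s₀) (X (F t s₀))) J t :=
    fun t ht => (hY _ (hF₀ t ht).1).comp_hasDerivWithinAt t (hF₀ t ht).2
      (fun t ht => (hF₀ t ht).1)
  have hBY : ContinuousOn (fun t => F t s - F t s₀ - (s - s₀) • k • Y (F t s₀)) J := fun t ht =>
    (((hs t ht).2.sub (hF₀ t ht).2).sub (((hYc t ht).const_smul k).const_smul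
      (s - s₀))).continuousWithinAt
  obtain ⟨R', hR'⟩ := (isCompact_Icc.image_of_continuousOn hBY).isBounded.exists_norm_le
  -- Because X and Y commute, t ↦ Y (F t s₀) solves the linearized equation along F · s₀. The first
  -- order remainder in s therefore satisfies this linear equation up to the Taylor error of X, and
  -- Gronwall applies.
  have := norm_le_two_mul_of_norm_deriv_le hJc ht₁ hJh hK0 hKh
    (e := ε' * (2 * C * ‖s - s₀‖)) (by positivity)
    (D := fun t => F t s - F t s₀ - (s - s₀) • k • Y (F t s₀))
    (D' := fun t => X (F t s) - X (F t s₀) - (s - s₀) • k • DY (F t s₀) (X (F t s₀))) (B := R')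
    (fun t ht => ((hs t ht).2.sub (hF₀ t ht).2).sub (((hYc t ht).const_smul k).const_smul
      (s - s₀)))
    (fun t ht => by
      have e1 : X (F t s) - X (F t s₀) - (s - s₀) • k • DY (F t s₀) (X (F t s₀)) =
          DX (F t s₀) (F t s - F t s₀ - (s - s₀) • k • Y (F t s₀)) +
          (X (F t s) - X (F t s₀) - DX (F t s₀) (F t s - F t s₀)) := by
        rw [map_sub (DX (F t s₀)) (F t s - F t s₀), map_smul, map_smul, hXY _ (hF₀ t ht).1]
        abel
      rw [e1]
      refine (norm_add_le _ _).trans (add_le_add ?_ ?_)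
      · exact (ContinuousLinearMap.le_opNorm _ _).trans
          (mul_le_mul_of_nonneg_right (hK _ (hF₀ t ht).1) (norm_nonneg _))
      · have hin : F t s ∈ B ∩ Metric.ball (F t s₀) η := by
          refine ⟨(hs t ht).1, ?_⟩
          rw [Metric.mem_ball, dist_eq_norm]
          exact (hls t ht).trans_lt hss
        have hin₀ : F t s₀ ∈ B ∩ Metric.ball (F t s₀) η :=
          ⟨(hF₀ t ht).1, Metric.mem_ball_self hη⟩
        -- Mean value inequality for X minus its differential at F t s₀, on a convex set on which DX
        -- varies by at most ε'.
        refine ((hBc.inter (convex_ball _ _)).norm_image_sub_le_of_norm_hasFDerivWithin_le' (C := ε')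
          (fun y hy => (hX y hy.1).mono inter_subset_left)
          (fun y hy => ?_) hin₀ hin).trans ?_
        · rw [← dist_eq_norm]
          exact (hunif y hy.1 _ (hF₀ t ht).1 hy.2).le
        · exact mul_le_mul_of_nonneg_left (hls t ht) hε'0.le)
    (fun t ht => hR' _ ⟨t, ht, rfl⟩) t ht
  refine this.trans ?_
  calc 2 * (‖F t₁ s - F t₁ s₀ - (s - s₀) • k • Y (F t₁ s₀)‖ + h * (ε' * (2 * C * ‖s - s₀‖)))
      ≤ 2 * (ε' * ‖s - s₀‖ + h * (ε' * (2 * C * ‖s - s₀‖))) := by gcongr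
    _ = (ε' * (2 * (1 + 2 * h * C))) * ‖s - s₀‖ := by ring
    _ = ε * ‖s - s₀‖ := by rw [hε', div_mul_cancel₀ _ hden.ne']

/-- A bounded Lipschitz vector field has global integral curves. -/
theorem exists_global_solution [CompleteSpace E] {F : E → E} {K : NNReal} (hF : LipschitzWith K F)
    {L : ℝ} (hL : ∀ x, ‖F x‖ ≤ L) (x : E) :
    ∃ z : ℝ → E, z 0 = x ∧ ∀ t, HasDerivAt z (F (z t)) t := by
  have hL0 : 0 ≤ L := (norm_nonneg _).trans (hL x)
  have hex : ∀ n : ℕ, ∃ α : ℝ → E, α 0 = x ∧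
      ∀ t ∈ Ioo (-(n : ℝ)) n, HasDerivAt α (F (α t)) t := by
    intro n
    -- A field bounded by L moves a point by at most L * n in time n, so a ball of this radius
    -- suffices for the whole interval.
    have hpl : IsPicardLindelof (fun _ => F) (tmin := -(n : ℝ)) (tmax := n)
        ⟨0, by simp, by simp⟩ x (.mk (L * n) (by positivity)) 0 (.mk L hL0) K := by
      refine IsPicardLindelof.of_time_independent (fun y _ => hL y) hF.lipschitzOnWith ?_
      simp
    obtain ⟨α, h0, hα⟩ := hpl.exists_eq_forall_mem_Icc_hasDerivWithinAt₀
    exact ⟨α, h0, fun t ht => (hα t (Ioo_subset_Icc_self ht)).hasDerivAt (Icc_mem_nhds ht.1 ht.2)⟩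
  choose α h0 hα using hex
  have huniq : ∀ m n : ℕ, m ≤ n → ∀ t ∈ Ioo (-(m : ℝ)) m, α m t = α n t := by
    intro m n hmn t ht
    have hm : (0 : ℝ) < m := by linarith [ht.1, ht.2]
    have hmn' : (m : ℝ) ≤ n := by exact_mod_cast hmn
    exact ODE_solution_unique_of_mem_Ioo (v := fun _ => F) (s := fun _ => univ) (t₀ := 0) (K := K)
      (fun _ _ => hF.lipschitzOnWith) ⟨by linarith, hm⟩
      (fun t ht => ⟨hα m t ht, mem_univ _⟩)
      (fun t ht => ⟨hα n t ⟨by linarith [ht.1], by linarith [ht.2]⟩, mem_univ _⟩)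
      (by rw [h0, h0]) ht
  -- The summand 1 puts t in the open interval on which the chosen solution is differentiable.
  refine ⟨fun t => α (⌈|t|⌉₊ + 1) t, h0 _, fun t => ?_⟩
  have hmem : ∀ t : ℝ, t ∈ Ioo (-((⌈|t|⌉₊ + 1 : ℕ) : ℝ)) ((⌈|t|⌉₊ + 1 : ℕ) : ℝ) := by
    intro t
    have h1 := Nat.le_ceil |t|
    push_cast
    exact ⟨by linarith [neg_abs_le t], by linarith [le_abs_self t]⟩
  set N := ⌈|t|⌉₊ + 1 with hN
  have hev : ∀ᶠ s in 𝓝 t, α (⌈|s|⌉₊ + 1) s = α N s := by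
    filter_upwards [Ioo_mem_nhds (hmem t).1 (hmem t).2] with s hs
    rcases le_total (⌈|s|⌉₊ + 1) N with h | h
    · exact huniq _ _ h s (hmem s)
    · exact (huniq _ _ h s hs).symm
  exact (hα N t (hmem t)).congr_of_eventuallyEq hev

end Ode

/-! ### Continuity arguments on intervals -/

section Connected

theorem frequently_nhdsWithin_of_mem {S : Set ℝ} {P : ℝ → Prop} {s : ℝ} (hs : s ∈ S) (h : P s) :
    ∃ᶠ t in 𝓝[S] s, P t := by
  have : ∃ᶠ t in pure s, P t := by simpa [frequently_pure] using h
  exact this.filter_mono (pure_le_nhdsWithin hs)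

/-- A property which holds near a point of a connected set as soon as it holds frequently there. -/
theorem forall_mem_of_frequently_imp_eventually {S : Set ℝ} (hS : IsPreconnected S)
    {P : ℝ → Prop} (hP : ∀ s ∈ S, (∃ᶠ t in 𝓝[S] s, P t) → ∀ᶠ t in 𝓝[S] s, P t)
    {s₀ : ℝ} (hs₀ : s₀ ∈ S) (h₀ : ∃ᶠ t in 𝓝[S] s₀, P t) : ∀ s ∈ S, P s := by
  have : PreconnectedSpace S := isPreconnected_iff_preconnectedSpace.1 hS
  have hself : ∀ s ∈ S, (∃ᶠ t in 𝓝[S] s, P t) → P s :=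
    fun s hs h => (hP s hs h).self_of_nhdsWithin hs
  -- The hypothesis yields both openness (a point of A has P frequently nearby) and closedness (off
  -- A, P cannot hold frequently).
  set A : Set S := {s | P s}
  have hop : IsOpen A := by
    rw [isOpen_iff_mem_nhds]
    intro s hs
    have := hP s s.2 (frequently_nhdsWithin_of_mem s.2 hs)
    rw [nhds_subtype_eq_comap_nhdsWithin]
    exact this.comap _
  have hcl : IsClosed A := by
    rw [← isOpen_compl_iff, isOpen_iff_mem_nhds]
    intro s hs
    have h1 : ¬ ∃ᶠ t in 𝓝[S] (s : ℝ), P t := fun h => hs (hself s s.2 h)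
    rw [not_frequently] at h1
    rw [nhds_subtype_eq_comap_nhdsWithin]
    exact h1.comap _
  have huniv : A = univ := IsClopen.eq_univ ⟨hcl, hop⟩ ⟨⟨s₀, hs₀⟩, hself s₀ hs₀ h₀⟩
  intro s hs
  have : (⟨s, hs⟩ : S) ∈ A := huniv ▸ mem_univ _
  exact this

end Connected

/-! ### Balls in the closed half plane -/

section HalfPlane

theorem extChartAt_mem_range {M : Type*} [TopologicalSpace M]
    [ChartedSpace (EuclideanHalfSpace 2) M] (p x : M) :
    extChartAt (𝓡∂ 2) p x ∈ range (𝓡∂ 2) := by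
  rw [extChartAt_coe]
  exact mem_range_self _

/-- The conclusion is stated for all small R so that several local properties can be imposed on one
common ball. -/
theorem eventually_forall_closedBall {E : Type*} [NormedAddCommGroup E] {H : Set E} {y₀ : E}
    {P : E → Prop} (h : ∀ᶠ y in 𝓝[H] y₀, P y) :
    ∀ᶠ R in 𝓝[>] (0 : ℝ), ∀ y ∈ Metric.closedBall y₀ R ∩ H, P y := by
  obtain ⟨ε, hε, h⟩ := Metric.mem_nhdsWithin_iff.1 h
  filter_upwards [Ioo_mem_nhdsGT hε] with R hR y hy
  exact h ⟨Metric.closedBall_subset_ball hR.2 hy.1, hy.2⟩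

/-- Supplies a compact convex piece of the half plane on which f has a continuous differential, so
that mean value estimates hold up to the boundary. -/
theorem eventually_contDiffWithinAt_range {f : Plane → Plane} {y₀ : Plane}
    (hf : ContDiffWithinAt ℝ 1 f (range (𝓡∂ 2)) y₀) (hy₀ : y₀ ∈ range (𝓡∂ 2)) :
    ∀ᶠ R in 𝓝[>] (0 : ℝ), (∀ y ∈ Metric.closedBall y₀ R ∩ range (𝓡∂ 2),
      HasFDerivWithinAt f (fderivWithin ℝ f (range (𝓡∂ 2)) y)
        (Metric.closedBall y₀ R ∩ range (𝓡∂ 2)) y) ∧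
      ContinuousOn (fderivWithin ℝ f (range (𝓡∂ 2)))
        (Metric.closedBall y₀ R ∩ range (𝓡∂ 2)) := by
  have h := hf.eventually (by simp)
  rw [insert_eq_of_mem hy₀] at h
  filter_upwards [eventually_forall_closedBall h] with R hR
  refine ⟨fun y hy => ?_, fun y hy => ?_⟩
  · exact ((hR y hy).differentiableWithinAt one_ne_zero).hasFDerivWithinAt.mono inter_subset_right
  · exact ((hR y hy).fderivWithin_right (m := 0) (𝓡∂ 2).uniqueDiffOn (by simp)
      hy.2).continuousWithinAt.mono inter_subset_right

theorem isCompact_closedBall_inter_range (y₀ : Plane) (R : ℝ) :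
    IsCompact (Metric.closedBall y₀ R ∩ range (𝓡∂ 2)) :=
  (isCompact_closedBall y₀ R).inter_right (𝓡∂ 2).isClosed_range

theorem convex_closedBall_inter_range (y₀ : Plane) (R : ℝ) :
    Convex ℝ (Metric.closedBall y₀ R ∩ range (𝓡∂ 2)) :=
  (convex_closedBall y₀ R).inter (𝓡∂ 2).convex_range

end HalfPlane

/-! ### Curves tangent to vector fields, uniqueness, and commuting fields -/

section Curves

variable {M : Type*} [TopologicalSpace M] [ChartedSpace (EuclideanHalfSpace 2) M]
  [IsManifold (𝓡∂ 2) ∞ M]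

/-- A vector field which is `C¹` near the base point of every preferred chart. -/
def VField.IsChartC1 (Z : VField M) : Prop :=
  ∀ p, ContDiffWithinAt ℝ 1 (chartField Z p) (range (𝓡∂ 2)) (extChartAt (𝓡∂ 2) p p)

/-- The curve `γ` has velocity `c • Z` within `S` at time `s`. -/
def HasVelocityWithin (Z : VField M) (c : ℝ) (γ : ℝ → M) (S : Set ℝ) (s : ℝ) : Prop :=
  HasMFDerivWithinAt 𝓘(ℝ, ℝ) (𝓡∂ 2) γ S s
      ((1 : ℝ →L[ℝ] ℝ).smulRight (c • Z (γ s) : TangentSpace (𝓡∂ 2) (γ s)))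

theorem VField.IsC.isChartC1 {r : ℕ∞} {X : VField M} (hX : X.IsC r) (hr : 1 ≤ r) :
    X.IsChartC1 := fun p =>
  ((contDiffOn_chartField hX hr p) _ (mem_extChartAt_target p)).mono_of_mem_nhdsWithin
    (extChartAt_target_mem_nhdsWithin p)

theorem HasVelocityWithin.continuousWithinAt {Z : VField M} {c : ℝ} {γ : ℝ → M} {S : Set ℝ}
    {s : ℝ} (h : HasVelocityWithin Z c γ S s) : ContinuousWithinAt γ S s := h.1

theorem HasVelocityWithin.hasDerivWithinAt {Z : VField M} {c : ℝ} {γ : ℝ → M} {S : Set ℝ}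
    {s : ℝ} (h : HasVelocityWithin Z c γ S s) {p : M}
    (hp : γ s ∈ (extChartAt (𝓡∂ 2) p).source) :
    HasDerivWithinAt (extChartAt (𝓡∂ 2) p ∘ γ)
      (c • chartField Z p (extChartAt (𝓡∂ 2) p (γ s))) S s :=
  ((hasMFDerivWithinAt_iff_chart Z hp).1 h).2

/-- The chart expression says nothing about γ outside the chart domain, whence `hev`; inside it, the
inverse chart gives back the continuity of γ. -/
theorem hasVelocityWithin_of_hasDerivWithinAt {Z : VField M} {c : ℝ} {γ : ℝ → M} {S : Set ℝ}
    {s : ℝ} {p : M} (hp : γ s ∈ (extChartAt (𝓡∂ 2) p).source)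
    (hev : ∀ᶠ t in 𝓝[S] s, γ t ∈ (extChartAt (𝓡∂ 2) p).source)
    (h : HasDerivWithinAt (extChartAt (𝓡∂ 2) p ∘ γ)
      (c • chartField Z p (extChartAt (𝓡∂ 2) p (γ s))) S s) : HasVelocityWithin Z c γ S s := by
  refine (hasMFDerivWithinAt_iff_chart Z hp).2 ⟨?_, h⟩
  have h1 : ContinuousWithinAt ((extChartAt (𝓡∂ 2) p).symm ∘ (extChartAt (𝓡∂ 2) p ∘ γ)) S s :=
    (continuousAt_extChartAt_symm'' ((extChartAt (𝓡∂ 2) p).map_source hp)).comp_continuousWithinAt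
      (f := extChartAt (𝓡∂ 2) p ∘ γ) h.continuousWithinAt
  refine h1.congr_of_eventuallyEq ?_ ((extChartAt (𝓡∂ 2) p).left_inv hp).symm
  filter_upwards [hev] with t ht
  exact ((extChartAt (𝓡∂ 2) p).left_inv ht).symm

theorem IsMIntegralCurve.hasVelocityWithin {X : VField M} {γ : ℝ → M} (h : IsMIntegralCurve γ X)
    (S : Set ℝ) (t : ℝ) : HasVelocityWithin X 1 γ S t := by
  unfold HasVelocityWithin
  rw [one_smul]
  exact (h t).hasMFDerivWithinAt

theorem isMIntegralCurve_of_hasVelocityWithin {X : VField M} {γ : ℝ → M}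
    (h : ∀ t, HasVelocityWithin X 1 γ univ t) : IsMIntegralCurve γ X := by
  intro t
  have := h t
  unfold HasVelocityWithin at this
  rw [one_smul] at this
  exact hasMFDerivWithinAt_univ.1 this

variable [T2Space M]

/-- Uniqueness of curves with velocity `k s • Z`, also at the boundary. -/
theorem eqOn_of_hasVelocityWithin {Z : VField M} (hZ : Z.IsChartC1) {u₁ u₂ : ℝ → M} {S : Set ℝ}
    (hS : S.OrdConnected) {k : ℝ → ℝ} (hk : ContinuousOn k S)
    (h₁ : ∀ s ∈ S, HasVelocityWithin Z (k s) u₁ S s)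
    (h₂ : ∀ s ∈ S, HasVelocityWithin Z (k s) u₂ S s) {s₀ : ℝ} (hs₀ : s₀ ∈ S)
    (h₀ : u₁ s₀ = u₂ s₀) : EqOn u₁ u₂ S := by
  refine forall_mem_of_frequently_imp_eventually hS.isPreconnected (P := fun s => u₁ s = u₂ s)
    (fun s hs hfr => ?_) hs₀ ?_
  -- Frequent agreement passes to the limit because M is Hausdorff.
  · have heq : u₁ s = u₂ s :=
      tendsto_nhds_unique_of_frequently_eq (h₁ s hs).continuousWithinAt
        (h₂ s hs).continuousWithinAt hfr
    set p := u₁ s with hp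
    set y₀ := extChartAt (𝓡∂ 2) p p with hy₀
    obtain ⟨R, hR, hR0⟩ := ((eventually_contDiffWithinAt_range (hZ p)
      (extChartAt_mem_range p p)).and self_mem_nhdsWithin).exists
    obtain ⟨K, hK⟩ := ((isCompact_closedBall_inter_range y₀ R).image_of_continuousOn
      hR.2).isBounded.exists_norm_le
    have hy₀B : y₀ ∈ Metric.closedBall y₀ R ∩ range (𝓡∂ 2) :=
      ⟨Metric.mem_closedBall_self hR0.le, extChartAt_mem_range p p⟩
    have hK0 : 0 ≤ K := (norm_nonneg _).trans (hK _ ⟨_, hy₀B, rfl⟩)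
    set κ := |k s| + 1 with hκ
    have hκ0 : 0 < κ := by positivity
    have hnear : ∀ u : ℝ → M, u s = p → ContinuousWithinAt u S s →
        ∀ᶠ t in 𝓝[S] s, u t ∈ (extChartAt (𝓡∂ 2) p).source ∧
          extChartAt (𝓡∂ 2) p (u t) ∈ Metric.closedBall y₀ R := by
      intro u hu hc
      have h1 : (extChartAt (𝓡∂ 2) p).source ∈ 𝓝 (u s) := by
        rw [hu]
        exact extChartAt_source_mem_nhds p
      have h2 : (extChartAt (𝓡∂ 2) p) ⁻¹' Metric.closedBall y₀ R ∈ 𝓝 (u s) := by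
        rw [hu]
        exact (continuousAt_extChartAt p).preimage_mem_nhds (Metric.closedBall_mem_nhds _ hR0)
      filter_upwards [hc h1, hc h2] with t ht1 ht2 using ⟨ht1, ht2⟩
    have hkn : ∀ᶠ t in 𝓝[S] s, |k t| < κ :=
      (hk s hs).abs.eventually_lt_const (by rw [hκ]; linarith)
    obtain ⟨δ₀, hδ₀, hδ⟩ := Metric.mem_nhdsWithin_iff.1 ((hnear u₁ rfl
      (h₁ s hs).continuousWithinAt).and ((hnear u₂ heq.symm
      (h₂ s hs).continuousWithinAt).and hkn))
    -- Near s the difference of the curves has Lipschitz constant κ * K, with κ bounding |k|; the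
    -- short-time Gronwall inequality needs κ * K * δ ≤ 1 / 2.
    obtain ⟨δ, hδpos, hδlt, hδK⟩ : ∃ δ, 0 < δ ∧ δ < δ₀ ∧ κ * K * δ ≤ 1 / 2 := by
      refine ⟨min (δ₀ / 2) (1 / (2 * (κ * K + 1))), by positivity, ?_, ?_⟩
      · exact (min_le_left _ _).trans_lt (half_lt_self hδ₀)
      · have hpos : 0 < κ * K + 1 := by positivity
        calc κ * K * min (δ₀ / 2) (1 / (2 * (κ * K + 1)))
            ≤ (κ * K + 1) * (1 / (2 * (κ * K + 1))) :=
              mul_le_mul (by linarith) (min_le_right _ _) (by positivity) hpos.le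
          _ = 1 / 2 := by field_simp
    set J := S ∩ Icc (s - δ) (s + δ) with hJ
    have hJS : J ⊆ S := inter_subset_left
    have hsJ : s ∈ J := ⟨hs, by constructor <;> linarith⟩
    have hJδ : ∀ t ∈ J, |t - s| ≤ δ := fun t ht =>
      abs_le.2 ⟨by linarith [ht.2.1], by linarith [ht.2.2]⟩
    have hball : ∀ t ∈ J, (u₁ t ∈ (extChartAt (𝓡∂ 2) p).source ∧
          extChartAt (𝓡∂ 2) p (u₁ t) ∈ Metric.closedBall y₀ R) ∧
        (u₂ t ∈ (extChartAt (𝓡∂ 2) p).source ∧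
          extChartAt (𝓡∂ 2) p (u₂ t) ∈ Metric.closedBall y₀ R) ∧ |k t| < κ := fun t ht =>
      hδ ⟨by rw [Metric.mem_ball, Real.dist_eq]; exact (hJδ t ht).trans_lt hδlt, ht.1⟩
    -- The difference in the chart starts from 0 at time s and has no inhomogeneous term, so the
    -- bound obtained is 0.
    have hzero := norm_le_two_mul_of_norm_deriv_le (hS.convex.inter (convex_Icc _ _)) hsJ hJδ
      (by positivity : (0 : ℝ) ≤ κ * K) hδK le_rfl
      (D := fun t => extChartAt (𝓡∂ 2) p (u₁ t) - extChartAt (𝓡∂ 2) p (u₂ t))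
      (D' := fun t => k t • chartField Z p (extChartAt (𝓡∂ 2) p (u₁ t)) -
        k t • chartField Z p (extChartAt (𝓡∂ 2) p (u₂ t))) (B := R + R)
      (fun t ht => (((h₁ t ht.1).hasDerivWithinAt (hball t ht).1.1).mono hJS).sub
        (((h₂ t ht.1).hasDerivWithinAt (hball t ht).2.1.1).mono hJS))
      (fun t ht => by
        rw [← smul_sub, norm_smul, Real.norm_eq_abs, add_zero, mul_assoc]
        refine mul_le_mul (hball t ht).2.2.le ?_ (norm_nonneg _) hκ0.le
        exact (convex_closedBall_inter_range y₀ R).norm_image_sub_le_of_norm_hasFDerivWithin_le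
          hR.1 (fun y hy => hK _ ⟨y, hy, rfl⟩)
          ⟨(hball t ht).2.1.2, extChartAt_mem_range _ _⟩
          ⟨(hball t ht).1.2, extChartAt_mem_range _ _⟩)
      (fun t ht => by
        have e1 := (hball t ht).1.2
        have e2 := (hball t ht).2.1.2
        rw [mem_closedBall_iff_norm] at e1 e2
        rw [← sub_sub_sub_cancel_right _ _ y₀]
        exact (norm_sub_le _ _).trans (add_le_add e1 e2))
    have hJn : J ∈ 𝓝[S] s := inter_mem self_mem_nhdsWithin
      (mem_nhdsWithin_of_mem_nhds (Icc_mem_nhds (by linarith) (by linarith)))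
    filter_upwards [hJn] with t ht
    have h3 := hzero t ht
    rw [← hp, ← heq, sub_self, norm_zero, mul_zero, add_zero, mul_zero] at h3
    exact (extChartAt (𝓡∂ 2) p).injOn (hball t ht).1.1 (hball t ht).2.1.1
      (sub_eq_zero.1 (norm_le_zero_iff.1 h3))
  · exact frequently_nhdsWithin_of_mem hs₀ h₀

theorem IsMIntegralCurve.eq_of_isChartC1 {X : VField M} (hX : X.IsChartC1) {γ γ' : ℝ → M}
    (h : IsMIntegralCurve γ X) (h' : IsMIntegralCurve γ' X) {t₀ : ℝ} (h₀ : γ t₀ = γ' t₀) :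
    γ = γ' := by
  ext1 t
  exact eqOn_of_hasVelocityWithin hX ordConnected_univ (k := fun _ => 1) continuousOn_const
    (fun s _ => h.hasVelocityWithin univ s) (fun s _ => h'.hasVelocityWithin univ s)
    (mem_univ t₀) h₀ (mem_univ t)

/-- A curve whose speed in a chart is at most `N` while it is in a ball stays in this ball for
some time. -/
theorem mem_closedBall_of_speed_le {p : M} {y₀ : Plane} {R r N a b : ℝ}
    (hR : Metric.closedBall y₀ R ∩ range (𝓡∂ 2) ⊆ (extChartAt (𝓡∂ 2) p).target) {γ : ℝ → M}
    (hγ : ContinuousOn γ (Icc a b)) (hab : a ≤ b)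
    (ha : γ a ∈ (extChartAt (𝓡∂ 2) p).source) (har : ‖extChartAt (𝓡∂ 2) p (γ a) - y₀‖ ≤ r)
    (hN : 0 ≤ N) (hrR : r + N * (b - a) < R) {v : ℝ → Plane}
    (hv : ∀ t ∈ Icc a b, γ t ∈ (extChartAt (𝓡∂ 2) p).source →
      extChartAt (𝓡∂ 2) p (γ t) ∈ Metric.closedBall y₀ R →
      HasDerivWithinAt (extChartAt (𝓡∂ 2) p ∘ γ) (v t) (Icc a b) t ∧ ‖v t‖ ≤ N) :
    ∀ t ∈ Icc a b, γ t ∈ (extChartAt (𝓡∂ 2) p).source ∧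
      extChartAt (𝓡∂ 2) p (γ t) ∈ Metric.closedBall y₀ R := by
  -- C is compact, hence closed in the Hausdorff space M; this excludes that the curve leaves the
  -- chart domain in the limit.
  set C := (extChartAt (𝓡∂ 2) p).symm '' (Metric.closedBall y₀ R ∩ range (𝓡∂ 2)) with hC
  have hCc : IsClosed C :=
    ((isCompact_closedBall_inter_range y₀ R).image_of_continuousOn
      ((continuousOn_extChartAt_symm p).mono hR)).isClosed
  have hCmem : ∀ x, x ∈ C ↔ x ∈ (extChartAt (𝓡∂ 2) p).source ∧
      extChartAt (𝓡∂ 2) p x ∈ Metric.closedBall y₀ R := by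
    intro x
    constructor
    · rintro ⟨y, hy, rfl⟩
      exact ⟨(extChartAt (𝓡∂ 2) p).map_target (hR hy), by
        rw [(extChartAt (𝓡∂ 2) p).right_inv (hR hy)]; exact hy.1⟩
    · rintro ⟨h1, h2⟩
      exact ⟨_, ⟨h2, extChartAt_mem_range _ _⟩, (extChartAt (𝓡∂ 2) p).left_inv h1⟩
  have hr0 : r < R := by nlinarith
  have haC : γ a ∈ C := (hCmem _).2 ⟨ha, by
    rw [mem_closedBall_iff_norm]; exact har.trans hr0.le⟩
  set A := {t | γ t ∈ C} with hA
  -- As long as the curve has stayed in C it is strictly inside the ball of radius R, so it stays in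
  -- C a little longer.
  have hstep : ∀ x ∈ Icc a b, (∀ t ∈ Icc a x, γ t ∈ C) →
      ‖extChartAt (𝓡∂ 2) p (γ x) - y₀‖ < R := by
    intro x hx hin
    have hsub : Icc a x ⊆ Icc a b := Icc_subset_Icc_right hx.2
    have h1 := (convex_Icc a x).norm_image_sub_le_of_norm_hasDerivWithin_le
      (f := extChartAt (𝓡∂ 2) p ∘ γ) (f' := v) (C := N)
      (fun t ht => ((hv t (hsub ht) ((hCmem _).1 (hin t ht)).1
        ((hCmem _).1 (hin t ht)).2).1).mono hsub)
      (fun t ht => (hv t (hsub ht) ((hCmem _).1 (hin t ht)).1 ((hCmem _).1 (hin t ht)).2).2)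
      (left_mem_Icc.2 hx.1) (right_mem_Icc.2 hx.1)
    have h2 : ‖x - a‖ ≤ b - a := by
      rw [Real.norm_eq_abs, abs_of_nonneg (by linarith [hx.1])]
      linarith [hx.2]
    calc ‖extChartAt (𝓡∂ 2) p (γ x) - y₀‖
        ≤ ‖extChartAt (𝓡∂ 2) p (γ x) - extChartAt (𝓡∂ 2) p (γ a)‖ +
          ‖extChartAt (𝓡∂ 2) p (γ a) - y₀‖ := norm_sub_le_norm_sub_add_norm_sub _ _ _
      _ ≤ N * (b - a) + r := add_le_add (h1.trans (by gcongr)) har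
      _ < R := by linarith
  have hall : ∀ x ∈ Icc a b, ∀ t ∈ Icc a x, γ t ∈ C := by
    refine forall_mem_of_frequently_imp_eventually isPreconnected_Icc ?_
      (left_mem_Icc.2 hab) ?_
    · intro x hx hfr
      have hlt : ∀ t ∈ Ico a x, γ t ∈ C := by
        intro t ht
        obtain ⟨z, hz, hz2⟩ := (hfr.and_eventually
          (mem_nhdsWithin_of_mem_nhds (Ioi_mem_nhds ht.2))).exists
        exact hz t ⟨ht.1, le_of_lt hz2⟩
      have hle : ∀ t ∈ Icc a x, γ t ∈ C := by
        rcases eq_or_lt_of_le hx.1 with h | h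
        · intro t ht
          have : t = a := le_antisymm (h ▸ ht.2) ht.1
          rw [this]
          exact haC
        · intro t ht
          rcases eq_or_lt_of_le ht.2 with h' | h'
          · rw [h']
            have hcx : ContinuousWithinAt γ (Ico a x) x :=
              (hγ x hx).mono (fun t ht => ⟨ht.1, ht.2.le.trans hx.2⟩)
            have : (𝓝[Ico a x] x).NeBot := by
              rw [← mem_closure_iff_nhdsWithin_neBot, closure_Ico h.ne]
              exact right_mem_Icc.2 h.le
            exact hCc.mem_of_tendsto hcx (by
              filter_upwards [self_mem_nhdsWithin] with z hz using hlt z hz)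
          · exact hlt t ⟨ht.1, h'⟩
      have hxs := ((hCmem _).1 (hle x (right_mem_Icc.2 hx.1))).1
      have hn : ∀ᶠ z in 𝓝 (γ x), z ∈ C := by
        have h1 := hstep x hx hle
        have h2 : ContinuousAt (fun z => ‖extChartAt (𝓡∂ 2) p z - y₀‖) (γ x) :=
          ((continuousAt_extChartAt' hxs).sub continuousAt_const).norm
        filter_upwards [extChartAt_source_mem_nhds' hxs, h2.eventually_lt_const h1] with z h3 h4
        exact (hCmem z).2 ⟨h3, mem_closedBall_iff_norm.2 h4.le⟩
      obtain ⟨δ, hδ, hδC⟩ := Metric.mem_nhdsWithin_iff.1 ((hγ x hx).eventually hn)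
      filter_upwards [self_mem_nhdsWithin,
        mem_nhdsWithin_of_mem_nhds (Iio_mem_nhds (show x < x + δ by linarith))] with z hz hz2 t ht
      rcases le_total t x with h | h
      · exact hle t ⟨ht.1, h⟩
      · refine hδC ⟨?_, ht.1, ht.2.trans hz.2⟩
        rw [Metric.mem_ball, Real.dist_eq, abs_of_nonneg (by linarith)]
        linarith [ht.2, mem_Iio.1 hz2]
    · refine frequently_nhdsWithin_of_mem (left_mem_Icc.2 hab) fun t ht => ?_
      have : t = a := le_antisymm ht.2 ht.1
      rwa [this]
  intro t ht
  exact (hCmem _).1 (hall t ht t (right_mem_Icc.2 ht.1))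

/-- Two `C¹` vector fields with vanishing Lie bracket. -/
structure VField.Commute (X Y : VField M) : Prop where
  left : X.IsChartC1
  right : Y.IsChartC1
  bracket : ∀ p, ∀ᶠ y in 𝓝[range (𝓡∂ 2)] (extChartAt (𝓡∂ 2) p p),
    fderivWithin ℝ (chartField X p) (range (𝓡∂ 2)) y (chartField Y p y) =
      fderivWithin ℝ (chartField Y p) (range (𝓡∂ 2)) y (chartField X p y)

/-- The flow of `X` preserves every vector field `Y` commuting with `X`. -/
theorem HasVelocityWithin.flow {X Y : VField M} (hXY : X.Commute Y) {F : ℝ → ℝ → M} {S : Set ℝ}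
    (hF : ∀ s ∈ S, IsMIntegralCurve (fun t => F t s) X) {s₀ c : ℝ} (hs₀ : s₀ ∈ S)
    (h₀ : HasVelocityWithin Y c (F 0) S s₀) :
    ∀ t, 0 ≤ t → HasVelocityWithin Y c (F t) S s₀ := by
  suffices h : ∀ T ∈ Ici (0 : ℝ), ∀ t ∈ Icc 0 T, HasVelocityWithin Y c (F t) S s₀ from
    fun t ht => h t ht t (right_mem_Icc.2 ht)
  refine forall_mem_of_frequently_imp_eventually isPreconnected_Ici ?_ self_mem_Ici ?_
  · intro T hT hfr
    set p := F T s₀ with hp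
    set y₀ := extChartAt (𝓡∂ 2) p p with hy₀
    obtain ⟨R, ⟨⟨⟨⟨hR0, hRX⟩, hRY⟩, hbr⟩, htar⟩⟩ := (((((eventually_mem_nhdsWithin
      (a := (0 : ℝ)) (s := Ioi 0)).and (eventually_contDiffWithinAt_range (hXY.left p) (extChartAt_mem_range p p))).and
      (eventually_contDiffWithinAt_range (hXY.right p) (extChartAt_mem_range p p))).and
      (eventually_forall_closedBall (hXY.bracket p))).and
      (eventually_forall_closedBall (extChartAt_target_mem_nhdsWithin (I := 𝓡∂ 2) p))).exists
    rw [mem_Ioi] at hR0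
    have hBc := isCompact_closedBall_inter_range y₀ R
    obtain ⟨K, hK⟩ := (hBc.image_of_continuousOn hRX.2).isBounded.exists_norm_le
    obtain ⟨N, hN⟩ := (hBc.image_of_continuousOn
      (fun y hy => (hRX.1 y hy).continuousWithinAt)).isBounded.exists_norm_le
    have hy₀B : y₀ ∈ Metric.closedBall y₀ R ∩ range (𝓡∂ 2) :=
      ⟨Metric.mem_closedBall_self hR0.le, extChartAt_mem_range p p⟩
    have hK0 : 0 ≤ K := (norm_nonneg _).trans (hK _ ⟨_, hy₀B, rfl⟩)
    have hN0 : 0 ≤ N := (norm_nonneg _).trans (hN _ ⟨_, hy₀B, rfl⟩)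
    -- The first condition is for Gronwall; the second keeps a curve starting within R / 2 of the
    -- centre inside the ball of radius R during time h.
    obtain ⟨h, hh, hKh, hNh⟩ : ∃ h, 0 < h ∧ K * h ≤ 1 / 2 ∧ N * h < R / 2 := by
      have h1 : ∀ᶠ h in 𝓝[>] (0 : ℝ), K * h < 1 / 2 :=
        mem_nhdsWithin_of_mem_nhds ((continuous_const.mul continuous_id).continuousAt
          |>.eventually_lt_const (by simp))
      have h2 : ∀ᶠ h in 𝓝[>] (0 : ℝ), N * h < R / 2 :=
        mem_nhdsWithin_of_mem_nhds ((continuous_const.mul continuous_id).continuousAt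
          |>.eventually_lt_const (by simpa using hR0))
      obtain ⟨h, ⟨h1, h2⟩, h3⟩ := ((h1.and h2).and self_mem_nhdsWithin).exists
      exact ⟨h, h3, h1.le, h2⟩
    have hnear : ∀ᶠ x in 𝓝 p, x ∈ (extChartAt (𝓡∂ 2) p).source ∧
        ‖extChartAt (𝓡∂ 2) p x - y₀‖ < R / 2 := by
      refine Filter.Eventually.and (extChartAt_source_mem_nhds p) ?_
      have h2 : ContinuousAt (fun z => ‖extChartAt (𝓡∂ 2) p z - y₀‖) p :=
        ((continuousAt_extChartAt p).sub continuousAt_const).norm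
      exact h2.eventually_lt_const (by simp [hy₀, hR0])
    have hcurve : ContinuousAt (fun t => F t s₀) T := (hF s₀ hs₀).continuous.continuousAt
    have hgood : ∀ t₁, (F t₁ s₀ ∈ (extChartAt (𝓡∂ 2) p).source ∧
        ‖extChartAt (𝓡∂ 2) p (F t₁ s₀) - y₀‖ < R / 2) → HasVelocityWithin Y c (F t₁) S s₀ →
        ∀ t ∈ Icc t₁ (t₁ + h), HasVelocityWithin Y c (F t) S s₀ := by
      intro t₁ ht₁ hP t ht
      have hev : ∀ᶠ s in 𝓝[S] s₀, F t₁ s ∈ (extChartAt (𝓡∂ 2) p).source ∧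
          ‖extChartAt (𝓡∂ 2) p (F t₁ s) - y₀‖ < R / 2 := by
        have h2 : ContinuousAt (fun z => ‖extChartAt (𝓡∂ 2) p z - y₀‖) (F t₁ s₀) :=
          ((continuousAt_extChartAt' ht₁.1).sub continuousAt_const).norm
        exact Filter.Eventually.and (hP.continuousWithinAt (extChartAt_source_mem_nhds' ht₁.1))
          (hP.continuousWithinAt.eventually (h2.eventually_lt_const ht₁.2))
      have hin : ∀ᶠ s in 𝓝[S] s₀, ∀ t ∈ Icc t₁ (t₁ + h),
          F t s ∈ (extChartAt (𝓡∂ 2) p).source ∧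
          extChartAt (𝓡∂ 2) p (F t s) ∈ Metric.closedBall y₀ R := by
        filter_upwards [hev, self_mem_nhdsWithin] with s hs hsS
        refine mem_closedBall_of_speed_le (r := R / 2) (N := N)
          (v := fun t => (1 : ℝ) • chartField X p (extChartAt (𝓡∂ 2) p (F t s))) htar
          (hF s hsS).continuous.continuousOn
          (by linarith) hs.1 hs.2.le hN0 (by rw [add_sub_cancel_left]; linarith) ?_
        intro t _ hsrc hb
        refine ⟨((hF s hsS).hasVelocityWithin _ t).hasDerivWithinAt hsrc, ?_⟩
        rw [one_smul]
        exact hN _ ⟨_, ⟨hb, extChartAt_mem_range _ _⟩, rfl⟩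
      have hd := hasDerivWithinAt_param_of_commute hBc (convex_closedBall_inter_range y₀ R)
        hRX.1 hRY.1 hRX.2 hbr (fun y hy => hK _ ⟨y, hy, rfl⟩) hK0 hh.le hKh
        (F := fun t s => extChartAt (𝓡∂ 2) p (F t s)) hs₀ (by
          filter_upwards [hin, self_mem_nhdsWithin] with s hs hsS t ht
          refine ⟨⟨(hs t ht).2, extChartAt_mem_range _ _⟩, ?_⟩
          have := ((hF s hsS).hasVelocityWithin (Icc t₁ (t₁ + h)) t).hasDerivWithinAt (hs t ht).1
          rwa [one_smul] at this) (hP.hasDerivWithinAt ht₁.1) ht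
      refine hasVelocityWithin_of_hasDerivWithinAt
        (hin.self_of_nhdsWithin hs₀ t ht).1 ?_ hd
      filter_upwards [hin] with s hs using (hs t ht).1
    -- A restart at some t₁ > T - h / 2 reaches beyond T + h / 2. The length h depends only on the
    -- neighbourhood of F T s₀, not on t₁.
    have hnt : ∀ᶠ t₁ in 𝓝[Ici 0] T, (F t₁ s₀ ∈ (extChartAt (𝓡∂ 2) p).source ∧
        ‖extChartAt (𝓡∂ 2) p (F t₁ s₀) - y₀‖ < R / 2) ∧ T - h / 2 < t₁ ∧ 0 ≤ t₁ :=
      (eventually_nhdsWithin_of_eventually_nhds (hcurve.eventually hnear)).and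
        ((eventually_nhdsWithin_of_eventually_nhds
          (eventually_gt_nhds (by linarith))).and eventually_mem_nhdsWithin)
    obtain ⟨t₁, hP₁, hb₁, hlt₁, h0₁⟩ := (hfr.and_eventually hnt).exists
    filter_upwards [mem_nhdsWithin_of_mem_nhds (Iio_mem_nhds (show T < T + h / 2 by linarith))]
      with z hz t ht
    rcases le_total t t₁ with h' | h'
    · exact hP₁ t ⟨ht.1, h'⟩
    · refine hgood t₁ hb₁ (hP₁ t₁ (right_mem_Icc.2 h0₁)) t ⟨h', ?_⟩
      linarith [ht.2, mem_Iio.1 hz]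
  · refine frequently_nhdsWithin_of_mem self_mem_Ici fun t ht => ?_
    have : t = 0 := le_antisymm ht.2 ht.1
    rwa [this]

/-- The least period of the orbits of `X` is constant along the orbits of every vector field
commuting with `X`. -/
theorem IsPeriodicPoint.of_commute {X Y : VField M} (hXY : X.Commute Y) {F : ℝ → ℝ → M}
    {S : Set ℝ} (hS : S.OrdConnected) {k : ℝ → ℝ} (hk : ContinuousOn k S)
    (hF : ∀ s ∈ S, IsMIntegralCurve (fun t => F t s) X)
    (h₀ : ∀ s ∈ S, HasVelocityWithin Y (k s) (F 0) S s) {T s₁ s₂ : ℝ} (hs₁ : s₁ ∈ S)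
    (hs₂ : s₂ ∈ S) (h : IsPeriodicPoint X (F 0 s₁) T) : IsPeriodicPoint X (F 0 s₂) T := by
  obtain ⟨hT, γ, hγ0, hγ, hper, hleast⟩ := h
  have hγF : γ = fun t => F t s₁ := hγ.eq_of_isChartC1 hXY.left (hF s₁ hs₁) hγ0
  -- The curves F t and F 0 both have velocity k • Y, so they agree everywhere on S once they agree
  -- at one parameter.
  have hiff : ∀ t, 0 ≤ t → ∀ a ∈ S, ∀ b ∈ S, F t a = F 0 a → F t b = F 0 b := by
    intro t ht a ha b hb hab
    exact eqOn_of_hasVelocityWithin hXY.right hS hk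
      (fun s hs => (h₀ s hs).flow hXY hF hs t ht) h₀ ha hab hb
  refine ⟨hT, fun t => F t s₂, rfl, hF s₂ hs₂, ?_, ?_⟩
  · have h1 : F T s₂ = F 0 s₂ := by
      refine hiff T hT.le s₁ hs₁ s₂ hs₂ ?_
      have := hper 0
      rw [hγF] at this
      simpa using this
    have h2 := ((hF s₂ hs₂).comp_add T).eq_of_isChartC1 hXY.left (hF s₂ hs₂) (t₀ := 0)
      (by simpa using h1)
    intro t
    exact congrFun h2 t
  · intro t ht heq
    refine hleast t ht ?_
    rw [hγF]
    exact hiff t ht.1.le s₂ hs₂ s₁ hs₁ heq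

theorem IsPeriodicPoint.period_unique {X : VField M} (hX : X.IsChartC1) {q : M} {T T' : ℝ}
    (h : IsPeriodicPoint X q T) (h' : IsPeriodicPoint X q T') : T = T' := by
  obtain ⟨hT, γ, hγ0, hγ, hper, hleast⟩ := h
  obtain ⟨hT', γ', hγ0', hγ', hper', hleast'⟩ := h'
  have heq : γ = γ' := hγ.eq_of_isChartC1 hX hγ' (hγ0.trans hγ0'.symm)
  subst heq
  rcases lt_trichotomy T T' with h | h | h
  · refine absurd ?_ (hleast' T ⟨hT, h⟩)
    rw [← hγ0]
    simpa using hper 0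
  · exact h
  · refine absurd ?_ (hleast T' ⟨hT', h⟩)
    rw [← hγ0]
    simpa using hper' 0

end Curves

/-! ### Rotation by a right angle for an inner product on the plane -/

section Rotation

/-- The standard basis of the plane. -/
noncomputable abbrev planeBasis (i : Fin 2) : Plane := EuclideanSpace.single i 1

theorem plane_eq (v : Plane) : v = v 0 • planeBasis 0 + v 1 • planeBasis 1 := by
  ext i
  fin_cases i <;> simp

theorem plane_map {F : Type*} [AddCommGroup F] [Module ℝ F] [TopologicalSpace F]
    (L : Plane →L[ℝ] F) (v : Plane) : L v = v 0 • L (planeBasis 0) + v 1 • L (planeBasis 1) := by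
  conv_lhs => rw [plane_eq v]
  rw [map_add, map_smul, map_smul]

theorem plane_det (L : Plane →L[ℝ] Plane) :
    L.det = L (planeBasis 0) 0 * L (planeBasis 1) 1 - L (planeBasis 1) 0 * L (planeBasis 0) 1 := by
  rw [ContinuousLinearMap.det,
    ← LinearMap.det_toMatrix (EuclideanSpace.basisFun (Fin 2) ℝ).toBasis, Matrix.det_fin_two]
  simp [LinearMap.toMatrix_apply]

/-- The determinant of the matrix of a bilinear form. -/
noncomputable def gramDet (B : Plane →L[ℝ] Plane →L[ℝ] ℝ) : ℝ :=
  B (planeBasis 0) (planeBasis 0) * B (planeBasis 1) (planeBasis 1) -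
    B (planeBasis 0) (planeBasis 1) * B (planeBasis 1) (planeBasis 0)

/-- The image of `u` under the rotation by a right angle for the inner product `B`. -/
noncomputable def rotField (B : Plane →L[ℝ] Plane →L[ℝ] ℝ) (u : Plane) : Plane :=
  (Real.sqrt (gramDet B))⁻¹ • (B u (planeBasis 0) • planeBasis 1 - B u (planeBasis 1) • planeBasis 0)

/-- With a = B e₀ e₀ and b = B e₀ e₁, the vector a e₁ - b e₀ is orthogonal to e₀ and its square
length is a times the determinant. -/
theorem gramDet_pos {B : Plane →L[ℝ] Plane →L[ℝ] ℝ} (hs : ∀ u v, B u v = B v u)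
    (hp : ∀ u, u ≠ 0 → 0 < B u u) : 0 < gramDet B := by
  have h0 : planeBasis 0 ≠ 0 := by simp [planeBasis]
  set a := B (planeBasis 0) (planeBasis 0)
  set b := B (planeBasis 0) (planeBasis 1)
  set c := B (planeBasis 1) (planeBasis 1)
  have ha : 0 < a := hp _ h0
  have hv : a • planeBasis 1 - b • planeBasis 0 ≠ 0 := by
    intro h
    have := congrArg (fun v : Plane => v 1) h
    simp at this
    exact ha.ne' this
  have h1 := hp _ hv
  have e : B (a • planeBasis 1 - b • planeBasis 0) (a • planeBasis 1 - b • planeBasis 0) =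
      a * (a * c - b * b) := by
    simp only [map_sub, map_smul, sub_apply, smul_apply,
      smul_eq_mul]
    rw [hs (planeBasis 1) (planeBasis 0)]
    ring
  rw [e] at h1
  have : 0 < a * c - b * b := pos_of_mul_pos_right h1 ha.le
  unfold gramDet
  rw [hs (planeBasis 1) (planeBasis 0)]
  exact this

theorem rotField_ne_zero {B : Plane →L[ℝ] Plane →L[ℝ] ℝ} (hs : ∀ u v, B u v = B v u)
    (hp : ∀ u, u ≠ 0 → 0 < B u u) {u : Plane} (hu : u ≠ 0) : rotField B u ≠ 0 := by
  intro h
  have hD := Real.sqrt_pos.2 (gramDet_pos hs hp)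
  have h1 := (smul_eq_zero.1 h).resolve_left (inv_ne_zero hD.ne')
  have h0 := congrArg (fun v : Plane => v 0) h1
  have h2 := congrArg (fun v : Plane => v 1) h1
  simp at h0 h2
  have h3 := hp u hu
  rw [plane_map (B u) u, h0, h2] at h3
  simp at h3

/-- If `w` is orthogonal to `u ≠ 0` then `w` is a multiple of the rotation of `u`. -/
theorem eq_smul_rotField {B : Plane →L[ℝ] Plane →L[ℝ] ℝ} (hs : ∀ u v, B u v = B v u)
    (hp : ∀ u, u ≠ 0 → 0 < B u u) {u w : Plane} (hu : u ≠ 0) (hw : B u w = 0) :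
    w = (B w (rotField B u) / B (rotField B u) (rotField B u)) • rotField B u := by
  have hr := rotField_ne_zero hs hp hu
  obtain ⟨c, hc⟩ : ∃ c : ℝ, w = c • rotField B u := by
    have hD := Real.sqrt_pos.2 (gramDet_pos hs hp)
    have h1 := plane_map (B u) w
    rw [hw, smul_eq_mul, smul_eq_mul] at h1
    have hq : B u (planeBasis 0) ≠ 0 ∨ B u (planeBasis 1) ≠ 0 := by
      by_contra! h
      have h3 := hp u hu
      rw [plane_map (B u) u, h.1, h.2] at h3
      simp at h3
    rcases hq with hq | hq
    · refine ⟨Real.sqrt (gramDet B) * (w 1 / B u (planeBasis 0)), ?_⟩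
      unfold rotField
      rw [smul_smul, mul_right_comm, mul_inv_cancel₀ hD.ne', one_mul]
      ext i
      fin_cases i
      · simp
        field_simp
        linarith
      · simp
        field_simp
    · refine ⟨-(Real.sqrt (gramDet B) * (w 0 / B u (planeBasis 1))), ?_⟩
      unfold rotField
      rw [smul_smul, neg_mul, mul_right_comm, mul_inv_cancel₀ hD.ne', one_mul]
      ext i
      fin_cases i
      · simp
        field_simp
      · simp
        field_simp
        linarith
  rw [hc, map_smul, smul_apply, smul_eq_mul, mul_div_assoc,
    div_self (hp _ hr).ne', mul_one]

/-- The square of the determinant is what produces the factor |det L| in the transformation of the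
rotation, hence only a sign in `map_rotField`. -/
theorem gramDet_comp (B : Plane →L[ℝ] Plane →L[ℝ] ℝ) (L : Plane →L[ℝ] Plane)
    {B' : Plane →L[ℝ] Plane →L[ℝ] ℝ} (hB : ∀ u v, B' u v = B (L u) (L v)) :
    gramDet B' = L.det ^ 2 * gramDet B := by
  have key : ∀ u v, B u v = u 0 * (v 0 * B (planeBasis 0) (planeBasis 0) +
      v 1 * B (planeBasis 0) (planeBasis 1)) + u 1 * (v 0 * B (planeBasis 1) (planeBasis 0) +
      v 1 * B (planeBasis 1) (planeBasis 1)) := by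
    intro u v
    rw [plane_map B u]
    simp only [add_apply, smul_apply, smul_eq_mul]
    rw [plane_map (B (planeBasis 0)) v, plane_map (B (planeBasis 1)) v]
    simp only [smul_eq_mul]
  unfold gramDet
  rw [hB, hB, hB, hB, key, key (L (planeBasis 1)) (L (planeBasis 1)),
    key (L (planeBasis 0)) (L (planeBasis 1)), key (L (planeBasis 1)) (L (planeBasis 0)), plane_det]
  ring

/-- The behaviour of the rotation under a linear change of coordinates. -/
theorem map_rotField (B : Plane →L[ℝ] Plane →L[ℝ] ℝ) (L : Plane →L[ℝ] Plane)
    {B' : Plane →L[ℝ] Plane →L[ℝ] ℝ} (hB : ∀ u v, B' u v = B (L u) (L v)) (u : Plane) :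
    L (rotField B' u) = (L.det / |L.det|) • rotField B (L u) := by
  unfold rotField
  rw [gramDet_comp B L hB, Real.sqrt_mul (sq_nonneg _), Real.sqrt_sq_eq_abs, map_smul, map_sub,
    map_smul, map_smul, hB, hB, smul_smul, mul_inv, div_eq_mul_inv, mul_assoc,
    mul_comm L.det, ← smul_smul, ← smul_smul, ← smul_smul]
  congr 2
  rw [plane_map (B (L u)) (L (planeBasis 0)), plane_map (B (L u)) (L (planeBasis 1)), plane_det]
  ext i
  fin_cases i
  · simp
    ring
  · simp
    ring

end Rotation

/-! ### A Killing field commutes with its rotation: the computation in a chart -/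

section Bracket

theorem contDiffWithinAt_rotField {H : Set Plane} {G : Plane → Plane →L[ℝ] Plane →L[ℝ] ℝ}
    {X : Plane → Plane} {y : Plane} (hG : ContDiffWithinAt ℝ 1 G H y)
    (hX : ContDiffWithinAt ℝ 1 X H y) (hpos : 0 < gramDet (G y)) :
    ContDiffWithinAt ℝ 1 (fun z => rotField (G z) (X z)) H y := by
  have hc : ∀ {f : Plane → Plane}, ContDiffWithinAt ℝ 1 f H y → ∀ v : Plane,
      ContDiffWithinAt ℝ 1 (fun z => G z (f z) v) H y := fun hf v =>
    (hG.clm_apply hf).clm_apply contDiffWithinAt_const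
  have hD : ContDiffWithinAt ℝ 1 (fun z => gramDet (G z)) H y := by
    unfold gramDet
    exact ((hc contDiffWithinAt_const _).mul (hc contDiffWithinAt_const _)).sub
      ((hc contDiffWithinAt_const _).mul (hc contDiffWithinAt_const _))
  unfold rotField
  exact ((hD.sqrt hpos.ne').inv (Real.sqrt_pos.2 hpos).ne').smul
    (((hc hX _).smul contDiffWithinAt_const).sub ((hc hX _).smul contDiffWithinAt_const))

/-- The derivative of the rotation of a Killing field `X` in the direction of `X`, in a chart. -/
theorem HasFDerivWithinAt.rotField_apply {H : Set Plane} {G : Plane → Plane →L[ℝ] Plane →L[ℝ] ℝ}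
    {G' : Plane →L[ℝ] Plane →L[ℝ] Plane →L[ℝ] ℝ}
    {X : Plane → Plane} {A : Plane →L[ℝ] Plane} {y : Plane} (hG : HasFDerivWithinAt G G' H y)
    (hX : HasFDerivWithinAt X A H y) (hpos : 0 < gramDet (G y))
    (hs : ∀ u v, G y u v = G y v u)
    (hK : ∀ u v, G' (X y) u v + G y (A u) v + G y u (A v) = 0) :
    ∃ R' : Plane →L[ℝ] Plane, HasFDerivWithinAt (fun z => rotField (G z) (X z)) R' H y ∧
      R' (X y) = A (rotField (G y) (X y)) := by
  have hc : ∀ {f : Plane → Plane} {f' : Plane →L[ℝ] Plane}, HasFDerivWithinAt f f' H y →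
      ∀ v : Plane, ∃ q : Plane →L[ℝ] ℝ, HasFDerivWithinAt (fun z => G z (f z) v) q H y ∧
        q (X y) = G' (X y) (f y) v + G y (f' (X y)) v := by
    intro f f' hf v
    refine ⟨_, (hG.clm_apply hf).clm_apply (hasFDerivWithinAt_const v y H), ?_⟩
    simp [add_comm]
  -- The Killing equation expresses the derivative of the metric along X through A, so that only
  -- algebra in A and G y remains.
  have hcst : ∀ u v : Plane, ∃ q : Plane →L[ℝ] ℝ, HasFDerivWithinAt (fun z => G z u v) q H y ∧
        q (X y) = -(G y (A u) v + G y u (A v)) := by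
    intro u v
    obtain ⟨q, hq, hq'⟩ := hc (hasFDerivWithinAt_const u y H) v
    refine ⟨q, hq, ?_⟩
    rw [hq']
    simp only [zero_apply, map_zero]
    linarith [hK u v]
  have hq : ∀ v : Plane, ∃ q : Plane →L[ℝ] ℝ, HasFDerivWithinAt (fun z => G z (X z) v) q H y ∧
        q (X y) = -G y (X y) (A v) := by
    intro v
    obtain ⟨q, hq, hq'⟩ := hc hX v
    refine ⟨q, hq, ?_⟩
    rw [hq']
    linarith [hK (X y) v]
  obtain ⟨g00, h00, e00⟩ := hcst (planeBasis 0) (planeBasis 0)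
  obtain ⟨g01, h01, e01⟩ := hcst (planeBasis 0) (planeBasis 1)
  obtain ⟨g10, h10, e10⟩ := hcst (planeBasis 1) (planeBasis 0)
  obtain ⟨g11, h11, e11⟩ := hcst (planeBasis 1) (planeBasis 1)
  obtain ⟨q0, hq0, eq0⟩ := hq (planeBasis 0)
  obtain ⟨q1, hq1, eq1⟩ := hq (planeBasis 1)
  have hD := (h00.mul h11).sub (h01.mul h10)
  have hφ : HasDerivAt (fun t : ℝ => (Real.sqrt t)⁻¹)
      (-(1 / (2 * Real.sqrt (gramDet (G y)))) / Real.sqrt (gramDet (G y)) ^ 2) (gramDet (G y)) :=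
    (Real.hasDerivAt_sqrt hpos.ne').inv (Real.sqrt_pos.2 hpos).ne'
  have hr := hφ.comp_hasFDerivWithinAt y hD
  have hN := (hq0.smul_const (planeBasis 1)).sub (hq1.smul_const (planeBasis 0))
  refine ⟨_, hr.smul hN, ?_⟩
  set r := Real.sqrt (gramDet (G y)) with hr_def
  have hr0 : r ≠ 0 := (Real.sqrt_pos.2 hpos).ne'
  have hr2 : gramDet (G y) = r ^ 2 := (Real.sq_sqrt hpos.le).symm
  have hdet : G y (planeBasis 0) (planeBasis 0) * G y (planeBasis 1) (planeBasis 1) -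
      G y (planeBasis 0) (planeBasis 1) * G y (planeBasis 0) (planeBasis 1) = r ^ 2 := by
    rw [← hr2]
    unfold gramDet
    rw [hs (planeBasis 1) (planeBasis 0)]
  have hr' : Real.sqrt (G y (planeBasis 0) (planeBasis 0) * G y (planeBasis 1) (planeBasis 1) -
      G y (planeBasis 0) (planeBasis 1) * G y (planeBasis 1) (planeBasis 0)) = r := rfl
  have hA0 := plane_eq (A (planeBasis 0))
  have hA1 := plane_eq (A (planeBasis 1))
  set a := A (planeBasis 0) 0
  set c := A (planeBasis 0) 1
  set b := A (planeBasis 1) 0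
  set d := A (planeBasis 1) 1
  unfold rotField
  simp only [add_apply, smul_apply,
    sub_apply, ContinuousLinearMap.smulRight_apply, map_smul, map_sub,
    Function.comp, e00, e01, e10, e11, eq0, eq1, hA0, hA1, map_add, smul_eq_mul]
  rw [← hr_def, hs (planeBasis 1) (planeBasis 0)]
  -- The derivative of det G along X is -2 tr(A) det G, so that of (det G)^(-1/2) is tr(A) (det
  -- G)^(-1/2).
  have htr : -(1 / (2 * r)) / r ^ 2 * (G y (planeBasis 0) (planeBasis 0) *
      -(b * G y (planeBasis 0) (planeBasis 1) + d * G y (planeBasis 1) (planeBasis 1) +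
        (b * G y (planeBasis 0) (planeBasis 1) + d * G y (planeBasis 1) (planeBasis 1))) +
      G y (planeBasis 1) (planeBasis 1) *
      -(a * G y (planeBasis 0) (planeBasis 0) + c * G y (planeBasis 0) (planeBasis 1) +
        (a * G y (planeBasis 0) (planeBasis 0) + c * G y (planeBasis 0) (planeBasis 1))) -
      (G y (planeBasis 0) (planeBasis 1) *
        -(b * G y (planeBasis 0) (planeBasis 0) + d * G y (planeBasis 0) (planeBasis 1) +
        (a * G y (planeBasis 0) (planeBasis 1) + c * G y (planeBasis 1) (planeBasis 1))) +
      G y (planeBasis 0) (planeBasis 1) *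
        -(a * G y (planeBasis 0) (planeBasis 1) + c * G y (planeBasis 1) (planeBasis 1) +
        (b * G y (planeBasis 0) (planeBasis 0) + d * G y (planeBasis 0) (planeBasis 1))))) =
      r⁻¹ * (a + d) := by
    field_simp
    rw [← hdet]
    ring
  ext i
  fin_cases i
  · simp
    rw [hr']
    linear_combination (-(G y (X y) (planeBasis 1))) * htr
  · simp
    rw [hr']
    linear_combination (G y (X y) (planeBasis 0)) * htr

end Bracket

/-! ### Orientation signs of the preferred charts -/

section Orientation

variable {M : Type*} [TopologicalSpace M] [ChartedSpace (EuclideanHalfSpace 2) M]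

/-- The differential of the transition map between two charts. -/
noncomputable def chartJacobian (e e' : OpenPartialHomeomorph M (EuclideanHalfSpace 2)) (x : M) :
    Plane →L[ℝ] Plane :=
  fderivWithin ℝ (e'.extend (𝓡∂ 2) ∘ (e.extend (𝓡∂ 2)).symm) (range (𝓡∂ 2)) (e.extend (𝓡∂ 2) x)

variable [IsManifold (𝓡∂ 2) ∞ M]

theorem contDiffWithinAt_transition {e e' : OpenPartialHomeomorph M (EuclideanHalfSpace 2)}
    (he : e ∈ IsManifold.maximalAtlas (𝓡∂ 2) ∞ M) (he' : e' ∈ IsManifold.maximalAtlas (𝓡∂ 2) ∞ M)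
    {x : M} (hx : x ∈ e.source) (hx' : x ∈ e'.source) :
    ContDiffWithinAt ℝ ∞ (e'.extend (𝓡∂ 2) ∘ (e.extend (𝓡∂ 2)).symm) (range (𝓡∂ 2))
      (e.extend (𝓡∂ 2) x) :=
  (𝓡∂ 2).contDiffWithinAt_extendCoordChange' he he' hx hx'

theorem hasFDerivWithinAt_chartJacobian {e e' : OpenPartialHomeomorph M (EuclideanHalfSpace 2)}
    (he : e ∈ IsManifold.maximalAtlas (𝓡∂ 2) ∞ M) (he' : e' ∈ IsManifold.maximalAtlas (𝓡∂ 2) ∞ M)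
    {x : M} (hx : x ∈ e.source) (hx' : x ∈ e'.source) :
    HasFDerivWithinAt (e'.extend (𝓡∂ 2) ∘ (e.extend (𝓡∂ 2)).symm) (chartJacobian e e' x)
      (range (𝓡∂ 2)) (e.extend (𝓡∂ 2) x) :=
  ((contDiffWithinAt_transition he he' hx hx').differentiableWithinAt (by simp)).hasFDerivWithinAt

theorem extend_mem_range (e : OpenPartialHomeomorph M (EuclideanHalfSpace 2)) (x : M) :
    e.extend (𝓡∂ 2) x ∈ range (𝓡∂ 2) := mem_range_self _

theorem chartJacobian_comp {e e' e'' : OpenPartialHomeomorph M (EuclideanHalfSpace 2)}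
    (he : e ∈ IsManifold.maximalAtlas (𝓡∂ 2) ∞ M) (he' : e' ∈ IsManifold.maximalAtlas (𝓡∂ 2) ∞ M)
    (he'' : e'' ∈ IsManifold.maximalAtlas (𝓡∂ 2) ∞ M)
    {x : M} (hx : x ∈ e.source) (hx' : x ∈ e'.source) (hx'' : x ∈ e''.source) :
    chartJacobian e e'' x = (chartJacobian e' e'' x).comp (chartJacobian e e' x) := by
  have h1 := hasFDerivWithinAt_chartJacobian he he' hx hx'
  have h2 := hasFDerivWithinAt_chartJacobian he' he'' hx' hx''
  have hxe : x ∈ (e.extend (𝓡∂ 2)).source := by rwa [e.extend_source]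
  have hpt : (e'.extend (𝓡∂ 2) ∘ (e.extend (𝓡∂ 2)).symm) (e.extend (𝓡∂ 2) x) =
      e'.extend (𝓡∂ 2) x := by
    simp only [Function.comp]
    rw [(e.extend (𝓡∂ 2)).left_inv hxe]
  rw [← hpt] at h2
  have h3 := h2.comp (e.extend (𝓡∂ 2) x) h1 (fun y _ => extend_mem_range _ _)
  have h4 : HasFDerivWithinAt (e''.extend (𝓡∂ 2) ∘ (e.extend (𝓡∂ 2)).symm)
      ((chartJacobian e' e'' x).comp (chartJacobian e e' x)) (range (𝓡∂ 2))
      (e.extend (𝓡∂ 2) x) := by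
    suffices hev : ∀ᶠ y in 𝓝[range (𝓡∂ 2)] (e.extend (𝓡∂ 2) x),
        (e''.extend (𝓡∂ 2) ∘ (e.extend (𝓡∂ 2)).symm) y =
        ((e''.extend (𝓡∂ 2) ∘ (e'.extend (𝓡∂ 2)).symm) ∘
          e'.extend (𝓡∂ 2) ∘ (e.extend (𝓡∂ 2)).symm) y from
      h3.congr_of_eventuallyEq hev (hev.self_of_nhdsWithin (extend_mem_range _ _))
    filter_upwards [(𝓡∂ 2).extendCoordChange_source_mem_nhdsWithin' hx hx'] with y hy
    have hy' : (e.extend (𝓡∂ 2)).symm y ∈ (e'.extend (𝓡∂ 2)).source := hy.2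
    simp only [Function.comp]
    rw [(e'.extend (𝓡∂ 2)).left_inv hy']
  exact ((𝓡∂ 2).uniqueDiffOn.eq (extend_mem_range e x)
    (hasFDerivWithinAt_chartJacobian he he'' hx hx'') h4)

theorem chartJacobian_det_comp {e e' e'' : OpenPartialHomeomorph M (EuclideanHalfSpace 2)}
    (he : e ∈ IsManifold.maximalAtlas (𝓡∂ 2) ∞ M) (he' : e' ∈ IsManifold.maximalAtlas (𝓡∂ 2) ∞ M)
    (he'' : e'' ∈ IsManifold.maximalAtlas (𝓡∂ 2) ∞ M)
    {x : M} (hx : x ∈ e.source) (hx' : x ∈ e'.source) (hx'' : x ∈ e''.source) :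
    (chartJacobian e e'' x).det = (chartJacobian e' e'' x).det * (chartJacobian e e' x).det := by
  rw [chartJacobian_comp he he' he'' hx hx' hx'']
  exact LinearMap.det_comp _ _

theorem chartJacobian_self {e : OpenPartialHomeomorph M (EuclideanHalfSpace 2)}
    (he : e ∈ IsManifold.maximalAtlas (𝓡∂ 2) ∞ M) {x : M} (hx : x ∈ e.source) :
    (chartJacobian e e x).det = 1 := by
  have h4 : HasFDerivWithinAt (e.extend (𝓡∂ 2) ∘ (e.extend (𝓡∂ 2)).symm)
      (ContinuousLinearMap.id ℝ Plane) (range (𝓡∂ 2)) (e.extend (𝓡∂ 2) x) := by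
    suffices hev : ∀ᶠ y in 𝓝[range (𝓡∂ 2)] (e.extend (𝓡∂ 2) x),
        (e.extend (𝓡∂ 2) ∘ (e.extend (𝓡∂ 2)).symm) y = id y from
      (hasFDerivWithinAt_id _ _).congr_of_eventuallyEq hev
        (hev.self_of_nhdsWithin (extend_mem_range _ _))
    filter_upwards [e.extend_target_mem_nhdsWithin (I := 𝓡∂ 2) hx] with y hy
    exact (e.extend (𝓡∂ 2)).right_inv hy
  rw [(𝓡∂ 2).uniqueDiffOn.eq (extend_mem_range e x)
    (hasFDerivWithinAt_chartJacobian he he hx hx) h4]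
  exact LinearMap.det_id

theorem chartJacobian_det_ne_zero {e e' : OpenPartialHomeomorph M (EuclideanHalfSpace 2)}
    (he : e ∈ IsManifold.maximalAtlas (𝓡∂ 2) ∞ M) (he' : e' ∈ IsManifold.maximalAtlas (𝓡∂ 2) ∞ M)
    {x : M} (hx : x ∈ e.source) (hx' : x ∈ e'.source) : (chartJacobian e e' x).det ≠ 0 := by
  intro h
  have h1 := chartJacobian_det_comp he he' he hx hx' hx
  rw [chartJacobian_self he hx, h, mul_zero] at h1
  exact one_ne_zero h1

theorem continuousAt_chartJacobian {e e' : OpenPartialHomeomorph M (EuclideanHalfSpace 2)}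
    (he : e ∈ IsManifold.maximalAtlas (𝓡∂ 2) ∞ M) (he' : e' ∈ IsManifold.maximalAtlas (𝓡∂ 2) ∞ M)
    {x : M} (hx : x ∈ e.source) (hx' : x ∈ e'.source) :
    ContinuousAt (chartJacobian e e') x := by
  have h1 := ((contDiffWithinAt_transition he he' hx hx').fderivWithin_right (m := 0)
    (𝓡∂ 2).uniqueDiffOn (by simp) (extend_mem_range e x)).continuousWithinAt
  have h2 : Tendsto (e.extend (𝓡∂ 2)) (𝓝 x) (𝓝[range (𝓡∂ 2)] (e.extend (𝓡∂ 2) x)) :=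
    tendsto_nhdsWithin_iff.2 ⟨e.continuousAt_extend hx,
      Eventually.of_forall fun z => extend_mem_range e z⟩
  exact h1.tendsto.comp h2

/-- On an orientable surface, there is a choice of signs relating the preferred charts to a given
orientation. -/
theorem IsOrientableSurface.exists_sign (hM : IsOrientableSurface M) :
    ∃ o : M → ℝ, (∀ x, o x ≠ 0) ∧ ∀ p, ∀ᶠ x in 𝓝 p,
      o x * ((tangentCoordChange (𝓡∂ 2) p x x).det / |(tangentCoordChange (𝓡∂ 2) p x x).det|) =
        o p := by
  obtain ⟨A, hA, hcov, hpos⟩ := hM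
  choose e heA hxe using hcov
  have hc : ∀ x : M, chartAt (EuclideanHalfSpace 2) x ∈ IsManifold.maximalAtlas (𝓡∂ 2) ∞ M :=
    fun x => IsManifold.chart_mem_maximalAtlas x
  -- The sign o x is that of the Jacobian at x from an oriented chart around x to the preferred
  -- chart at x. The preferred charts need not be oriented, so o need not be locally constant.
  set a : M → M → ℝ := fun p x =>
    (chartJacobian (e p) (chartAt (EuclideanHalfSpace 2) p) x).det with ha
  have ha0 : ∀ x, a x x ≠ 0 := fun x =>
    chartJacobian_det_ne_zero (hA (heA x)) (hc x) (hxe x) (mem_chart_source _ x)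
  refine ⟨fun x => a x x / |a x x|, fun x => div_ne_zero (ha0 x) (abs_pos.2 (ha0 x)).ne', ?_⟩
  intro p
  have hcont : ContinuousAt (a p) p :=
    (ContinuousLinearMap.continuous_det.continuousAt).comp (continuousAt_chartJacobian
      (hA (heA p)) (hc p) (hxe p) (mem_chart_source _ p))
  have hsign : ∀ᶠ x in 𝓝 p, 0 < a p x * a p p :=
    (hcont.mul continuousAt_const).eventually_const_lt
      (mul_self_pos.2 (ha0 p))
  filter_upwards [hsign, (e p).open_source.mem_nhds (hxe p),
    (chartAt (EuclideanHalfSpace 2) p).open_source.mem_nhds (mem_chart_source _ p)]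
    with x hx hxep hxp
  -- The passage from `e x` to the chart at x factors through the chart at p, and that from `e x` to
  -- the chart at p factors through `e p`. Only the Jacobian between `e x` and `e p` is known to be
  -- positive.
  have h1 : a x x = (tangentCoordChange (𝓡∂ 2) p x x).det * (chartJacobian (e x)
      (chartAt (EuclideanHalfSpace 2) p) x).det :=
    chartJacobian_det_comp (hA (heA x)) (hc p) (hc x) (hxe x) hxp (mem_chart_source _ x)
  have h2 := chartJacobian_det_comp (hA (heA x)) (hA (heA p)) (hc p) (hxe x) hxep hxp
  have h3 : 0 < (chartJacobian (e x) (e p) x).det :=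
    hpos _ (heA x) _ (heA p) x ⟨hxe x, hxep⟩
  have h4 : (tangentCoordChange (𝓡∂ 2) p x x).det ≠ 0 := by
    intro h
    rw [h, zero_mul] at h1
    exact ha0 x h1
  set t := (tangentCoordChange (𝓡∂ 2) p x x).det
  set b := (chartJacobian (e x) (e p) x).det
  change (chartJacobian (e x) (chartAt (EuclideanHalfSpace 2) p) x).det = a p x * b at h2
  rw [h1, h2, abs_mul, abs_mul, abs_of_pos h3]
  have hx0 : a p x ≠ 0 := fun h => by rw [h, zero_mul] at hx; exact hx.false
  have e1 : t * (a p x * b) / (|t| * (|a p x| * b)) * (t / |t|) =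
      (t ^ 2 / |t| ^ 2) * (a p x / |a p x|) * (b / b) := by
    have := abs_pos.2 h4
    have := abs_pos.2 hx0
    field_simp
  rw [e1, div_self h3.ne', sq_abs, div_self (pow_ne_zero 2 h4), one_mul, mul_one]
  rcases lt_or_gt_of_ne hx0 with h | h
  · have h' : a p p < 0 := by nlinarith
    rw [abs_of_neg h, abs_of_neg h', div_neg, div_neg, div_self h.ne, div_self h'.ne]
  · have h' : 0 < a p p := by nlinarith
    rw [abs_of_pos h, abs_of_pos h', div_self h.ne', div_self h'.ne']

end Orientation

/-! ### The globally defined rotated field -/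

section RotatedField

variable {M : Type*} [TopologicalSpace M] [ChartedSpace (EuclideanHalfSpace 2) M]
  [IsManifold (𝓡∂ 2) ∞ M]

/-- The rotation of `X` by a right angle, in the orientation given by `o`. -/
noncomputable def VField.rotate (X : VField M) (g : SurfaceMetric M) (o : M → ℝ) : VField M :=
  fun x => (o x • rotField (innerAt g x) (fieldAt X x) : Plane)

theorem det_tangentCoordChange_ne_zero {p x : M} (hx : x ∈ (extChartAt (𝓡∂ 2) p).source) :
    (tangentCoordChange (𝓡∂ 2) p x x).det ≠ 0 := by
  rw [extChartAt_source] at hx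
  exact chartJacobian_det_ne_zero (IsManifold.chart_mem_maximalAtlas p)
    (IsManifold.chart_mem_maximalAtlas x) hx (mem_chart_source _ x)

/-- The sign of the Jacobian arising from `map_rotField` is cancelled by the one in o x. Hence one
constant o p serves near p, and the rotated field is as regular there as X. -/
theorem chartField_rotate (X : VField M) (g : SurfaceMetric M) {o : M → ℝ} {p x : M}
    (hx : x ∈ (extChartAt (𝓡∂ 2) p).source)
    (ho : o x * ((tangentCoordChange (𝓡∂ 2) p x x).det /
      |(tangentCoordChange (𝓡∂ 2) p x x).det|) = o p) :
    chartField (X.rotate g o) p (extChartAt (𝓡∂ 2) p x) =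
      o p • rotField (chartMetric g p (extChartAt (𝓡∂ 2) p x))
        (chartField X p (extChartAt (𝓡∂ 2) p x)) := by
  have hxx := mem_extChartAt_source (I := 𝓡∂ 2) x
  have h0 := det_tangentCoordChange_ne_zero hx
  have h1 := map_rotField (innerAt g x) (tangentCoordChange (𝓡∂ 2) p x x)
    (chartMetric_apply g hx) (chartField X p (extChartAt (𝓡∂ 2) p x))
  have h2 : tangentCoordChange (𝓡∂ 2) p x x (chartField X p (extChartAt (𝓡∂ 2) p x)) =
      fieldAt X x := by
    rw [chartField_apply X hx, tangentCoordChange_comp_inverse hx hxx]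
  rw [h2] at h1
  set s := (tangentCoordChange (𝓡∂ 2) p x x).det / |(tangentCoordChange (𝓡∂ 2) p x x).det|
  have hs : s * s = 1 := by
    rw [div_mul_div_comm, abs_mul_abs_self, div_self (mul_ne_zero h0 h0)]
  have h3 : fieldAt (X.rotate g o) x = o p • tangentCoordChange (𝓡∂ 2) p x x
      (rotField (chartMetric g p (extChartAt (𝓡∂ 2) p x))
        (chartField X p (extChartAt (𝓡∂ 2) p x))) := by
    rw [h1, smul_smul, ← ho, mul_assoc, hs, mul_one]
    rfl
  rw [chartField_apply _ hx, h3, map_smul, tangentCoordChange_comp_inverse hxx hx]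

/-- On an oriented surface, a Killing field commutes with its rotation by a right angle. -/
theorem IsKilling.exists_commute (hM : IsOrientableSurface M) {g : SurfaceMetric M} {r : ℕ∞}
    {X : VField M} (hX : X.IsC r) (hr : 1 ≤ r) (hK : IsKilling g X) :
    ∃ Y : VField M, X.Commute Y ∧ ∀ p, ∃ c : ℝ, c ≠ 0 ∧
      ∀ᶠ y in 𝓝[range (𝓡∂ 2)] (extChartAt (𝓡∂ 2) p p),
        chartField Y p y = c • rotField (chartMetric g p y) (chartField X p y) := by
  obtain ⟨o, ho, hop⟩ := hM.exists_sign
  have hev : ∀ p : M, ∀ᶠ y in 𝓝[range (𝓡∂ 2)] (extChartAt (𝓡∂ 2) p p),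
      y ∈ (extChartAt (𝓡∂ 2) p).target ∧ chartField (X.rotate g o) p y =
        o p • rotField (chartMetric g p y) (chartField X p y) := by
    intro p
    have h1 := (continuousAt_extChartAt_symm (I := 𝓡∂ 2) p).eventually
      (p := fun x => o x * ((tangentCoordChange (𝓡∂ 2) p x x).det /
        |(tangentCoordChange (𝓡∂ 2) p x x).det|) = o p) (by
          rw [(extChartAt (𝓡∂ 2) p).left_inv (mem_extChartAt_source p)]
          exact hop p)
    filter_upwards [eventually_nhdsWithin_of_eventually_nhds h1,
      extChartAt_target_mem_nhdsWithin (I := 𝓡∂ 2) p] with y hy hyt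
    refine ⟨hyt, ?_⟩
    have h2 := chartField_rotate X g ((extChartAt (𝓡∂ 2) p).map_target hyt) hy
    rwa [(extChartAt (𝓡∂ 2) p).right_inv hyt] at h2
  have hdiff : ∀ p : M, ∀ y ∈ (extChartAt (𝓡∂ 2) p).target,
      (extChartAt (𝓡∂ 2) p).target ∈ 𝓝[range (𝓡∂ 2)] y := fun p y hy =>
    extChartAt_target_mem_nhdsWithin_of_mem hy
  have hGc : ∀ p : M, ∀ y ∈ (extChartAt (𝓡∂ 2) p).target,
      ContDiffWithinAt ℝ 1 (chartMetric g p) (range (𝓡∂ 2)) y := fun p y hy =>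
    (((contDiffOn_chartMetric g p) y hy).of_le (by simp)).mono_of_mem_nhdsWithin (hdiff p y hy)
  have hXc : ∀ p : M, ∀ y ∈ (extChartAt (𝓡∂ 2) p).target,
      ContDiffWithinAt ℝ 1 (chartField X p) (range (𝓡∂ 2)) y := fun p y hy =>
    ((contDiffOn_chartField hX hr p) y hy).mono_of_mem_nhdsWithin (hdiff p y hy)
  have hgp : ∀ p : M, ∀ y ∈ (extChartAt (𝓡∂ 2) p).target, 0 < gramDet (chartMetric g p y) :=
    fun p y hy => gramDet_pos (chartMetric_symm g p y) (fun u hu => chartMetric_pos g hy hu)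
  refine ⟨X.rotate g o, ⟨hX.isChartC1 hr, fun p => ?_, fun p => ?_⟩, fun p =>
    ⟨o p, ho p, (hev p).mono fun y hy => hy.2⟩⟩
  · have hp := mem_extChartAt_target (I := 𝓡∂ 2) p
    refine ((contDiffWithinAt_rotField (hGc p _ hp) (hXc p _ hp) (hgp p _ hp)).const_smul
      (o p)).congr_of_eventuallyEq ((hev p).mono fun y hy => hy.2) ?_
    exact ((hev p).self_of_nhdsWithin (extChartAt_mem_range p p)).2
  -- The formula for the rotated field is needed on a neighbourhood of y in order to differentiate
  -- it at y.
  · filter_upwards [eventually_eventually_nhdsWithin.2 (hev p), self_mem_nhdsWithin] with y hy hyr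
    obtain ⟨hyt, hyY⟩ := hy.self_of_nhdsWithin hyr
    obtain ⟨R', hR', hRX⟩ := HasFDerivWithinAt.rotField_apply
      (((hGc p y hyt).differentiableWithinAt one_ne_zero).hasFDerivWithinAt)
      (((hXc p y hyt).differentiableWithinAt one_ne_zero).hasFDerivWithinAt) (hgp p y hyt)
      (chartMetric_symm g p y) (fun u v => hK p y hyt u v)
    have hY := (hR'.const_smul (o p)).congr_of_eventuallyEq (hy.mono fun z hz => hz.2) hyY
    rw [hY.fderivWithin ((𝓡∂ 2).uniqueDiffOn y hyr), hyY, smul_apply, hRX, map_smul]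

end RotatedField

/-! ### Unique continuation for C¹ Killing fields: the estimate -/

section UniqueContinuation

/-- If `∂ₓ f` is Lipschitz in `y`, then `∂_y f` is Lipschitz in `x`. -/
theorem abs_partial_sub_le {I J : Set ℝ} (hI : Convex ℝ I) {f s : ℝ → ℝ → ℝ} {L y d d' x x' : ℝ}
    (hs : ∀ x ∈ I, ∀ y ∈ J, HasDerivWithinAt (fun x => f x y) (s x y) I x)
    (hL : ∀ x ∈ I, ∀ y ∈ J, ∀ y' ∈ J, |s x y - s x y'| ≤ L * |y - y'|)
    (hy : y ∈ J) (hacc : (𝓝[J \ {y}] y).NeBot) (hx : x ∈ I) (hx' : x' ∈ I)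
    (hd : HasDerivWithinAt (f x) d J y) (hd' : HasDerivWithinAt (f x') d' J y) :
    |d - d'| ≤ L * |x - x'| := by
  -- The mean value inequality in x for f · y' - f · y; dividing by y' - y and letting y' tend to y
  -- gives the claim without second derivatives of f.
  have h1 : ∀ y' ∈ J, |(f x y' - f x' y') - (f x y - f x' y)| ≤ L * |y' - y| * |x - x'| := by
    intro y' hy'
    have := hI.norm_image_sub_le_of_norm_hasDerivWithin_le
      (f := fun x => f x y' - f x y) (f' := fun x => s x y' - s x y)
      (fun z hz => (hs z hz y' hy').sub (hs z hz y hy)) (fun z hz => hL z hz y' hy' y hy) hx' hx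
    rw [Real.norm_eq_abs, Real.norm_eq_abs] at this
    convert this using 2
    ring
  have h2 := hasDerivWithinAt_iff_tendsto_slope.1 (hd.sub hd')
  refine le_of_tendsto h2.abs ?_
  filter_upwards [self_mem_nhdsWithin] with y' hy'
  have hne : 0 < |y' - y| := abs_pos.2 (sub_ne_zero.2 hy'.2)
  rw [slope_def_field, abs_div, div_le_iff₀ hne]
  have := h1 y' hy'.1
  simp only [Pi.sub_apply]
  linarith

set_option maxSynthPendingDepth 3 in
set_option maxHeartbeats 1000000 in
/-- The key estimate: on a small rectangle, the derivative of a Killing field which vanishes to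
second order at a point is bounded by half of any bound that it satisfies. -/
theorem norm_fderiv_le_of_killing {I J : Set ℝ} (hI : Convex ℝ I) (hJ : Convex ℝ J) {a : Plane}
    {Q : Set Plane} (hQ : ∀ z : Plane, z ∈ Q ↔ z 0 ∈ I ∧ z 1 ∈ J)
    (haQ : a ∈ Q) (hIacc : ∀ x ∈ I, (𝓝[I \ {x}] x).NeBot) (hJacc : ∀ y ∈ J, (𝓝[J \ {y}] y).NeBot)
    {G : Plane → Plane →L[ℝ] Plane →L[ℝ] ℝ} {G' : Plane → Plane →L[ℝ] Plane →L[ℝ] Plane →L[ℝ] ℝ}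
    {G'' : Plane → Plane →L[ℝ] Plane →L[ℝ] Plane →L[ℝ] Plane →L[ℝ] ℝ}
    {X : Plane → Plane} {A : Plane → Plane →L[ℝ] Plane} {B C d m : ℝ}
    (hd1 : d ≤ 1) (hd : ∀ z ∈ Q, ‖z - a‖ ≤ d) (hC0 : 0 ≤ C) (hm : 0 < m)
    (hG : ∀ z ∈ Q, HasFDerivWithinAt G (G' z) Q z)
    (hG' : ∀ z ∈ Q, HasFDerivWithinAt G' (G'' z) Q z)
    (hX : ∀ z ∈ Q, HasFDerivWithinAt X (A z) Q z)
    (hs : ∀ z u v, G z u v = G z v u)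
    (hK : ∀ z ∈ Q, ∀ u v, G' z (X z) u v + G z (A z u) v + G z u (A z v) = 0)
    (hC' : ∀ z ∈ Q, ‖G' z‖ ≤ C) (hC'' : ∀ z ∈ Q, ‖G'' z‖ ≤ C)
    (hmG : ∀ z ∈ Q, ∀ u, m * ‖u‖ ^ 2 ≤ G z u u)
    (hXa : X a = 0) (hAa : A a = 0) (hB : ∀ z ∈ Q, ‖A z‖ ≤ B) :
    ∀ z ∈ Q, ‖A z‖ ≤ 88 * C * B * d / m := by
  have hB0 : 0 ≤ B := (norm_nonneg _).trans (hB a haQ)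
  have hd0 : 0 ≤ d := (norm_nonneg _).trans (hd a haQ)
  have hQc : Convex ℝ Q := by
    intro z hz w hw s t hs ht hst
    rw [hQ] at hz hw ⊢
    exact ⟨hI hz.1 hw.1 hs ht hst, hJ hz.2 hw.2 hs ht hst⟩
  have hXb : ∀ z ∈ Q, ‖X z‖ ≤ B * d := by
    intro z hz
    have := hQc.norm_image_sub_le_of_norm_hasFDerivWithin_le hX hB haQ hz
    rw [hXa, sub_zero] at this
    exact this.trans (mul_le_mul_of_nonneg_left (hd z hz) hB0)
  have hcoord : ∀ z ∈ Q, ∀ w ∈ Q, ∀ i, |z i - w i| ≤ 2 * d := by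
    intro z hz w hw i
    have h1 := (PiLp.norm_apply_le (z - w) i)
    have h2 : ‖z - w‖ ≤ ‖z - a‖ + ‖w - a‖ := by
      have := norm_sub_le (z - a) (w - a)
      rwa [sub_sub_sub_cancel_right] at this
    rw [Real.norm_eq_abs, PiLp.sub_apply] at h1
    linarith [hd z hz, hd w hw]
  have hun : ∀ i, ‖planeBasis i‖ = 1 := fun i => by simp [planeBasis]
  have hG'b : ∀ z ∈ Q, ∀ u v w : Plane, |G' z u v w| ≤ C * ‖u‖ * ‖v‖ * ‖w‖ := by
    intro z hz u v w
    have h1 := (G' z u v).le_opNorm w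
    have h2 := (G' z u).le_opNorm v
    have h3 := (G' z).le_of_opNorm_le (hC' z hz) u
    calc |G' z u v w| ≤ ‖G' z u v‖ * ‖w‖ := h1
      _ ≤ (‖G' z u‖ * ‖v‖) * ‖w‖ := by gcongr
      _ ≤ C * ‖u‖ * ‖v‖ * ‖w‖ := by gcongr
  have hG''b : ∀ z ∈ Q, ∀ t u v w : Plane, |G'' z t u v w| ≤ C * ‖t‖ * ‖u‖ * ‖v‖ * ‖w‖ := by
    intro z hz t u v w
    have h1 := (G'' z t u v).le_opNorm w
    have h2 := (G'' z t u).le_opNorm v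
    have h3 := (G'' z t).le_opNorm u
    have h4 := (G'' z).le_of_opNorm_le (hC'' z hz) t
    calc |G'' z t u v w| ≤ ‖G'' z t u v‖ * ‖w‖ := h1
      _ ≤ (‖G'' z t u‖ * ‖v‖) * ‖w‖ := by gcongr
      _ ≤ (‖G'' z t‖ * ‖u‖ * ‖v‖) * ‖w‖ := by gcongr
      _ ≤ C * ‖t‖ * ‖u‖ * ‖v‖ * ‖w‖ := by gcongr
  -- For the 1-form ξ = G(X, ·), the Killing equation prescribes the symmetrized derivative of ξ as
  -- S, which is of order zero in X. So S is C¹ although the derivative of ξ is only continuous. In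
  -- the bound 6 C B, each of the three terms contributes C B from G'' and C B from G'; the former
  -- uses d ≤ 1.
  set S : Plane → Plane → Plane → ℝ := fun u v z =>
    G' z u (X z) v + G' z v (X z) u - G' z (X z) u v with hS
  have hSd : ∀ i j, ∀ z ∈ Q, ∃ q : Plane →L[ℝ] ℝ,
      HasFDerivWithinAt (S (planeBasis i) (planeBasis j)) q Q z ∧ ‖q‖ ≤ 6 * C * B := by
    intro i j z hz
    have hterm : ∀ u v : Plane, HasFDerivWithinAt (fun z => G' z u (X z) v) _ Q z := fun u v =>
      ((((hG' z hz).clm_apply (hasFDerivWithinAt_const u z Q)).clm_apply (hX z hz)).clm_apply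
        (hasFDerivWithinAt_const v z Q))
    have hterm' : ∀ u v : Plane, HasFDerivWithinAt (fun z => G' z (X z) u v) _ Q z := fun u v =>
      ((((hG' z hz).clm_apply (hX z hz)).clm_apply (hasFDerivWithinAt_const u z Q)).clm_apply
        (hasFDerivWithinAt_const v z Q))
    refine ⟨_, ((hterm _ _).add (hterm _ _)).sub (hterm' _ _), ?_⟩
    refine ContinuousLinearMap.opNorm_le_bound _ (by positivity) fun t => ?_
    have e1 := hG''b z hz t (planeBasis i) (X z) (planeBasis j)
    have e2 := hG''b z hz t (planeBasis j) (X z) (planeBasis i)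
    have e3 := hG''b z hz t (X z) (planeBasis i) (planeBasis j)
    have e4 := hG'b z hz (planeBasis i) (A z t) (planeBasis j)
    have e5 := hG'b z hz (planeBasis j) (A z t) (planeBasis i)
    have e6 := hG'b z hz (A z t) (planeBasis i) (planeBasis j)
    simp only [hun, mul_one] at e1 e2 e3 e4 e5 e6
    have hXB : ‖X z‖ ≤ B := (hXb z hz).trans (by nlinarith)
    have hAB : ‖A z t‖ ≤ B * ‖t‖ := (A z).le_of_opNorm_le (hB z hz) t
    have f1 : C * ‖t‖ * ‖X z‖ ≤ C * B * ‖t‖ := by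
      have := mul_le_mul_of_nonneg_left hXB (mul_nonneg hC0 (norm_nonneg t))
      linarith
    have f2 : C * ‖A z t‖ ≤ C * B * ‖t‖ := by
      have := mul_le_mul_of_nonneg_left hAB hC0
      linarith
    simp only [add_apply, sub_apply, ContinuousLinearMap.comp_apply, ContinuousLinearMap.flip_apply,
      zero_apply, map_zero, zero_add, Real.norm_eq_abs]
    rw [abs_le] at *
    constructor <;> linarith
  have hSb : ∀ i j, ∀ z ∈ Q, |S (planeBasis i) (planeBasis j) z| ≤ 3 * C * B * d := by
    intro i j z hz
    have e4 := hG'b z hz (planeBasis i) (X z) (planeBasis j)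
    have e5 := hG'b z hz (planeBasis j) (X z) (planeBasis i)
    have e6 := hG'b z hz (X z) (planeBasis i) (planeBasis j)
    simp only [hun, mul_one] at e4 e5 e6
    have f2 := mul_le_mul_of_nonneg_left (hXb z hz) hC0
    simp only [hS]
    rw [abs_le] at *
    constructor <;> linarith
  have hSL : ∀ i j, ∀ z ∈ Q, ∀ w ∈ Q, |S (planeBasis i) (planeBasis j) z -
      S (planeBasis i) (planeBasis j) w| ≤ 6 * C * B * ‖z - w‖ := by
    intro i j z hz w hw
    choose! q hq hq' using hSd i j
    exact hQc.norm_image_sub_le_of_norm_hasFDerivWithin_le hq hq' hw hz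
  -- ξ' u v is the derivative in direction u of the component ξ(v).
  set ξ' : Plane → Plane → Plane → ℝ := fun u v z => G' z u (X z) v + G z (A z u) v with hξ'
  have hξd : ∀ v, ∀ z ∈ Q, ∃ q : Plane →L[ℝ] ℝ,
      HasFDerivWithinAt (fun z => G z (X z) v) q Q z ∧ ∀ u, q u = ξ' u v z := by
    intro v z hz
    refine ⟨_, ((hG z hz).clm_apply (hX z hz)).clm_apply (hasFDerivWithinAt_const v z Q),
      fun u => ?_⟩
    simp [hξ', add_comm]
  have hsum : ∀ z ∈ Q, ∀ u v, ξ' u v z + ξ' v u z = S u v z := by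
    intro z hz u v
    simp only [hξ', hS]
    have := hK z hz u v
    rw [hs z u (A z v)] at this
    linarith
  set P : ℝ → ℝ → Plane := fun x y => x • planeBasis 0 + y • planeBasis 1 with hP
  have hP0 : ∀ x y, P x y 0 = x := fun x y => by simp [hP]
  have hP1 : ∀ x y, P x y 1 = y := fun x y => by simp [hP]
  have hPQ : ∀ x y, x ∈ I → y ∈ J → P x y ∈ Q := fun x y hx hy =>
    (hQ _).2 ⟨by rwa [hP0], by rwa [hP1]⟩
  have hPz : ∀ z : Plane, P (z 0) (z 1) = z := fun z => (plane_eq z).symm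
  have hdx : ∀ v, ∀ x ∈ I, ∀ y ∈ J, HasDerivWithinAt (fun x => G (P x y) (X (P x y)) v)
      (ξ' (planeBasis 0) v (P x y)) I x := by
    intro v x hx y hy
    obtain ⟨q, hq, hq'⟩ := hξd v _ (hPQ x y hx hy)
    rw [← hq']
    refine hq.comp_hasDerivWithinAt (f := fun x => P x y) x ?_ (fun x hx => hPQ x y hx hy)
    have := ((hasDerivWithinAt_id x I).smul_const (planeBasis 0)).add_const (y • planeBasis 1)
    rwa [one_smul] at this
  have hdy : ∀ v, ∀ x ∈ I, ∀ y ∈ J, HasDerivWithinAt (fun y => G (P x y) (X (P x y)) v)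
      (ξ' (planeBasis 1) v (P x y)) J y := by
    intro v x hx y hy
    obtain ⟨q, hq, hq'⟩ := hξd v _ (hPQ x y hx hy)
    rw [← hq']
    refine hq.comp_hasDerivWithinAt (f := fun y => P x y) y ?_ (fun y hy => hPQ x y hx hy)
    have := ((hasDerivWithinAt_id y J).smul_const (planeBasis 1)).const_add (x • planeBasis 0)
    rwa [one_smul] at this
  have hdiag : ∀ i, ∀ z ∈ Q, ξ' (planeBasis i) (planeBasis i) z =
      S (planeBasis i) (planeBasis i) z / 2 := fun i z hz => by
    have := hsum z hz (planeBasis i) (planeBasis i)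
    linarith
  have hCB : 0 ≤ C * B := mul_nonneg hC0 hB0
  -- The diagonal derivative ∂₀ξ₀ = S₀₀ / 2 is Lipschitz in y, so ∂₁ξ₀ is Lipschitz in x. This
  -- replaces the commutation of second derivatives of ξ.
  have hvx : ∀ x ∈ I, ∀ x' ∈ I, ∀ y ∈ J, |ξ' (planeBasis 1) (planeBasis 0) (P x y) -
      ξ' (planeBasis 1) (planeBasis 0) (P x' y)| ≤ 3 * C * B * |x - x'| := by
    intro x hx x' hx' y hy
    refine abs_partial_sub_le (J := J) hI (hdx (planeBasis 0)) ?_ hy (hJacc y hy) hx hx'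
      (hdy _ x hx y hy) (hdy _ x' hx' y hy)
    intro x hx y hy y' hy'
    rw [hdiag 0 _ (hPQ x y hx hy), hdiag 0 _ (hPQ x y' hx hy'), ← sub_div, abs_div, abs_two]
    have h1 := hSL 0 0 _ (hPQ x y hx hy) _ (hPQ x y' hx hy')
    have h2 : P x y - P x y' = (y - y') • planeBasis 1 := by
      simp only [hP, sub_smul]
      abel
    rw [h2, norm_smul, hun, mul_one, Real.norm_eq_abs] at h1
    linarith
  have hvy : ∀ x ∈ I, ∀ y ∈ J, ∀ y' ∈ J, |ξ' (planeBasis 0) (planeBasis 1) (P x y) -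
      ξ' (planeBasis 0) (planeBasis 1) (P x y')| ≤ 3 * C * B * |y - y'| := by
    intro x hx y hy y' hy'
    refine abs_partial_sub_le (f := fun y x => G (P x y) (X (P x y)) (planeBasis 1)) (J := I) hJ
      (fun y hy x hx => hdy (planeBasis 1) x hx y hy) ?_ hx (hIacc x hx) hy hy'
      (hdx _ x hx y hy) (hdx _ x hx y' hy')
    intro y hy x hx x' hx'
    rw [hdiag 1 _ (hPQ x y hx hy), hdiag 1 _ (hPQ x' y hx' hy), ← sub_div, abs_div, abs_two]
    have h1 := hSL 1 1 _ (hPQ x y hx hy) _ (hPQ x' y hx' hy)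
    have h2 : P x y - P x' y = (x - x') • planeBasis 0 := by
      simp only [hP, sub_smul]
      abel
    rw [h2, norm_smul, hun, mul_one, Real.norm_eq_abs] at h1
    linarith
  have haIJ := (hQ a).1 haQ
  -- From a to z along two sides of a rectangle: `hvx` controls ∂₁ξ₀ along the first side. On the
  -- second, ∂₀ξ₁ is controlled by `hvy`, and ∂₁ξ₀ + ∂₀ξ₁ = S₀₁ converts one into the other at both
  -- ends. The constant is 18 = 6 + 6 + 3 + 3.
  have hΩ : ∀ z ∈ Q, |ξ' (planeBasis 1) (planeBasis 0) z| ≤ 18 * C * B * d := by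
    intro z hz
    have hzIJ := (hQ z).1 hz
    have hwQ := hPQ _ _ hzIJ.1 haIJ.2
    have e1 := hvx _ hzIJ.1 _ haIJ.1 _ haIJ.2
    have e2 := hvy _ hzIJ.1 _ hzIJ.2 _ haIJ.2
    rw [hPz] at e1 e2
    have e3 := hsum z hz (planeBasis 0) (planeBasis 1)
    have e4 := hsum _ hwQ (planeBasis 0) (planeBasis 1)
    have e5 := hSb 0 1 z hz
    have e6 := hSb 0 1 _ hwQ
    have e7 : ξ' (planeBasis 1) (planeBasis 0) a = 0 := by simp [hξ', hXa, hAa]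
    have e8 := mul_le_mul_of_nonneg_left (hcoord z hz a haQ 0) hCB
    have e9 := mul_le_mul_of_nonneg_left (hcoord z hz a haQ 1) hCB
    rw [e7, sub_zero] at e1
    rw [abs_le] at e1 e2 e5 e6 ⊢
    constructor <;> linarith
  -- One more use of S₀₁ for ∂₀ξ₁ adds 3 to 18.
  have hall : ∀ i j, ∀ z ∈ Q, |ξ' (planeBasis i) (planeBasis j) z| ≤ 21 * C * B * d := by
    intro i j z hz
    have hCBd : 0 ≤ C * B * d := mul_nonneg hCB hd0
    have e3 := hsum z hz (planeBasis 0) (planeBasis 1)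
    have e5 := hSb 0 1 z hz
    have e6 := hΩ z hz
    have e7 := hdiag 0 z hz
    have e8 := hdiag 1 z hz
    have e9 := hSb 0 0 z hz
    have e10 := hSb 1 1 z hz
    rw [abs_le] at *
    fin_cases i <;> fin_cases j <;> simp only [Fin.zero_eta, Fin.mk_one] <;>
      constructor <;> linarith
  intro z hz
  -- Removing the term G' z u (X z) v from ξ' adds 1 to 21. The two doublings that follow, to 44 and
  -- 88, come from summing over two coordinates.
  have hGA : ∀ i j, |G z (A z (planeBasis i)) (planeBasis j)| ≤ 22 * C * B * d := by
    intro i j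
    have e1 := hall i j z hz
    have e4 := hG'b z hz (planeBasis i) (X z) (planeBasis j)
    simp only [hun, mul_one] at e4
    have f2 := mul_le_mul_of_nonneg_left (hXb z hz) hC0
    simp only [hξ'] at e1
    rw [abs_le] at *
    constructor <;> linarith
  have hCBd : 0 ≤ C * B * d := mul_nonneg hCB hd0
  have hAi : ∀ i, ‖A z (planeBasis i)‖ ≤ 44 * C * B * d / m := by
    intro i
    set w := A z (planeBasis i) with hw
    have e1 := hmG z hz w
    have e2 := plane_map (G z w) w
    have e3 : |w 0| ≤ ‖w‖ := PiLp.norm_apply_le w 0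
    have e4 : |w 1| ≤ ‖w‖ := PiLp.norm_apply_le w 1
    have e5 : G z w w ≤ 44 * C * B * d * ‖w‖ := by
      rw [e2, smul_eq_mul, smul_eq_mul]
      calc _ ≤ |w 0| * |G z w (planeBasis 0)| + |w 1| * |G z w (planeBasis 1)| := by
            rw [← abs_mul, ← abs_mul]
            exact add_le_add (le_abs_self _) (le_abs_self _)
        _ ≤ ‖w‖ * (22 * C * B * d) + ‖w‖ * (22 * C * B * d) := by
            gcongr
            · exact hGA i 0
            · exact hGA i 1
        _ = _ := by ring
    rw [le_div_iff₀ hm]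
    rcases eq_or_lt_of_le (norm_nonneg w) with h | h
    · rw [← h]
      linarith
    · refine le_of_mul_le_mul_right ?_ h
      linarith
  refine ContinuousLinearMap.opNorm_le_bound _ (by positivity) fun t => ?_
  rw [plane_map (A z) t]
  have e3 : |t 0| ≤ ‖t‖ := PiLp.norm_apply_le t 0
  have e4 : |t 1| ≤ ‖t‖ := PiLp.norm_apply_le t 1
  calc _ ≤ ‖t 0 • A z (planeBasis 0)‖ + ‖t 1 • A z (planeBasis 1)‖ := norm_add_le _ _
    _ = |t 0| * ‖A z (planeBasis 0)‖ + |t 1| * ‖A z (planeBasis 1)‖ := by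
        rw [norm_smul, norm_smul, Real.norm_eq_abs, Real.norm_eq_abs]
    _ ≤ ‖t‖ * (44 * C * B * d / m) + ‖t‖ * (44 * C * B * d / m) := by
        gcongr
        · exact hAi 0
        · exact hAi 1
    _ = _ := by ring

end UniqueContinuation

/-! ### Unique continuation for C¹ Killing fields: local vanishing -/

section ChartDerivatives

variable {M : Type*} [TopologicalSpace M] [ChartedSpace (EuclideanHalfSpace 2) M]
  [IsManifold (𝓡∂ 2) ∞ M]

theorem contDiffWithinAt_chartMetric (g : SurfaceMetric M) {p : M} {y : Plane}
    (hy : y ∈ (extChartAt (𝓡∂ 2) p).target) :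
    ContDiffWithinAt ℝ ∞ (chartMetric g p) (range (𝓡∂ 2)) y :=
  ((contDiffOn_chartMetric g p) y hy).mono_of_mem_nhdsWithin
    (extChartAt_target_mem_nhdsWithin_of_mem hy)

theorem hasFDerivWithinAt_chartMetric (g : SurfaceMetric M) {p : M} {y : Plane}
    (hy : y ∈ (extChartAt (𝓡∂ 2) p).target) :
    HasFDerivWithinAt (chartMetric g p) (chartMetricDeriv g p y) (range (𝓡∂ 2)) y :=
  ((contDiffWithinAt_chartMetric g hy).differentiableWithinAt (by simp)).hasFDerivWithinAt

set_option maxSynthPendingDepth 3 in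
theorem contDiffWithinAt_chartMetricDeriv (g : SurfaceMetric M) {p : M} {y : Plane}
    (hy : y ∈ (extChartAt (𝓡∂ 2) p).target) :
    ContDiffWithinAt ℝ ∞ (chartMetricDeriv g p) (range (𝓡∂ 2)) y :=
  (contDiffWithinAt_chartMetric g hy).fderivWithin_right (𝓡∂ 2).uniqueDiffOn (by simp)
    (extChartAt_target_subset_range p hy)

theorem VField.IsC.hasFDerivWithinAt {r : ℕ∞} {X : VField M} (hX : X.IsC r) (hr : 1 ≤ r) {p : M}
    {y : Plane} (hy : y ∈ (extChartAt (𝓡∂ 2) p).target) :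
    HasFDerivWithinAt (chartField X p) (chartFieldDeriv X p y) (range (𝓡∂ 2)) y :=
  ((((contDiffOn_chartField hX hr p) y hy).mono_of_mem_nhdsWithin
    (extChartAt_target_mem_nhdsWithin_of_mem hy)).differentiableWithinAt
      one_ne_zero).hasFDerivWithinAt

theorem VField.IsC.continuousWithinAt_chartFieldDeriv {r : ℕ∞} {X : VField M} (hX : X.IsC r)
    (hr : 1 ≤ r) {p : M} {y : Plane} (hy : y ∈ (extChartAt (𝓡∂ 2) p).target) :
    ContinuousWithinAt (chartFieldDeriv X p) (range (𝓡∂ 2)) y :=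
  ((((contDiffOn_chartField hX hr p) y hy).mono_of_mem_nhdsWithin
    (extChartAt_target_mem_nhdsWithin_of_mem hy)).fderivWithin_right (m := 0)
      (𝓡∂ 2).uniqueDiffOn (by simp) (extChartAt_target_subset_range p hy)).continuousWithinAt

/-- On a compact subset of a chart, the metric is bounded below by the euclidean metric. -/
theorem exists_chartMetric_ge (g : SurfaceMetric M) {p : M} {K : Set Plane} (hK : IsCompact K)
    (hKt : K ⊆ (extChartAt (𝓡∂ 2) p).target) :
    ∃ m, 0 < m ∧ ∀ y ∈ K, ∀ u, m * ‖u‖ ^ 2 ≤ chartMetric g p y u u := by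
  have hc : ContinuousOn (fun z : Plane × Plane => chartMetric g p z.1 z.2 z.2)
      (K ×ˢ Metric.sphere 0 1) := by
    have h1 : ContinuousOn (fun z : Plane × Plane => chartMetric g p z.1) (K ×ˢ Metric.sphere 0 1) :=
      ((contDiffOn_chartMetric g p).continuousOn.mono hKt).comp continuousOn_fst
        (fun z hz => hz.1)
    exact (h1.clm_apply continuousOn_snd).clm_apply continuousOn_snd
  rcases K.eq_empty_or_nonempty with rfl | ⟨y₀, hy₀⟩
  · exact ⟨1, one_pos, by simp⟩
  have hne : (K ×ˢ Metric.sphere (0 : Plane) 1).Nonempty :=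
    ⟨(y₀, planeBasis 0), hy₀, by simp [planeBasis]⟩
  -- The constant is the minimum over K times the unit sphere; homogeneity extends the bound to all
  -- vectors.
  obtain ⟨⟨y₁, u₁⟩, ⟨hy₁, hu₁⟩, hmin⟩ := (hK.prod (isCompact_sphere 0 1)).exists_isMinOn hne hc
  have hu₁' : u₁ ≠ 0 := by
    rintro rfl
    simp at hu₁
  refine ⟨chartMetric g p y₁ u₁ u₁, chartMetric_pos g (hKt hy₁) hu₁', fun y hy u => ?_⟩
  rcases eq_or_ne u 0 with rfl | hu
  · simp
  have hun : ‖u‖ ≠ 0 := norm_ne_zero_iff.2 hu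
  have h1 := hmin (show (y, ‖u‖⁻¹ • u) ∈ K ×ˢ Metric.sphere (0 : Plane) 1 from
    ⟨hy, by simp [norm_smul, hun]⟩)
  simp only [mem_ofPred_eq, map_smul, smul_apply, smul_eq_mul] at h1
  calc chartMetric g p y₁ u₁ u₁ * ‖u‖ ^ 2
      ≤ (‖u‖⁻¹ * (‖u‖⁻¹ * chartMetric g p y u u)) * ‖u‖ ^ 2 := by gcongr
    _ = chartMetric g p y u u := by field_simp

theorem mem_range_halfSpace {y : Plane} : y ∈ range (𝓡∂ 2) ↔ 0 ≤ y 0 := by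
  rw [range_modelWithCornersEuclideanHalfSpace]
  rfl

/-- At a point that is not an accumulation point every linear map is a derivative, which would
contradict unique differentiability on a nontrivial interval. -/
theorem neBot_nhdsWithin_Icc_diff {l u x : ℝ} (h : l < u) (hx : x ∈ Icc l u) :
    (𝓝[Icc l u \ {x}] x).NeBot := by
  have h1 : AccPt x (𝓟 (Icc l u)) := by
    by_contra h2
    have h3 := HasFDerivWithinAt.of_not_accPt (𝕜 := ℝ) (f := fun t : ℝ => t)
      (f' := (0 : ℝ →L[ℝ] ℝ)) h2
    have h4 := (uniqueDiffOn_Icc h).eq hx h3 (hasFDerivWithinAt_id x _)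
    have := congrArg (fun q : ℝ →L[ℝ] ℝ => q 1) h4
    simp at this
  exact accPt_principal_iff_nhdsWithin.1 h1

set_option maxSynthPendingDepth 3 in
/-- A Killing field which vanishes to second order at a point vanishes near that point. -/
theorem IsKilling.eventually_eq_zero {g : SurfaceMetric M} {r : ℕ∞} {X : VField M}
    (hX : X.IsC r) (hr : 1 ≤ r) (hK : IsKilling g X) {p : M} (h0 : X p = 0)
    (h1 : linearization X p = 0) : ∀ᶠ x in 𝓝 p, X x = 0 := by
  set a := extChartAt (𝓡∂ 2) p p with ha
  obtain ⟨R, hR0, hRt⟩ := ((eventually_mem_nhdsWithin (a := (0 : ℝ)) (s := Ioi 0)).and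
    (eventually_forall_closedBall (extChartAt_target_mem_nhdsWithin (I := 𝓡∂ 2) p))).exists
  rw [mem_Ioi] at hR0
  set K := Metric.closedBall a R ∩ range (𝓡∂ 2) with hKdef
  have hKc : IsCompact K := isCompact_closedBall_inter_range a R
  have hKt : K ⊆ (extChartAt (𝓡∂ 2) p).target := hRt
  have hKr : K ⊆ range (𝓡∂ 2) := inter_subset_right
  obtain ⟨m, hm, hmG⟩ := exists_chartMetric_ge g hKc hKt
  obtain ⟨C₁, hC₁⟩ := (hKc.image_of_continuousOn (f := chartMetricDeriv g p) (fun y hy =>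
    ((contDiffWithinAt_chartMetricDeriv g (hKt hy)).continuousWithinAt.mono
      hKr))).isBounded.exists_norm_le
  have hD : ∀ y ∈ K, ContDiffWithinAt ℝ ∞ (chartMetricDeriv g p) (range (𝓡∂ 2)) y := fun y hy =>
    contDiffWithinAt_chartMetricDeriv g (hKt hy)
  obtain ⟨C₂, hC₂⟩ := (hKc.image_of_continuousOn
    (f := fderivWithin ℝ (chartMetricDeriv g p) (range (𝓡∂ 2))) (fun y hy =>
    (((hD y hy).fderivWithin_right (m := 0) (𝓡∂ 2).uniqueDiffOn (by simp)
      (hKr hy)).continuousWithinAt.mono hKr))).isBounded.exists_norm_le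
  obtain ⟨B₀, hB₀⟩ := (hKc.image_of_continuousOn (f := chartFieldDeriv X p) (fun y hy =>
    ((hX.continuousWithinAt_chartFieldDeriv hr (hKt hy)).mono hKr))).isBounded.exists_norm_le
  have haK : a ∈ K := ⟨Metric.mem_closedBall_self hR0.le, extChartAt_mem_range p p⟩
  set C := max C₁ C₂
  have hC0 : 0 ≤ C := (norm_nonneg _).trans ((hC₁ _ ⟨a, haK, rfl⟩).trans (le_max_left _ _))
  -- The rectangle of half-width ρ lies within 2 * ρ of its centre, which is the d of
  -- `norm_fderiv_le_of_killing`; the last condition turns that estimate into a halving.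
  obtain ⟨ρ, hρ0, hρR, hρ1, hρC⟩ : ∃ ρ, 0 < ρ ∧ 2 * ρ ≤ R ∧ 2 * ρ ≤ 1 ∧
      88 * C * (2 * ρ) / m ≤ 1 / 2 := by
    have e1 : ∀ᶠ ρ in 𝓝[>] (0 : ℝ), 2 * ρ < R :=
      (((continuous_const_mul (2 : ℝ)).tendsto' 0 0 (by simp)).eventually_lt_const
        hR0).filter_mono nhdsWithin_le_nhds
    have e2 : ∀ᶠ ρ in 𝓝[>] (0 : ℝ), 2 * ρ < 1 :=
      (((continuous_const_mul (2 : ℝ)).tendsto' 0 0 (by simp)).eventually_lt_const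
        one_pos).filter_mono nhdsWithin_le_nhds
    have e3 : ∀ᶠ ρ in 𝓝[>] (0 : ℝ), 88 * C * (2 * ρ) / m < 1 / 2 := by
      have : Continuous fun ρ : ℝ => 88 * C * (2 * ρ) / m := by fun_prop
      exact ((this.tendsto' 0 0 (by simp)).eventually_lt_const
        (by norm_num)).filter_mono nhdsWithin_le_nhds
    obtain ⟨ρ, hρ, h⟩ := ((eventually_mem_nhdsWithin (a := (0 : ℝ)) (s := Ioi 0)).and
      (e1.and (e2.and e3))).exists
    exact ⟨ρ, hρ, h.1.le, h.2.1.le, h.2.2.le⟩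
  have ha0 : 0 ≤ a 0 := mem_range_halfSpace.1 (extChartAt_mem_range p p)
  -- The maximum with 0 cuts the rectangle off at the boundary of the half plane.
  set I := Icc (max (a 0 - ρ) 0) (a 0 + ρ)
  set J := Icc (a 1 - ρ) (a 1 + ρ)
  set Q : Set Plane := {z | z 0 ∈ I ∧ z 1 ∈ J} with hQdef
  have haQ : a ∈ Q := ⟨⟨max_le (by linarith) ha0, by linarith⟩, ⟨by linarith, by linarith⟩⟩
  have hQd : ∀ z ∈ Q, ‖z - a‖ ≤ 2 * ρ := by
    intro z hz
    have e0 : |z 0 - a 0| ≤ ρ := abs_le.2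
      ⟨by linarith [(le_max_left _ _).trans hz.1.1], by linarith [hz.1.2]⟩
    have e1 : |z 1 - a 1| ≤ ρ := abs_le.2 ⟨by linarith [hz.2.1], by linarith [hz.2.2]⟩
    rw [plane_eq (z - a)]
    refine (norm_add_le _ _).trans ?_
    rw [norm_smul, norm_smul]
    simp only [PiLp.sub_apply, Real.norm_eq_abs, PiLp.norm_single, abs_one, mul_one,
      planeBasis]
    linarith
  have hQK : Q ⊆ K := fun z hz => ⟨by
    rw [Metric.mem_closedBall, dist_eq_norm]
    exact (hQd z hz).trans hρR, mem_range_halfSpace.2 ((le_max_right _ _).trans hz.1.1)⟩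
  have hXa : chartField X p a = 0 := by
    rw [ha, chartField_self]
    exact h0
  -- Every bound for the derivative on Q can be halved, and iterating shows that the derivative
  -- vanishes on Q.
  have step : ∀ B, (∀ z ∈ Q, ‖chartFieldDeriv X p z‖ ≤ B) →
      ∀ z ∈ Q, ‖chartFieldDeriv X p z‖ ≤ B / 2 := by
    intro B hB z hz
    have hB0 : 0 ≤ B := (norm_nonneg _).trans (hB a haQ)
    have h := norm_fderiv_le_of_killing (convex_Icc _ _) (convex_Icc _ _) (I := I) (J := J)
      (a := a) (Q := Q) (fun z => Iff.rfl) haQ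
      (fun x hx => neBot_nhdsWithin_Icc_diff (max_lt (by linarith) (by linarith)) hx)
      (fun x hx => neBot_nhdsWithin_Icc_diff (by linarith) hx)
      (G := chartMetric g p) (G' := chartMetricDeriv g p)
      (G'' := fderivWithin ℝ (chartMetricDeriv g p) (range (𝓡∂ 2)))
      (X := chartField X p) (A := chartFieldDeriv X p) (B := B) (C := C) (d := 2 * ρ) (m := m)
      hρ1 hQd hC0 hm
      (fun z hz => (hasFDerivWithinAt_chartMetric g (hKt (hQK hz))).mono (hQK.trans hKr))
      (fun z hz => (((hD z (hQK hz)).differentiableWithinAt (by simp)).hasFDerivWithinAt).mono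
        (hQK.trans hKr))
      (fun z hz => (hX.hasFDerivWithinAt hr (hKt (hQK hz))).mono (hQK.trans hKr))
      (chartMetric_symm g p) (fun z hz u v => hK p z (hKt (hQK hz)) u v)
      (fun z hz => (hC₁ _ ⟨z, hQK hz, rfl⟩).trans (le_max_left _ _))
      (fun z hz => (hC₂ _ ⟨z, hQK hz, rfl⟩).trans (le_max_right _ _))
      (fun z hz => hmG z (hQK hz)) hXa h1 hB z hz
    calc _ ≤ 88 * C * B * (2 * ρ) / m := h
      _ = B * (88 * C * (2 * ρ) / m) := by ring
      _ ≤ B * (1 / 2) := by gcongr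
      _ = B / 2 := by ring
  have hA0 : ∀ z ∈ Q, chartFieldDeriv X p z = 0 := by
    have h2 : ∀ n : ℕ, ∀ z ∈ Q, ‖chartFieldDeriv X p z‖ ≤ B₀ * (1 / 2) ^ n := by
      intro n
      induction n with
      | zero => exact fun z hz => by simpa using hB₀ _ ⟨z, hQK hz, rfl⟩
      | succ n ih =>
        intro z hz
        have := step _ ih z hz
        rw [pow_succ]
        linarith
    intro z hz
    have h3 : Tendsto (fun n : ℕ => B₀ * (1 / 2 : ℝ) ^ n) atTop (𝓝 0) := by
      have := (tendsto_pow_atTop_nhds_zero_of_lt_one (r := (1 / 2 : ℝ)) (by norm_num)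
        (by norm_num)).const_mul B₀
      rwa [mul_zero] at this
    exact norm_le_zero_iff.1 (ge_of_tendsto' h3 fun n => h2 n z hz)
  have hQc : Convex ℝ Q := by
    intro z hz w hw s t hs ht hst
    exact ⟨(convex_Icc _ _) hz.1 hw.1 hs ht hst, (convex_Icc _ _) hz.2 hw.2 hs ht hst⟩
  have hX0 : ∀ z ∈ Q, chartField X p z = 0 := by
    intro z hz
    have := hQc.norm_image_sub_le_of_norm_hasFDerivWithin_le (C := 0)
      (fun z hz => (hX.hasFDerivWithinAt hr (hKt (hQK hz))).mono (hQK.trans hKr))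
      (fun z hz => by rw [hA0 z hz, norm_zero]) haQ hz
    rw [hXa, sub_zero, zero_mul] at this
    exact norm_le_zero_iff.1 this
  have hc0 : ∀ i : Fin 2, ContinuousAt (fun x => extChartAt (𝓡∂ 2) p x i) p := fun i =>
    ((continuous_apply i).comp (PiLp.continuous_ofLp 2 _)).continuousAt.comp
      (continuousAt_extChartAt (I := 𝓡∂ 2) p)
  filter_upwards [extChartAt_source_mem_nhds (I := 𝓡∂ 2) p,
    (hc0 0).eventually (Ioo_mem_nhds (show a 0 - ρ < a 0 by linarith)
      (show a 0 < a 0 + ρ by linarith)),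
    (hc0 1).eventually (Ioo_mem_nhds (show a 1 - ρ < a 1 by linarith)
      (show a 1 < a 1 + ρ by linarith))] with x hx hx0 hx1
  rw [← chartField_eq_zero_iff X hx]
  exact hX0 _ ⟨⟨max_le hx0.1.le (mem_range_halfSpace.1 (extChartAt_mem_range p x)), hx0.2.le⟩,
    ⟨hx1.1.le, hx1.2.le⟩⟩

end ChartDerivatives

/-! ### Zeros: skew linearization, nondegeneracy, and absence from the boundary -/

section Zeros

variable {M : Type*} [TopologicalSpace M] [ChartedSpace (EuclideanHalfSpace 2) M]
  [IsManifold (𝓡∂ 2) ∞ M]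

theorem isBoundaryPoint_of_extChartAt_eq_zero {p x : M} (hx : x ∈ (extChartAt (𝓡∂ 2) p).source)
    (h0 : extChartAt (𝓡∂ 2) p x 0 = 0) : (𝓡∂ 2).IsBoundaryPoint x := by
  rw [(𝓡∂ 2).isBoundaryPoint_iff_not_isInteriorPoint]
  intro h
  rw [extChartAt_source] at hx
  rw [(𝓡∂ 2).isInteriorPoint_iff_of_mem_atlas (n := ∞) (by simp) (chart_mem_atlas _ p) hx] at h
  have h1 := OpenPartialHomeomorph.interior_extend_target_subset_interior_range _ h
  rw [interior_range_modelWithCornersEuclideanHalfSpace] at h1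
  have h2 : 0 < extChartAt (𝓡∂ 2) p x 0 := h1
  exact h2.ne' h0

/-- Along the boundary line in direction v, the coordinate 0 of the transition map is nonnegative
and vanishes at x. It has a minimum there, so its derivative is zero. -/
theorem tangentCoordChange_boundary {p x : M} (hx : x ∈ (extChartAt (𝓡∂ 2) p).source)
    (h0 : extChartAt (𝓡∂ 2) p x 0 = 0) {p' : M} (hx' : x ∈ (extChartAt (𝓡∂ 2) p').source)
    {v : Plane} (hv : v 0 = 0) : tangentCoordChange (𝓡∂ 2) p' p x v 0 = 0 := by
  have hb := isBoundaryPoint_of_extChartAt_eq_zero hx h0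
  have h0' : extChartAt (𝓡∂ 2) p' x 0 = 0 := by
    by_contra hne
    have hpos : 0 < extChartAt (𝓡∂ 2) p' x 0 :=
      lt_of_le_of_ne (mem_range_halfSpace.1 (extChartAt_mem_range p' x)) (Ne.symm hne)
    refine (𝓡∂ 2).isBoundaryPoint_iff_not_isInteriorPoint x |>.1 hb ?_
    have hx'' := hx'
    rw [extChartAt_source] at hx''
    rw [(𝓡∂ 2).isInteriorPoint_iff_of_mem_atlas (n := ∞) (by simp) (chart_mem_atlas _ p') hx'']
    refine (chartAt (EuclideanHalfSpace 2) p').mem_interior_extend_target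
      ((chartAt (EuclideanHalfSpace 2) p').map_source hx'') ?_
    rw [interior_range_modelWithCornersEuclideanHalfSpace]
    exact hpos
  set y := extChartAt (𝓡∂ 2) p' x
  set ψ := extChartAt (𝓡∂ 2) p ∘ (extChartAt (𝓡∂ 2) p').symm
  have hψ : HasFDerivWithinAt ψ (tangentCoordChange (𝓡∂ 2) p' p x) (range (𝓡∂ 2)) y :=
    hasFDerivWithinAt_tangentCoordChange ⟨hx', hx⟩
  have hline : HasDerivAt (fun t : ℝ => y + t • v) v 0 := by
    have := ((hasDerivAt_id (0 : ℝ)).smul_const v).const_add y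
    rwa [one_smul] at this
  have hmem : ∀ t : ℝ, y + t • v ∈ range (𝓡∂ 2) := fun t =>
    mem_range_halfSpace.2 (by simp [hv, h0'])
  have hψ' : HasFDerivWithinAt ψ (tangentCoordChange (𝓡∂ 2) p' p x) (range (𝓡∂ 2))
      (y + (0 : ℝ) • v) := by simpa using hψ
  have h1 : HasDerivAt (fun t : ℝ => ψ (y + t • v)) (tangentCoordChange (𝓡∂ 2) p' p x v) 0 :=
    hψ'.comp_hasDerivAt (f := fun t : ℝ => y + t • v) 0 hline (Eventually.of_forall hmem)
  have h2 : HasDerivAt (fun t : ℝ => ψ (y + t • v) 0) (tangentCoordChange (𝓡∂ 2) p' p x v 0) 0 :=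
    ((EuclideanSpace.proj (𝕜 := ℝ) (0 : Fin 2)).hasFDerivAt).comp_hasDerivAt 0 h1
  refine IsLocalMin.hasDerivAt_eq_zero (Eventually.of_forall fun t => ?_) h2
  have e1 : ψ (y + (0 : ℝ) • v) 0 = 0 := by
    rw [zero_smul, add_zero]
    change extChartAt (𝓡∂ 2) p ((extChartAt (𝓡∂ 2) p').symm (extChartAt (𝓡∂ 2) p' x)) 0 = 0
    rw [(extChartAt (𝓡∂ 2) p').left_inv hx', h0]
  change ψ (y + (0 : ℝ) • v) 0 ≤ ψ (y + t • v) 0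
  rw [e1]
  exact mem_range_halfSpace.1 (extChartAt_mem_range p _)

theorem IsTangentToBoundary.chartField_eq_zero {X : VField M} (hX : IsTangentToBoundary X)
    {p x : M} (hx : x ∈ (extChartAt (𝓡∂ 2) p).source) (h0 : extChartAt (𝓡∂ 2) p x 0 = 0) :
    chartField X p (extChartAt (𝓡∂ 2) p x) 0 = 0 := by
  have hb := isBoundaryPoint_of_extChartAt_eq_zero hx h0
  have h1 := hX x hb
  rw [chartField_self] at h1
  rw [chartField_apply X hx]
  exact tangentCoordChange_boundary hx h0 (mem_extChartAt_source x) h1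

/-- At a zero of a Killing field, the linearization is skew. -/
theorem IsKilling.linearization_skew {g : SurfaceMetric M} {X : VField M} (hK : IsKilling g X)
    {p : M} (h0 : X p = 0) (u v : Plane) :
    innerAt g p (linearization X p u) v + innerAt g p u (linearization X p v) = 0 := by
  have h := hK p _ (mem_extChartAt_target p) u v
  unfold lieDerivMetric at h
  have h1 : chartField X p (extChartAt (𝓡∂ 2) p p) = 0 := by
    rw [chartField_self]
    exact h0
  rw [h1, map_zero, chartMetric_self, chartMetric_self] at h
  simpa [linearization] using h

theorem innerAt_pos (g : SurfaceMetric M) (p : M) {u : Plane} (hu : u ≠ 0) :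
    0 < innerAt g p u u := g.pos p u hu

theorem innerAt_symm (g : SurfaceMetric M) (p : M) (u v : Plane) :
    innerAt g p u v = innerAt g p v u := g.symm p u v

/-- A Killing field which is tangent to the boundary vanishes to second order at its zeros on
the boundary. -/
theorem IsKilling.linearization_eq_zero_of_boundary {g : SurfaceMetric M} {r : ℕ∞} {X : VField M}
    (hX : X.IsC r) (hr : 1 ≤ r) (hK : IsKilling g X) (hbd : IsTangentToBoundary X) {p : M}
    (h0 : X p = 0) (hp : extChartAt (𝓡∂ 2) p p 0 = 0) : linearization X p = 0 := by
  set A := linearization X p with hA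
  set y := extChartAt (𝓡∂ 2) p p with hy
  have hd : HasFDerivWithinAt (chartField X p) A (range (𝓡∂ 2)) (y + (0 : ℝ) • planeBasis 1) := by
    rw [zero_smul, add_zero]
    exact hX.hasFDerivWithinAt hr (mem_extChartAt_target p)
  have hline : HasDerivAt (fun t : ℝ => y + t • planeBasis 1) (planeBasis 1) 0 := by
    have := ((hasDerivAt_id (0 : ℝ)).smul_const (planeBasis 1)).const_add y
    rwa [one_smul] at this
  have hmem : ∀ t : ℝ, y + t • planeBasis 1 ∈ range (𝓡∂ 2) := fun t =>
    mem_range_halfSpace.2 (by simp [hp])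
  have h1 : HasDerivAt (fun t : ℝ => chartField X p (y + t • planeBasis 1)) (A (planeBasis 1)) 0 :=
    hd.comp_hasDerivAt (f := fun t : ℝ => y + t • planeBasis 1) 0 hline (Eventually.of_forall hmem)
  have h2 : HasDerivAt (fun t : ℝ => chartField X p (y + t • planeBasis 1) 0)
      (A (planeBasis 1) 0) 0 :=
    ((EuclideanSpace.proj (𝕜 := ℝ) (0 : Fin 2)).hasFDerivAt).comp_hasDerivAt 0 h1
  have htend : Tendsto (fun t : ℝ => y + t • planeBasis 1) (𝓝 0) (𝓝[range (𝓡∂ 2)] y) :=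
    tendsto_nhdsWithin_iff.2 ⟨by simpa using hline.continuousAt.tendsto,
      Eventually.of_forall hmem⟩
  -- Tangency at all boundary points near p, not only at p, makes the normal component vanish along
  -- the whole boundary line.
  have h3 : (fun t : ℝ => chartField X p (y + t • planeBasis 1) 0) =ᶠ[𝓝 0] fun _ => 0 := by
    filter_upwards [htend.eventually (extChartAt_target_mem_nhdsWithin (I := 𝓡∂ 2) p)] with t ht
    have e1 := (extChartAt (𝓡∂ 2) p).right_inv ht
    have e2 := hbd.chartField_eq_zero ((extChartAt (𝓡∂ 2) p).map_target ht)
    rw [e1] at e2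
    exact e2 (by simp [hp])
  have h4 : A (planeBasis 1) 0 = 0 := by
    have := (hasDerivAt_const (0 : ℝ) (0 : ℝ)).congr_of_eventuallyEq h3
    exact h2.unique this
  have hsk := hK.linearization_skew h0
  have hpos : 0 < innerAt g p (planeBasis 1) (planeBasis 1) :=
    innerAt_pos g p (by simp [planeBasis])
  -- Now A e₁ is a multiple of e₁, and by skewness it is also orthogonal to e₁.
  have h5 : A (planeBasis 1) = 0 := by
    have e1 := plane_eq (A (planeBasis 1))
    rw [h4, zero_smul, zero_add] at e1
    have e2 := hsk (planeBasis 1) (planeBasis 1)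
    rw [← hA, e1] at e2
    simp only [map_smul, smul_apply, smul_eq_mul] at e2
    have e3 : A (planeBasis 1) 1 = 0 := by
      have : A (planeBasis 1) 1 * innerAt g p (planeBasis 1) (planeBasis 1) = 0 := by linarith
      exact (mul_eq_zero.1 this).resolve_right hpos.ne'
    rw [e1, e3, zero_smul]
  -- By skewness and A e₁ = 0, the vector A e₀ is orthogonal to both basis vectors.
  have h6 : A (planeBasis 0) = 0 := by
    by_contra hne
    have e1 := hsk (planeBasis 0) (planeBasis 0)
    have e2 := hsk (planeBasis 0) (planeBasis 1)
    rw [← hA] at e1 e2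
    rw [h5, map_zero, add_zero] at e2
    rw [innerAt_symm g p (planeBasis 0)] at e1
    have e3 := innerAt_pos g p hne
    rw [plane_map (innerAt g p (A (planeBasis 0))) (A (planeBasis 0)), e2, smul_zero, add_zero,
      smul_eq_mul] at e3
    have e4 : innerAt g p (A (planeBasis 0)) (planeBasis 0) = 0 := by linarith
    rw [e4, mul_zero] at e3
    exact e3.false
  ext1 v
  rw [plane_map A v, h5, h6]
  simp

/-- A nonzero Killing field on a connected surface has nonzero linearization at its zeros. -/
theorem IsKilling.linearization_ne_zero [PreconnectedSpace M] {g : SurfaceMetric M} {r : ℕ∞}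
    {X : VField M} (hX : X.IsC r) (hr : 1 ≤ r) (hK : IsKilling g X) (hne : ∃ q, X q ≠ 0)
    {p : M} (h0 : X p = 0) : linearization X p ≠ 0 := by
  intro hA
  set Z : Set M := {x | ∀ᶠ z in 𝓝 x, X z = 0} with hZ
  have hop : IsOpen Z := isOpen_setOfPred_eventually_nhds
  -- At a limit of points near which X vanishes, X and its derivative vanish by continuity, so X
  -- vanishes near the limit by unique continuation.
  have hcl : IsClosed Z := by
    rw [← closure_subset_iff_isClosed]
    intro x hx
    have hfr : ∃ᶠ z in 𝓝 x, z ∈ Z := mem_closure_iff_frequently.1 hx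
    have ht : Tendsto (extChartAt (𝓡∂ 2) x) (𝓝 x) (𝓝[range (𝓡∂ 2)] (extChartAt (𝓡∂ 2) x x)) :=
      tendsto_nhdsWithin_iff.2 ⟨continuousAt_extChartAt x,
        Eventually.of_forall fun z => extChartAt_mem_range x z⟩
    have hxt := mem_extChartAt_target (I := 𝓡∂ 2) x
    have c1 : Tendsto (fun z => chartField X x (extChartAt (𝓡∂ 2) x z)) (𝓝 x)
        (𝓝 (chartField X x (extChartAt (𝓡∂ 2) x x))) :=
      (hX.hasFDerivWithinAt hr hxt).continuousWithinAt.tendsto.comp ht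
    have c2 : Tendsto (fun z => chartFieldDeriv X x (extChartAt (𝓡∂ 2) x z)) (𝓝 x)
        (𝓝 (chartFieldDeriv X x (extChartAt (𝓡∂ 2) x x))) :=
      (hX.continuousWithinAt_chartFieldDeriv hr hxt).tendsto.comp ht
    have hfr2 : ∃ᶠ z in 𝓝 x, chartField X x (extChartAt (𝓡∂ 2) x z) = 0 ∧
        chartFieldDeriv X x (extChartAt (𝓡∂ 2) x z) = 0 := by
      refine (hfr.and_eventually (extChartAt_source_mem_nhds (I := 𝓡∂ 2) x)).mono ?_
      rintro z ⟨hzZ, hzs⟩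
      have hz : (extChartAt (𝓡∂ 2) x).symm (extChartAt (𝓡∂ 2) x z) = z :=
        (extChartAt (𝓡∂ 2) x).left_inv hzs
      have hzt := (extChartAt (𝓡∂ 2) x).map_source hzs
      have hev : chartField X x =ᶠ[𝓝[range (𝓡∂ 2)] (extChartAt (𝓡∂ 2) x z)] fun _ => 0 := by
        have h1 := (continuousAt_extChartAt_symm'' (I := 𝓡∂ 2) hzt).eventually
          (p := fun w => X w = 0) (by rw [hz]; exact hzZ)
        filter_upwards [eventually_nhdsWithin_of_eventually_nhds h1,
          extChartAt_target_mem_nhdsWithin_of_mem hzt] with y hy hyt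
        have := (chartField_eq_zero_iff X ((extChartAt (𝓡∂ 2) x).map_target hyt)).2 hy
        rwa [(extChartAt (𝓡∂ 2) x).right_inv hyt] at this
      have hev0 := hev.self_of_nhdsWithin (extChartAt_mem_range x z)
      refine ⟨hev0, ?_⟩
      unfold chartFieldDeriv
      rw [hev.fderivWithin_eq hev0, fderivWithin_fun_const]
      rfl
    have e1 : chartField X x (extChartAt (𝓡∂ 2) x x) = 0 :=
      tendsto_nhds_unique_of_frequently_eq c1 tendsto_const_nhds (hfr2.mono fun z h => h.1)
    have e2 : chartFieldDeriv X x (extChartAt (𝓡∂ 2) x x) = 0 :=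
      tendsto_nhds_unique_of_frequently_eq c2 tendsto_const_nhds (hfr2.mono fun z h => h.2)
    exact hK.eventually_eq_zero hX hr
      ((chartField_eq_zero_iff X (mem_extChartAt_source x)).1 e1) e2
  obtain ⟨q, hq⟩ := hne
  have huniv := IsClopen.eq_univ ⟨hcl, hop⟩ ⟨p, hK.eventually_eq_zero hX hr h0 hA⟩
  have : q ∈ Z := huniv ▸ mem_univ q
  exact hq (Eventually.self_of_nhds (p := fun z => X z = 0) this)

/-- The zeros of a nonzero Killing field which is tangent to the boundary are interior points. -/
theorem IsKilling.range_mem_nhds [PreconnectedSpace M] {g : SurfaceMetric M} {r : ℕ∞}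
    {X : VField M} (hX : X.IsC r) (hr : 1 ≤ r) (hK : IsKilling g X) (hbd : IsTangentToBoundary X)
    (hne : ∃ q, X q ≠ 0) {p : M} (h0 : X p = 0) :
    range (𝓡∂ 2) ∈ 𝓝 (extChartAt (𝓡∂ 2) p p) := by
  have h1 : extChartAt (𝓡∂ 2) p p 0 ≠ 0 := fun h =>
    hK.linearization_ne_zero hX hr hne h0 (hK.linearization_eq_zero_of_boundary hX hr hbd h0 h)
  have h2 : extChartAt (𝓡∂ 2) p p ∈ interior (range (𝓡∂ 2)) := by
    rw [interior_range_modelWithCornersEuclideanHalfSpace]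
    exact lt_of_le_of_ne (mem_range_halfSpace.1 (extChartAt_mem_range p p)) (Ne.symm h1)
  exact mem_interior_iff_mem_nhds.1 h2

end Zeros

/-! ### Centers of planar systems -/

section PlanarCenter

/-- A field which is `C¹` near a point agrees near this point with a bounded Lipschitz field. -/
theorem exists_lipschitz_eventuallyEq {E : Type*} [NormedAddCommGroup E] [NormedSpace ℝ E]
    [FiniteDimensional ℝ E] {W : E → E} {y₀ : E} (hW : ContDiffAt ℝ 1 W y₀) :
    ∃ (F : E → E) (K : NNReal) (B : ℝ), LipschitzWith K F ∧ (∀ x, ‖F x‖ ≤ B) ∧ F =ᶠ[𝓝 y₀] W := by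
  obtain ⟨ε, hε, hball⟩ := Metric.mem_nhds_iff.1 (hW.eventually (by simp))
  -- Cutting off by a bump function makes the field C¹ with compact support, hence bounded and
  -- Lipschitz, so that its integral curves are global.
  let χ : ContDiffBump y₀ := ⟨ε / 4, ε / 2, by positivity, by linarith⟩
  have hF : ContDiff ℝ 1 (fun x => χ x • W x) := by
    rw [contDiff_iff_contDiffAt]
    intro x
    by_cases hx : x ∈ Metric.ball y₀ ε
    · exact χ.contDiff.contDiffAt.smul (hball hx)
    · have hx' : x ∉ tsupport χ := by
        rw [χ.tsupport_eq]
        intro h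
        have h' : dist x y₀ ≤ ε / 2 := h
        exact hx (Metric.mem_ball.2 (by linarith))
      refine (contDiffAt_const (c := (0 : E))).congr_of_eventuallyEq ?_
      filter_upwards [(isClosed_tsupport χ).isOpen_compl.mem_nhds hx'] with y hy
      rw [image_eq_zero_of_notMem_tsupport hy, zero_smul]
  have hcs : HasCompactSupport (fun x => χ x • W x) :=
    HasCompactSupport.smul_right (f' := W) χ.hasCompactSupport
  obtain ⟨K, hK⟩ := ContDiff.lipschitzWith_of_hasCompactSupport hcs hF one_ne_zero
  obtain ⟨B, hB⟩ := hcs.exists_bound_of_continuous hF.continuous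
  refine ⟨_, K, B, hK, hB, ?_⟩
  filter_upwards [Metric.closedBall_mem_nhds y₀ (show 0 < ε / 4 by positivity)] with x hx
  rw [χ.one_of_mem_closedBall hx, one_smul]

/-- A solution that reached the stationary point would be the constant solution by uniqueness. -/
theorem ne_of_solution {E : Type*} [NormedAddCommGroup E] [NormedSpace ℝ E] {F : E → E}
    {K : NNReal} (hF : LipschitzWith K F) {y₀ : E} (h0 : F y₀ = 0) {z : ℝ → E}
    (hz : ∀ t, HasDerivAt z (F (z t)) t) {t₀ : ℝ} (h : z t₀ ≠ y₀) (t : ℝ) : z t ≠ y₀ := by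
  intro ht
  have := ODE_solution_unique_univ (v := fun _ => F) (K := K) (s := fun _ => univ)
    (fun _ => hF.lipschitzOnWith) (f := z) (g := fun _ => y₀) (t₀ := t)
    (fun t => ⟨hz t, mem_univ _⟩)
    (fun t => ⟨by rw [h0]; exact hasDerivAt_const t y₀, mem_univ _⟩) ht
  exact h (congrFun this t₀)

/-- Orbits near a center with a first integral which increases along rays are periodic, with
almost constant period. -/
theorem exists_periodic_of_firstIntegral {F : ℂ → ℂ} {K : NNReal} (hF : LipschitzWith K F)
    {B : ℝ} (hB : ∀ z, ‖F z‖ ≤ B) {l ε ρ : ℝ} (hε : 0 ≤ ε) (hl : ε < l) (hρ : 0 < ρ)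
    (hFl : ∀ z, ‖z‖ ≤ ρ → ‖F z - Complex.I * l * z‖ ≤ ε * ‖z‖)
    {f : ℂ → ℝ} (hf : ContinuousOn f (Metric.closedBall 0 ρ))
    (hray : ∀ z, z ≠ 0 → ‖z‖ ≤ ρ → StrictMonoOn (fun s : ℝ => f (s • z)) (Icc 0 1))
    (hint : ∀ z : ℝ → ℂ, (∀ t, HasDerivAt z (F (z t)) t) → ∀ t, ‖z t‖ < ρ →
      HasDerivAt (fun t => f (z t)) 0 t) :
    ∃ V : Set ℂ, V ∈ 𝓝 0 ∧ V ⊆ Metric.ball 0 ρ ∧ ∀ z₀ ∈ V, z₀ ≠ 0 → ∃ (z : ℝ → ℂ) (T : ℝ),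
      z 0 = z₀ ∧ (∀ t, HasDerivAt z (F (z t)) t) ∧ (∀ t, z t ∈ V) ∧
      Function.Periodic z T ∧ (∀ t ∈ Ioo 0 T, z t ≠ z₀) ∧ 0 < T ∧
      2 * Real.pi ≤ (l + ε) * T ∧ (l - ε) * T ≤ 2 * Real.pi := by
  have hl0 : 0 < l := hε.trans_lt hl
  -- V is cut out by the minimum of f on the sphere of radius ρ: an orbit starting below this level
  -- cannot reach the sphere.
  obtain ⟨z₁, hz₁, hmin⟩ := (isCompact_sphere (0 : ℂ) ρ).exists_isMinOn
    ⟨(ρ : ℂ), by simp [abs_of_pos hρ]⟩ (hf.mono Metric.sphere_subset_closedBall)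
  have hz₁ρ : ‖z₁‖ = ρ := by simpa using hz₁
  have hz₁0 : z₁ ≠ 0 := by
    rintro rfl
    rw [norm_zero] at hz₁ρ
    exact hρ.ne hz₁ρ
  set m := f z₁
  have hm : f 0 < m := by
    have := hray z₁ hz₁0 hz₁ρ.le (left_mem_Icc.2 zero_le_one) (right_mem_Icc.2 zero_le_one) one_pos
    simpa using this
  have hcl : Metric.closedBall (0 : ℂ) ρ ∈ 𝓝 0 := Metric.closedBall_mem_nhds 0 hρ
  refine ⟨{z | ‖z‖ < ρ ∧ f z < m}, ?_, fun z hz => by simpa using hz.1, ?_⟩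
  · have h1 : ∀ᶠ z in 𝓝 (0 : ℂ), ‖z‖ < ρ := by
      filter_upwards [Metric.ball_mem_nhds (0 : ℂ) hρ] with z hz
      simpa using hz
    exact h1.and ((hf.continuousAt hcl).eventually_lt_const hm)
  rintro z₀ ⟨hz₀ρ, hz₀m⟩ hz₀
  have hF0 : F 0 = 0 := by
    have := hFl 0 (by simpa using hρ.le)
    simpa using this
  obtain ⟨z, hz0, hz⟩ := exists_global_solution hF hB z₀
  have hzc : Continuous z := continuous_iff_continuousAt.2 fun t => (hz t).continuousAt
  have hstay : ∀ t, ‖z t‖ < ρ ∧ f (z t) = f z₀ := by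
    set S : Set ℝ := {t | ‖z t‖ < ρ ∧ f (z t) = f z₀}
    have hSo : IsOpen S := by
      rw [Metric.isOpen_iff]
      rintro t ⟨ht, htf⟩
      obtain ⟨δ, hδ, hball⟩ := Metric.isOpen_iff.1
        (isOpen_lt (continuous_norm.comp hzc) continuous_const) t ht
      refine ⟨δ, hδ, fun s hs => ⟨hball hs, ?_⟩⟩
      rw [← htf]
      have hc := (convex_ball t δ).norm_image_sub_le_of_norm_hasDerivWithin_le (C := 0)
        (f := fun t => f (z t)) (f' := fun _ => 0)
        (fun s hs => (hint z hz s (hball hs)).hasDerivWithinAt) (fun s _ => by simp)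
        (Metric.mem_ball_self hδ) hs
      rw [zero_mul] at hc
      exact sub_eq_zero.1 (norm_le_zero_iff.1 hc)
    have hSc : IsClosed S := by
      rw [← closure_subset_iff_isClosed]
      intro t ht
      have hle : ‖z t‖ ≤ ρ := by
        have : S ⊆ {t | ‖z t‖ ≤ ρ} := fun s hs => hs.1.le
        exact closure_minimal this (isClosed_le (continuous_norm.comp hzc) continuous_const) ht
      have hft : f (z t) = f z₀ := by
        have h1 : ContinuousWithinAt (fun t => f (z t)) S t :=
          (hf (z t) (by simpa using hle)).comp hzc.continuousWithinAt
            (fun s hs => by simpa using hs.1.le)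
        have : (𝓝[S] t).NeBot := mem_closure_iff_nhdsWithin_neBot.1 ht
        refine tendsto_nhds_unique_of_eventuallyEq h1.tendsto tendsto_const_nhds ?_
        filter_upwards [self_mem_nhdsWithin] with s hs
        exact hs.2
      refine ⟨lt_of_le_of_ne hle fun heq => ?_, hft⟩
      have h2 : m ≤ f (z t) := hmin (by simpa using heq)
      linarith
    have := IsClopen.eq_univ ⟨hSc, hSo⟩ ⟨0, by rw [hz0]; exact hz₀ρ, by rw [hz0]⟩
    exact fun t => (this.symm ▸ mem_univ t : t ∈ S)
  have hzne : ∀ t, z t ≠ 0 := ne_of_solution hF hF0 hz (t₀ := 0) (by rwa [hz0])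
  have hwc : Continuous fun t => F (z t) / z t := (hF.continuous.comp hzc).div hzc hzne
  -- A continuous logarithm of z / z₀; its imaginary part θ is the angle swept, whose speed differs
  -- from l by at most ε.
  set w : ℝ → ℂ := fun t => ∫ s in (0 : ℝ)..t, F (z s) / z s with hw_def
  have hw : ∀ t, HasDerivAt w (F (z t) / z t) t := fun t =>
    intervalIntegral.integral_hasDerivAt_right (hwc.intervalIntegrable _ _)
      (hwc.stronglyMeasurableAtFilter _ _) hwc.continuousAt
  have hw0 : w 0 = 0 := intervalIntegral.integral_same
  have hzw : ∀ t, z t = z₀ * Complex.exp (w t) := by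
    have hd : ∀ t, HasDerivAt (fun t => z t * Complex.exp (-w t)) 0 t := by
      intro t
      have h1 := (hz t).mul ((hw t).neg.cexp)
      refine h1.congr_deriv ?_
      have := hzne t
      field_simp
      ring
    intro t
    have h1 := is_const_of_deriv_eq_zero (fun t => (hd t).differentiableAt)
      (fun t => (hd t).deriv) t 0
    simp only [hw0, hz0, neg_zero, Complex.exp_zero, mul_one] at h1
    rw [← h1, mul_assoc, ← Complex.exp_add, neg_add_cancel, Complex.exp_zero, mul_one]
  have hquot : ∀ t, ‖F (z t) / z t - Complex.I * l‖ ≤ ε := by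
    intro t
    have h1 : F (z t) / z t - Complex.I * l = (F (z t) - Complex.I * l * z t) / z t := by
      have := hzne t
      field_simp
    rw [h1, norm_div, div_le_iff₀ (norm_pos_iff.2 (hzne t))]
    exact hFl _ (hstay t).1.le
  set θ : ℝ → ℝ := fun t => (w t).im with hθ_def
  have hθ : ∀ t, HasDerivAt θ (F (z t) / z t).im t := fun t =>
    Complex.imCLM.hasFDerivAt.comp_hasDerivAt t (hw t)
  have hθ0 : θ 0 = 0 := by simp [hθ_def, hw0]
  have him : ∀ t, |(F (z t) / z t).im - l| ≤ ε := by
    intro t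
    have h1 := (Complex.abs_im_le_norm _).trans (hquot t)
    simpa using h1
  have hlow : ∀ s t, s ≤ t → (l - ε) * (t - s) ≤ θ t - θ s := by
    intro s t hst
    have : Monotone fun t => θ t - (l - ε) * t :=
      monotone_of_deriv_nonneg
        (fun t => ((hθ t).sub ((hasDerivAt_id t).const_mul (l - ε))).differentiableAt) (fun t => by
        have := ((hθ t).sub ((hasDerivAt_id t).const_mul (l - ε))).deriv
        simp only [id, Pi.sub_def] at this
        rw [this]
        linarith [(abs_le.1 (him t)).1])
    have := this hst
    simp only at this
    linarith
  have hup : ∀ s t, s ≤ t → θ t - θ s ≤ (l + ε) * (t - s) := by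
    intro s t hst
    have : Antitone fun t => θ t - (l + ε) * t :=
      antitone_of_deriv_nonpos
        (fun t => ((hθ t).sub ((hasDerivAt_id t).const_mul (l + ε))).differentiableAt) (fun t => by
        have := ((hθ t).sub ((hasDerivAt_id t).const_mul (l + ε))).deriv
        simp only [id, Pi.sub_def] at this
        rw [this]
        linarith [(abs_le.1 (him t)).2])
    have := this hst
    simp only at this
    linarith
  have hθc : Continuous θ := continuous_iff_continuousAt.2 fun t => (hθ t).continuousAt
  have hpi := Real.pi_pos
  have hlε : 0 < l - ε := by linarith
  -- T is the time of one full turn.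
  obtain ⟨T, ⟨hT0, hT1⟩, hTθ⟩ : ∃ T ∈ Icc 0 (2 * Real.pi / (l - ε)), θ T = 2 * Real.pi := by
    have h1 := hlow 0 (2 * Real.pi / (l - ε)) (by positivity)
    rw [sub_zero, hθ0, sub_zero, mul_div_cancel₀ _ hlε.ne'] at h1
    exact intermediate_value_Icc (by positivity) hθc.continuousOn
      ⟨by rw [hθ0]; positivity, h1⟩
  have hTpos : 0 < T := lt_of_le_of_ne hT0 fun h => by
    rw [← h, hθ0] at hTθ
    linarith
  -- After one turn z T is a positive multiple of z₀ at the same level of f. Since f is strictly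
  -- increasing along rays, the factor is 1.
  have hzT : z T = z₀ := by
    have h1 : z T = Real.exp (w T).re • z₀ := by
      rw [hzw T, ← Complex.re_add_im (w T), show (w T).im = 2 * Real.pi from hTθ, Complex.exp_add]
      have : Complex.exp (((2 * Real.pi : ℝ) : ℂ) * Complex.I) = 1 := by
        push_cast
        exact Complex.exp_two_pi_mul_I
      rw [this, mul_one, Complex.real_smul, Complex.ofReal_exp]
      simp [mul_comm]
    set a := Real.exp (w T).re
    have ha : 0 < a := Real.exp_pos _
    rcases lt_trichotomy a 1 with h | h | h
    · have h2 := hray z₀ hz₀ hz₀ρ.le ⟨ha.le, h.le⟩ (right_mem_Icc.2 zero_le_one) h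
      simp only [one_smul] at h2
      rw [← h1, (hstay T).2] at h2
      exact absurd h2 (lt_irrefl _)
    · rw [h1, h, one_smul]
    · have h2 := hray (z T) (hzne T) (hstay T).1.le (a := a⁻¹) (b := 1)
        ⟨(inv_pos.2 ha).le, (inv_lt_one_of_one_lt₀ h).le⟩ (right_mem_Icc.2 zero_le_one)
        (inv_lt_one_of_one_lt₀ h)
      simp only [one_smul] at h2
      rw [(hstay T).2, h1, smul_smul, inv_mul_cancel₀ ha.ne', one_smul] at h2
      exact absurd h2 (lt_irrefl _)
  have hper : Function.Periodic z T := by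
    have := ODE_solution_unique_univ (v := fun _ => F) (K := K) (s := fun _ => univ)
      (fun _ => hF.lipschitzOnWith) (f := fun t => z (t + T)) (g := z) (t₀ := 0)
      (fun t => ⟨(hz (t + T)).comp_add_const t T, mem_univ _⟩)
      (fun t => ⟨hz t, mem_univ _⟩) (by simp only [zero_add]; rw [hzT, hz0])
    exact fun t => congrFun this t
  refine ⟨z, T, hz0, hz, fun t => ⟨(hstay t).1, by rw [(hstay t).2]; exact hz₀m⟩, hper, ?_,
    hTpos, ?_, ?_⟩
  -- A return at time t would make θ t a multiple of 2π, but θ t lies strictly between 0 and 2π for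
  -- 0 < t < T.
  · intro t ht heq
    have h1 : Complex.exp (w t) = 1 := by
      have h2 := hzw t
      rw [heq] at h2
      exact (mul_right_eq_self₀.1 h2.symm).resolve_right hz₀
    obtain ⟨n, hn⟩ := Complex.exp_eq_one_iff.1 h1
    have h3 : θ t = n * (2 * Real.pi) := by
      simp only [hθ_def, hn]
      simp
    have h4 : 0 < θ t := by
      have := hlow 0 t ht.1.le
      rw [sub_zero, hθ0, sub_zero] at this
      exact (mul_pos hlε ht.1).trans_le this
    have h5 : θ t < 2 * Real.pi := by
      have := hlow t T ht.2.le
      have h6 := mul_pos hlε (sub_pos.2 ht.2)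
      linarith
    rw [h3] at h4 h5
    have h7 : (0 : ℝ) < n := pos_of_mul_pos_left h4 (by positivity)
    have h8 : (n : ℝ) < 1 := by
      by_contra h
      push Not at h
      nlinarith
    have h9 : 0 < n := by exact_mod_cast h7
    have h10 : n < 1 := by exact_mod_cast h8
    omega
  · have := hup 0 T hTpos.le
    rw [sub_zero, hθ0, sub_zero, hTθ] at this
    exact this
  · have := hlow 0 T hTpos.le
    rw [sub_zero, hθ0, sub_zero, hTθ] at this
    exact this

end PlanarCenter

/-! ### Skew endomorphisms of the plane -/

section SkewMaps

variable {G : Plane →L[ℝ] Plane →L[ℝ] ℝ} {A : Plane →L[ℝ] Plane}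

/-- In dimension two, a nonzero skew map is a nonzero multiple of the rotation by a right angle.
This gives trace zero, positive determinant, and that rotating once more yields a multiple of the
identity. The nonvanishing matrix entry serves as a denominator in `exists_complex_coordinate`. -/
theorem skew_coordinates (hs : ∀ u v, G u v = G v u) (hp : ∀ u, u ≠ 0 → 0 < G u u)
    (hA : ∀ u v, G (A u) v + G u (A v) = 0) (hne : A ≠ 0) :
    A (planeBasis 0) 0 + A (planeBasis 1) 1 = 0 ∧ A (planeBasis 0) 1 ≠ 0 ∧ 0 < A.det ∧
      ∃ κ : ℝ, κ ≠ 0 ∧ ∀ u, rotField G (A u) = κ • u := by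
  have hdet := gramDet_pos hs hp
  have hE : 0 < G (planeBasis 0) (planeBasis 0) := hp _ (by simp [planeBasis])
  have h00 := hA (planeBasis 0) (planeBasis 0)
  have h01 := hA (planeBasis 0) (planeBasis 1)
  have h11 := hA (planeBasis 1) (planeBasis 1)
  have hA0 := plane_eq (A (planeBasis 0))
  have hA1 := plane_eq (A (planeBasis 1))
  rw [plane_det]
  set a := A (planeBasis 0) 0
  set c := A (planeBasis 0) 1
  set b := A (planeBasis 1) 0
  set d := A (planeBasis 1) 1
  have hF := hs (planeBasis 1) (planeBasis 0)
  unfold gramDet at hdet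
  rw [hF] at hdet
  simp only [hA0, hA1, map_add, map_smul, add_apply, smul_apply, smul_eq_mul, hF] at h00 h01 h11
  set E := G (planeBasis 0) (planeBasis 0)
  set F := G (planeBasis 0) (planeBasis 1)
  set H := G (planeBasis 1) (planeBasis 1)
  have htr : a + d = 0 := by
    have : (a + d) * (E * H - F * F) = 0 := by linear_combination (1 / 2) * H * h00 + (1 / 2) * E * h11 - F * h01
    exact (mul_eq_zero.1 this).resolve_right hdet.ne'
  have hd : d = -a := by linarith
  have hc : c ≠ 0 := by
    intro hc
    rw [hc] at h00 h01 hA0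
    have ha : a = 0 := by
      have : a * E = 0 := by linarith
      exact (mul_eq_zero.1 this).resolve_right hE.ne'
    rw [hd, ha] at hA1 h01
    have hb : b = 0 := by
      have : b * E = 0 := by linarith
      exact (mul_eq_zero.1 this).resolve_right hE.ne'
    rw [ha] at hA0
    rw [hb] at hA1
    refine hne ?_
    ext1 v
    rw [plane_map A v, hA0, hA1]
    simp
  have hdA : 0 < a * d - b * c := by
    have h1 : E ^ 2 * (a * d - b * c) = c ^ 2 * (E * H - F * F) := by
      rw [hd] at h01 h11 ⊢
      linear_combination (-E * c) * h01 + (-(a * E) / 2 + c * F / 2) * h00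
    have h2 : 0 < c ^ 2 * (E * H - F * F) := mul_pos (by positivity) hdet
    rw [← h1] at h2
    exact pos_of_mul_pos_right h2 (sq_nonneg E)
  refine ⟨htr, hc, hdA, -((Real.sqrt (gramDet G))⁻¹ * (a * F + c * H)), ?_, fun u => ?_⟩
  · refine neg_ne_zero.2 (mul_ne_zero (inv_ne_zero (Real.sqrt_pos.2 (gramDet_pos hs hp)).ne') ?_)
    intro h
    have h1 : c * (E * H - F * F) = 0 := by linear_combination E * h - (F / 2) * h00
    rcases mul_eq_zero.1 h1 with h2 | h2
    · exact hc h2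
    · exact hdet.ne' h2
  · rw [plane_map A u, hA0, hA1]
    unfold rotField
    simp only [map_add, map_smul, add_apply, smul_apply, smul_eq_mul, hF]
    have e0 : a * E + c * F = 0 := by linarith
    have e1 : b * F + d * H = 0 := by linarith
    have e2 : b * E + d * F = -(a * F + c * H) := by linarith
    ext i
    fin_cases i
    · simp
      linear_combination (-(Real.sqrt (gramDet G))⁻¹ * u 1) * e1
    · simp
      linear_combination ((Real.sqrt (gramDet G))⁻¹ * u 0) * e0 +
        ((Real.sqrt (gramDet G))⁻¹ * u 1) * e2

/-- A nonzero trace free map of positive determinant is conjugate to the multiplication by a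
purely imaginary number. -/
theorem exists_complex_coordinate (htr : A (planeBasis 0) 0 + A (planeBasis 1) 1 = 0)
    (hc : A (planeBasis 0) 1 ≠ 0) (hdet : 0 < A.det) :
    ∃ L : Plane ≃L[ℝ] ℂ, ∀ u, L (A u) = Complex.I * (Real.sqrt A.det) * L u := by
  set l := Real.sqrt A.det
  have hl : 0 < l := Real.sqrt_pos.2 hdet
  have hl2 : l ^ 2 = A.det := Real.sq_sqrt hdet.le
  rw [plane_det] at hl2
  have hAu : ∀ u : Plane, A u = _ := fun u => plane_map A u
  set a := A (planeBasis 0) 0 with ha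
  set c := A (planeBasis 0) 1 with hc'
  set b := A (planeBasis 1) 0 with hb
  set d := A (planeBasis 1) 1 with hd'
  have hd : d = -a := by linarith
  -- The coordinate sends e₀ to 1 and A e₀ / l to i; trace zero gives A² = -l².
  let L₀ : Plane ≃ₗ[ℝ] ℂ :=
    { toFun := fun v => ⟨v 0 - a * v 1 / c, l * v 1 / c⟩
      invFun := fun w => (w.re + a * w.im / l) • planeBasis 0 + (c * w.im / l) • planeBasis 1
      map_add' := fun u v => by
        apply Complex.ext
        · simp
          ring
        · simp
          ring
      map_smul' := fun r v => by
        apply Complex.ext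
        · simp
          ring
        · simp
          ring
      left_inv := fun v => by
        ext i
        fin_cases i
        · simp
          field_simp
          ring
        · simp
          field_simp
      right_inv := fun w => by
        apply Complex.ext
        · simp
          field_simp
          ring
        · simp
          field_simp }
  have hL0 : ∀ v, L₀ v = ⟨v 0 - a * v 1 / c, l * v 1 / c⟩ := fun v => rfl
  refine ⟨L₀.toContinuousLinearEquiv, fun u => ?_⟩
  change L₀ (A u) = Complex.I * l * L₀ u
  have e0 : A u 0 = u 0 * a + u 1 * b := by rw [hAu u]; simp [ha, hb]
  have e1 : A u 1 = u 0 * c + u 1 * d := by rw [hAu u]; simp [hc', hd']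
  rw [hL0, hL0, e0, e1, hd]
  rw [hd] at hl2
  apply Complex.ext
  · simp
    field_simp
    linear_combination (u 1) * hl2
  · simp
    field_simp
    ring

/-- The characteristic polynomial is μ² + det A. -/
theorem eigenvalues_of_trace_eq_zero (htr : A (planeBasis 0) 0 + A (planeBasis 1) 1 = 0)
    (hdet : 0 < A.det) (μ : ℂ)
    (hμ : Polynomial.aeval μ (LinearMap.charpoly (A : Plane →ₗ[ℝ] Plane)) = 0) :
    μ.re = 0 ∧ μ ≠ 0 := by
  rw [plane_det] at hdet
  rw [← LinearMap.charpoly_toMatrix _ (EuclideanSpace.basisFun (Fin 2) ℝ).toBasis,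
    Matrix.charpoly_fin_two, Matrix.trace_fin_two, Matrix.det_fin_two] at hμ
  simp only [LinearMap.toMatrix_apply, OrthonormalBasis.coe_toBasis,
    OrthonormalBasis.coe_toBasis_repr_apply, EuclideanSpace.basisFun_apply,
    EuclideanSpace.basisFun_repr, ContinuousLinearMap.coe_coe] at hμ
  change Polynomial.aeval μ (Polynomial.X ^ 2 - Polynomial.C (A (planeBasis 0) 0 +
    A (planeBasis 1) 1) * Polynomial.X + Polynomial.C (A (planeBasis 0) 0 * A (planeBasis 1) 1 -
    A (planeBasis 1) 0 * A (planeBasis 0) 1)) = 0 at hμ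
  rw [htr] at hμ
  set D := A (planeBasis 0) 0 * A (planeBasis 1) 1 - A (planeBasis 1) 0 * A (planeBasis 0) 1
  have h1 : μ ^ 2 + (D : ℂ) = 0 := by simpa using hμ
  have hre := congrArg Complex.re h1
  have him := congrArg Complex.im h1
  simp [pow_two] at hre him
  have h0 : μ.re = 0 := by
    have h2 : μ.re * μ.im = 0 := by linarith
    rcases mul_eq_zero.1 h2 with h | h
    · exact h
    · rw [h] at hre
      nlinarith [mul_self_nonneg μ.re]
  refine ⟨h0, ?_⟩
  rintro rfl
  simp at hre
  exact hdet.ne' hre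

end SkewMaps

/-! ### The squared length of the field increases along rays -/

section Rays

set_option maxSynthPendingDepth 3 in
/-- The squared length of a field with a nondegenerate zero is increasing along short rays. -/
theorem exists_strictMonoOn_ray {G : Plane → Plane →L[ℝ] Plane →L[ℝ] ℝ}
    {G' : Plane → Plane →L[ℝ] Plane →L[ℝ] Plane →L[ℝ] ℝ} {X : Plane → Plane}
    {A : Plane → Plane →L[ℝ] Plane} {y₀ : Plane} {C c m : ℝ} (hC : 0 < C) (hc : 0 < c) (hm : 0 < m)
    (hG : ∀ᶠ y in 𝓝 y₀, HasFDerivAt G (G' y) y) (hX : ∀ᶠ y in 𝓝 y₀, HasFDerivAt X (A y) y)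
    (hs : ∀ y u v, G y u v = G y v u) (hA : ContinuousAt A y₀) (hX0 : X y₀ = 0)
    (hGC : ∀ᶠ y in 𝓝 y₀, ‖G y‖ ≤ C)
    (hG'C : ∀ᶠ y in 𝓝 y₀, ∀ u v w, |G' y u v w| ≤ C * ‖u‖ * ‖v‖ * ‖w‖)
    (hGm : ∀ᶠ y in 𝓝 y₀, ∀ u, m * ‖u‖ ^ 2 ≤ G y u u) (hAc : ∀ u, c * ‖u‖ ≤ ‖A y₀ u‖) :
    ∃ ρ, 0 < ρ ∧ ∀ v, v ≠ 0 → ‖v‖ ≤ ρ →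
      StrictMonoOn (fun s : ℝ => G (y₀ + s • v) (X (y₀ + s • v)) (X (y₀ + s • v))) (Icc 0 1) := by
  -- The bound c / 2 keeps ‖X y‖ at least (c / 2)‖x‖ for x = y - y₀; the other bound makes the error
  -- of replacing A y x by X y small against the metric.
  obtain ⟨δ, hδ, hδc, hδm⟩ : ∃ δ, 0 < δ ∧ δ ≤ c / 2 ∧ 8 * C * δ / c ≤ m / 2 := by
    refine ⟨min (c / 2) (m * c / (16 * C)), by positivity, min_le_left _ _, ?_⟩
    rw [div_le_iff₀ hc]
    have := min_le_right (c / 2) (m * c / (16 * C))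
    rw [le_div_iff₀ (by positivity)] at this
    linarith
  have hAδ : ∀ᶠ y in 𝓝 y₀, ‖A y - A y₀‖ < δ := by
    have := Metric.tendsto_nhds.1 hA δ hδ
    simpa only [dist_eq_norm] using this
  have hXδ : ∀ᶠ y in 𝓝 y₀, ‖X y - A y₀ (y - y₀)‖ ≤ δ * ‖y - y₀‖ := by
    have := (hasFDerivAt_iff_isLittleO.1 hX.self_of_nhds).def hδ
    simpa only [hX0, sub_zero] using this
  obtain ⟨R, hR, hball⟩ := Metric.eventually_nhds_iff.1
    (hG.and (hX.and (hGC.and (hG'C.and (hGm.and (hAδ.and hXδ))))))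
  refine ⟨min (R / 2) (m / (2 * C)), by positivity, fun v hv hvρ => ?_⟩
  have hvR : ‖v‖ ≤ R / 2 := hvρ.trans (min_le_left _ _)
  have hvm : C * ‖v‖ ≤ m / 2 := by
    have := hvρ.trans (min_le_right _ _)
    rw [le_div_iff₀ (by positivity)] at this
    linarith
  have hin : ∀ s ∈ Icc (0 : ℝ) 1, dist (y₀ + s • v) y₀ < R := by
    intro s hs
    rw [dist_eq_norm, add_sub_cancel_left, norm_smul, Real.norm_eq_abs, abs_of_nonneg hs.1]
    nlinarith [hs.2, norm_nonneg v]
  have hder : ∀ s ∈ Icc (0 : ℝ) 1, HasDerivAt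
      (fun s : ℝ => G (y₀ + s • v) (X (y₀ + s • v)) (X (y₀ + s • v)))
      (G' (y₀ + s • v) v (X (y₀ + s • v)) (X (y₀ + s • v)) +
        2 * G (y₀ + s • v) (A (y₀ + s • v) v) (X (y₀ + s • v))) s := by
    intro s hs'
    obtain ⟨hG, hX, -⟩ := hball (hin s hs')
    have hline : HasDerivAt (fun s : ℝ => y₀ + s • v) v s := by
      have := ((hasDerivAt_id s).smul_const v).const_add y₀
      rwa [one_smul] at this
    have hXs : HasDerivAt (fun s : ℝ => X (y₀ + s • v)) (A (y₀ + s • v) v) s :=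
      hX.comp_hasDerivAt s hline
    have hGs : HasDerivAt (fun s : ℝ => G (y₀ + s • v)) (G' (y₀ + s • v) v) s :=
      hG.comp_hasDerivAt s hline
    have h1 := hGs.clm_apply hXs
    have h2 := h1.clm_apply hXs
    refine h2.congr_deriv ?_
    simp only [add_apply]
    rw [hs _ (X (y₀ + s • v)) (A (y₀ + s • v) v)]
    ring
  refine strictMonoOn_of_deriv_pos (convex_Icc 0 1)
    (fun s hs => (hder s hs).continuousAt.continuousWithinAt) fun s hs' => ?_
  rw [interior_Icc] at hs'
  rw [(hder s (Ioo_subset_Icc_self hs')).deriv]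
  obtain ⟨-, -, hGC, hG'C, hGm, hAδ, hXδ⟩ := hball (hin s (Ioo_subset_Icc_self hs'))
  set y := y₀ + s • v with hy
  have hyx : y - y₀ = s • v := add_sub_cancel_left _ _
  set x := s • v with hx
  rw [hyx] at hXδ
  have hx0 : 0 < ‖x‖ := norm_pos_iff.2 (smul_ne_zero hs'.1.ne' hv)
  have hxv : ‖x‖ ≤ ‖v‖ := by
    rw [hx, norm_smul, Real.norm_eq_abs, abs_of_pos hs'.1]
    nlinarith [hs'.2, norm_nonneg v]
  have hXl : c / 2 * ‖x‖ ≤ ‖X y‖ := by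
    have h1 := hAc x
    have h2 := norm_sub_norm_le (A y₀ x) (X y)
    rw [norm_sub_rev] at h2
    nlinarith
  have hXpos : 0 < ‖X y‖ := lt_of_lt_of_le (by positivity) hXl
  have h1 : ‖A y x - X y‖ ≤ 2 * δ * ‖x‖ := by
    have e1 : A y x - X y = (A y - A y₀) x - (X y - A y₀ x) := by
      rw [sub_apply]
      abel
    have e2 := (A y - A y₀).le_of_opNorm_le hAδ.le x
    rw [e1]
    linarith [norm_sub_le ((A y - A y₀) x) (X y - A y₀ x)]
  have h2 : |G y (A y x - X y) (X y)| ≤ 4 * C * δ / c * ‖X y‖ ^ 2 := by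
    have e1 := ((G y (A y x - X y)).le_opNorm (X y))
    have e2 := (G y).le_of_opNorm_le hGC (A y x - X y)
    calc |G y (A y x - X y) (X y)| ≤ ‖G y (A y x - X y)‖ * ‖X y‖ := e1
      _ ≤ (C * (2 * δ * ‖x‖)) * ‖X y‖ := by
          gcongr
          exact e2.trans (by gcongr)
      _ ≤ (C * (2 * δ * (2 / c * ‖X y‖))) * ‖X y‖ := by
          gcongr
          rw [div_mul_eq_mul_div, le_div_iff₀ hc]
          linarith
      _ = 4 * C * δ / c * ‖X y‖ ^ 2 := by ring
  have h3 : |G' y x (X y) (X y)| ≤ m / 2 * ‖X y‖ ^ 2 := by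
    calc _ ≤ C * ‖x‖ * ‖X y‖ * ‖X y‖ := hG'C x (X y) (X y)
      _ = (C * ‖x‖) * ‖X y‖ ^ 2 := by ring
      _ ≤ m / 2 * ‖X y‖ ^ 2 := by
          gcongr
          exact le_trans (by gcongr) hvm
  have h4 := hGm (X y)
  -- Multiplying by s replaces v by x = s • v, and A y x is close to X y. The main term is then 2
  -- G(X, X) ≥ 2 m ‖X‖², and each of the two errors is at most (m / 2)‖X‖².
  have h5 : 0 < s * (G' y v (X y) (X y) + 2 * G y (A y v) (X y)) := by
    have e1 : s * (G' y v (X y) (X y) + 2 * G y (A y v) (X y)) =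
        G' y x (X y) (X y) + 2 * G y (X y) (X y) + 2 * G y (A y x - X y) (X y) := by
      simp only [hx, map_smul, map_sub, sub_apply, smul_apply, smul_eq_mul]
      ring
    rw [e1]
    have e2 : 4 * C * δ / c ≤ m / 4 := by
      have : 8 * C * δ / c = 2 * (4 * C * δ / c) := by ring
      linarith
    have e3 := mul_le_mul_of_nonneg_right e2 (sq_nonneg ‖X y‖)
    have e4 := mul_pos hm (pow_pos hXpos 2)
    rw [abs_le] at h2 h3
    nlinarith
  exact pos_of_mul_pos_right h5 hs'.1.le

end Rays

/-! ### Periodic orbits near an interior zero, with approximate periods -/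

section ZerosOfKillingFields

/-- F is close to -μ (y - y₀), so the squared distance h to y₀ satisfies h' ≤ -μ h in the ball and
decays exponentially. Applied to a multiple of the rotated field. -/
theorem tendsto_of_contracting {E : Type*} [NormedAddCommGroup E] [InnerProductSpace ℝ E]
    {F : E → E} {y₀ : E} {μ R : ℝ} (hμ : 0 < μ)
    (hF : ∀ y, ‖y - y₀‖ ≤ R → ‖F y + μ • (y - y₀)‖ ≤ μ / 2 * ‖y - y₀‖) {z : ℝ → E}
    (hz : ∀ t, HasDerivAt z (F (z t)) t) (h0 : ‖z 0 - y₀‖ ≤ R) (hne : z 0 ≠ y₀) :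
    (∀ s, 0 ≤ s → ‖z s - y₀‖ ≤ R) ∧ Tendsto z atTop (𝓝 y₀) := by
  set h : ℝ → ℝ := fun s => ‖z s - y₀‖ ^ 2 with hh
  have hd : ∀ s, HasDerivAt h (2 * inner ℝ (z s - y₀) (F (z s))) s := fun s =>
    ((hz s).sub_const y₀).norm_sq
  have hR : 0 ≤ R := (norm_nonneg _).trans h0
  have hle : ∀ s, ‖z s - y₀‖ ≤ R → 2 * inner ℝ (z s - y₀) (F (z s)) ≤ -(μ * h s) := by
    intro s hs
    have e1 : inner ℝ (z s - y₀) (F (z s)) =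
        inner ℝ (z s - y₀) (F (z s) + μ • (z s - y₀)) - μ * ‖z s - y₀‖ ^ 2 := by
      rw [inner_add_right, real_inner_smul_right, real_inner_self_eq_norm_sq]
      ring
    have e2 := real_inner_le_norm (z s - y₀) (F (z s) + μ • (z s - y₀))
    have e3 := mul_le_mul_of_nonneg_left (hF _ hs) (norm_nonneg (z s - y₀))
    rw [e1]
    simp only [hh]
    nlinarith
  have hδ : 0 < h 0 := pow_pos (norm_pos_iff.2 (sub_ne_zero.2 hne)) 2
  -- The differential inequality holds only inside the ball. The barrier argument needs it only at
  -- times when h s = h 0, where the point is in the ball.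
  have hstay : ∀ s, 0 ≤ s → h s ≤ h 0 := by
    intro b hb
    refine image_le_of_deriv_right_lt_deriv_boundary (f := h) (B := fun _ => h 0)
      (f' := fun s => 2 * inner ℝ (z s - y₀) (F (z s))) (B' := fun _ => 0) (a := 0) (b := b)
      (fun s _ => (hd s).continuousAt.continuousWithinAt)
      (fun s _ => (hd s).hasDerivWithinAt) le_rfl (fun s => hasDerivAt_const s (h 0)) ?_
      (right_mem_Icc.2 hb)
    intro s _ heq
    have h1 : ‖z s - y₀‖ ≤ R := by
      have h2 : ‖z s - y₀‖ = ‖z 0 - y₀‖ := by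
        have h3 : ‖z s - y₀‖ ^ 2 = ‖z 0 - y₀‖ ^ 2 := heq
        exact (pow_left_inj₀ (norm_nonneg _) (norm_nonneg _) two_ne_zero).1 h3
      rw [h2]
      exact h0
    have := hle s h1
    rw [heq] at this
    have := mul_pos hμ hδ
    linarith
  have hstay' : ∀ s, 0 ≤ s → ‖z s - y₀‖ ≤ R := fun s hs =>
    (pow_le_pow_iff_left₀ (norm_nonneg _) (norm_nonneg _) two_ne_zero).1 (hstay s hs) |>.trans h0
  refine ⟨hstay', ?_⟩
  have hanti : AntitoneOn (fun s => h s * Real.exp (μ * s)) (Ici 0) := by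
    have hd' : ∀ s, HasDerivAt (fun s => h s * Real.exp (μ * s))
        ((2 * inner ℝ (z s - y₀) (F (z s)) + μ * h s) * Real.exp (μ * s)) s := by
      intro s
      have := (hd s).mul (((hasDerivAt_id s).const_mul μ).exp)
      refine this.congr_deriv ?_
      simp only [id]
      ring
    refine antitoneOn_of_deriv_nonpos (convex_Ici 0)
      (fun s _ => (hd' s).continuousAt.continuousWithinAt)
      (fun s _ => (hd' s).differentiableAt.differentiableWithinAt) fun s hs => ?_
    rw [interior_Ici] at hs
    rw [(hd' s).deriv]
    have := hle s (hstay' s (le_of_lt hs))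
    exact mul_nonpos_of_nonpos_of_nonneg (by linarith) (Real.exp_pos _).le
  have hsq : Tendsto h atTop (𝓝 0) := by
    have h1 : Tendsto (fun s => h 0 * Real.exp (-(μ * s))) atTop (𝓝 0) := by
      have := (Real.tendsto_exp_neg_atTop_nhds_zero.comp
        (tendsto_id.const_mul_atTop hμ)).const_mul (h 0)
      rwa [mul_zero] at this
    refine tendsto_of_tendsto_of_tendsto_of_le_of_le' tendsto_const_nhds h1
      (Eventually.of_forall fun s => sq_nonneg _) ?_
    filter_upwards [eventually_ge_atTop 0] with s hs
    have := hanti (self_mem_Ici : (0 : ℝ) ∈ Ici 0) hs hs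
    simp only [mul_zero, Real.exp_zero, mul_one] at this
    rw [Real.exp_neg, ← div_eq_mul_inv, le_div_iff₀ (Real.exp_pos _)]
    exact this
  rw [tendsto_iff_norm_sub_tendsto_zero]
  have h2 := hsq.sqrt
  simp only [Real.sqrt_zero, hh, Real.sqrt_sq (norm_nonneg _)] at h2
  exact h2

variable {M : Type*} [TopologicalSpace M] [ChartedSpace (EuclideanHalfSpace 2) M]
  [IsManifold (𝓡∂ 2) ∞ M]

theorem hasVelocityWithin_chart_symm {Z : VField M} {p : M} {c : ℝ → Plane} {S : Set ℝ} {s k : ℝ}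
    (hc : ∀ t ∈ S, c t ∈ (extChartAt (𝓡∂ 2) p).target) (hs : s ∈ S)
    (hd : HasDerivWithinAt c (k • chartField Z p (c s)) S s) :
    HasVelocityWithin Z k (fun t => (extChartAt (𝓡∂ 2) p).symm (c t)) S s := by
  refine hasVelocityWithin_of_hasDerivWithinAt (p := p)
    ((extChartAt (𝓡∂ 2) p).map_target (hc s hs)) ?_ ?_
  · filter_upwards [self_mem_nhdsWithin] with t ht
    exact (extChartAt (𝓡∂ 2) p).map_target (hc t ht)
  · rw [(extChartAt (𝓡∂ 2) p).right_inv (hc s hs)]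
    exact hd.congr (fun t ht => (extChartAt (𝓡∂ 2) p).right_inv (hc t ht))
      ((extChartAt (𝓡∂ 2) p).right_inv (hc s hs))

theorem eventually_mem_target_of_range_mem_nhds {p : M}
    (hp : range (𝓡∂ 2) ∈ 𝓝 (extChartAt (𝓡∂ 2) p p)) :
    ∀ᶠ y in 𝓝 (extChartAt (𝓡∂ 2) p p), y ∈ (extChartAt (𝓡∂ 2) p).target ∧
      range (𝓡∂ 2) ∈ 𝓝 y := by
  have h1 := extChartAt_target_mem_nhdsWithin (I := 𝓡∂ 2) p
  rw [nhdsWithin_eq_nhds.2 hp] at h1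
  exact (show ∀ᶠ y in 𝓝 (extChartAt (𝓡∂ 2) p p), y ∈ (extChartAt (𝓡∂ 2) p).target from h1).and
    (eventually_mem_nhds_iff.2 hp)

set_option maxSynthPendingDepth 3 in
theorem eventually_abs_chartMetricDeriv_le (g : SurfaceMetric M) (p : M) :
    ∃ C, 0 < C ∧ ∀ᶠ y in 𝓝[range (𝓡∂ 2)] (extChartAt (𝓡∂ 2) p p), ‖chartMetric g p y‖ ≤ C ∧
      ∀ u v w, |chartMetricDeriv g p y u v w| ≤ C * ‖u‖ * ‖v‖ * ‖w‖ := by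
  have hp := mem_extChartAt_target (I := 𝓡∂ 2) p
  have h1 := (contDiffWithinAt_chartMetric g hp).continuousWithinAt.norm
  have h2 := (contDiffWithinAt_chartMetricDeriv g hp).continuousWithinAt.norm
  set C := max ‖chartMetric g p (extChartAt (𝓡∂ 2) p p)‖
    ‖chartMetricDeriv g p (extChartAt (𝓡∂ 2) p p)‖ + 1
  have hC : 0 < C := lt_of_lt_of_le one_pos (by
    simp only [C, le_add_iff_nonneg_left]
    exact (norm_nonneg _).trans (le_max_left _ _))
  refine ⟨C, hC, ?_⟩
  have e1 : ‖chartMetric g p (extChartAt (𝓡∂ 2) p p)‖ < C :=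
    (le_max_left _ _).trans_lt (lt_add_one _)
  have e2 : ‖chartMetricDeriv g p (extChartAt (𝓡∂ 2) p p)‖ < C :=
    (le_max_right _ _).trans_lt (lt_add_one _)
  filter_upwards [h1.tendsto.eventually_lt_const e1, h2.tendsto.eventually_lt_const e2]
    with y hy hy'
  refine ⟨hy.le, fun u v w => ?_⟩
  have e1 := (chartMetricDeriv g p y u v).le_opNorm w
  have e2 := (chartMetricDeriv g p y u).le_opNorm v
  have e3 := (chartMetricDeriv g p y).le_of_opNorm_le hy'.le u
  calc _ ≤ ‖chartMetricDeriv g p y u v‖ * ‖w‖ := e1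
    _ ≤ (‖chartMetricDeriv g p y u‖ * ‖v‖) * ‖w‖ := by gcongr
    _ ≤ C * ‖u‖ * ‖v‖ * ‖w‖ := by gcongr

theorem eventually_chartMetric_ge (g : SurfaceMetric M) (p : M) :
    ∃ m, 0 < m ∧ ∀ᶠ y in 𝓝[range (𝓡∂ 2)] (extChartAt (𝓡∂ 2) p p),
      ∀ u, m * ‖u‖ ^ 2 ≤ chartMetric g p y u u := by
  obtain ⟨R, hR0, hRt⟩ := ((eventually_mem_nhdsWithin (a := (0 : ℝ)) (s := Ioi 0)).and
    (eventually_forall_closedBall (extChartAt_target_mem_nhdsWithin (I := 𝓡∂ 2) p))).exists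
  obtain ⟨m, hm, h⟩ := exists_chartMetric_ge g
    (isCompact_closedBall_inter_range (extChartAt (𝓡∂ 2) p p) R) hRt
  refine ⟨m, hm, ?_⟩
  filter_upwards [self_mem_nhdsWithin, eventually_nhdsWithin_of_eventually_nhds
    (Metric.closedBall_mem_nhds _ hR0)] with y hy hy'
  exact h y ⟨hy', hy⟩

set_option maxSynthPendingDepth 3 in
/-- The squared length of a Killing field is constant along its integral curves. -/
theorem IsKilling.hasDerivAt_chartMetric_self {g : SurfaceMetric M} {r : ℕ∞} {X : VField M}
    (hX : X.IsC r) (hr : 1 ≤ r) (hK : IsKilling g X) {p : M} {c : ℝ → Plane} {t : ℝ}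
    (ht : c t ∈ (extChartAt (𝓡∂ 2) p).target) (hct : range (𝓡∂ 2) ∈ 𝓝 (c t))
    (hc : HasDerivAt c (chartField X p (c t)) t) :
    HasDerivAt (fun t => chartMetric g p (c t) (chartField X p (c t)) (chartField X p (c t))) 0
      t := by
  have hXs : HasDerivAt (fun t => chartField X p (c t))
      (chartFieldDeriv X p (c t) (chartField X p (c t))) t :=
    ((hX.hasFDerivWithinAt hr ht).hasFDerivAt hct).comp_hasDerivAt t hc
  have hGs : HasDerivAt (fun t => chartMetric g p (c t))
      (chartMetricDeriv g p (c t) (chartField X p (c t))) t :=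
    ((hasFDerivWithinAt_chartMetric g ht).hasFDerivAt hct).comp_hasDerivAt t hc
  have h1 := hGs.clm_apply hXs
  have h2 := h1.clm_apply hXs
  refine h2.congr_deriv ?_
  have := hK p _ ht (chartField X p (c t)) (chartField X p (c t))
  unfold lieDerivMetric at this
  simp only [add_apply]
  exact this

/-- Near a zero in the interior, the orbits of a Killing field are periodic, and their periods
are controlled by the linearization. -/
theorem IsKilling.exists_periodic_nhds {g : SurfaceMetric M} {r : ℕ∞} {X : VField M}
    (hX : X.IsC r) (hr : 1 ≤ r) (hK : IsKilling g X) {p : M} (h0 : X p = 0)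
    (hp : range (𝓡∂ 2) ∈ 𝓝 (extChartAt (𝓡∂ 2) p p)) (hA : linearization X p ≠ 0) {ε : ℝ}
    (hε : 0 < ε) (hεl : ε < Real.sqrt (linearization X p).det) {U : Set M} (hU : U ∈ 𝓝 p) :
    ∃ V ∈ 𝓝 p, V ⊆ U ∧ ∀ q ∈ V, q ≠ p → ∃ (γ : ℝ → M) (T : ℝ), γ 0 = q ∧ IsMIntegralCurve γ X ∧
      Function.Periodic γ T ∧ (∀ t ∈ Ioo 0 T, γ t ≠ q) ∧ 0 < T ∧
      2 * Real.pi ≤ (Real.sqrt (linearization X p).det + ε) * T ∧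
      (Real.sqrt (linearization X p).det - ε) * T ≤ 2 * Real.pi ∧ ∀ t, γ t ∈ V := by
  set A := linearization X p with hA_def
  set l := Real.sqrt A.det with hl_def
  set y₀ := extChartAt (𝓡∂ 2) p p with hy₀
  have hyt := mem_extChartAt_target (I := 𝓡∂ 2) p
  have hnh : 𝓝[range (𝓡∂ 2)] y₀ = 𝓝 y₀ := nhdsWithin_eq_nhds.2 hp
  obtain ⟨htr, hc, hdet, -⟩ := skew_coordinates (innerAt_symm g p) (fun u hu => innerAt_pos g p hu)
    (hK.linearization_skew h0) hA
  have hl : 0 < l := Real.sqrt_pos.2 hdet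
  obtain ⟨L, hL⟩ := exists_complex_coordinate htr hc hdet
  have hX0 : chartField X p y₀ = 0 := by
    rw [hy₀, chartField_self]
    exact h0
  have hXd : HasFDerivAt (chartField X p) A y₀ := (hX.hasFDerivWithinAt hr hyt).hasFDerivAt hp
  -- Affine complex coordinate centred at the zero, in which the linear part of the field is
  -- multiplication by i·l.
  set σ : ℂ → Plane := fun z => y₀ + L.symm z with hσ
  have hσ0 : σ 0 = y₀ := by simp [hσ]
  have hσd : ∀ z, HasFDerivAt σ (L.symm : ℂ →L[ℝ] Plane) z := fun z =>
    (L.symm : ℂ →L[ℝ] Plane).hasFDerivAt.const_add y₀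
  have hσc : Tendsto σ (𝓝 0) (𝓝 y₀) := by
    have := (hσd 0).continuousAt.tendsto
    rwa [hσ0] at this
  set F₀ : ℂ → ℂ := fun z => L (chartField X p (σ z)) with hF₀
  have hF₀c : ContDiffAt ℝ 1 F₀ 0 := by
    have h1 : ContDiffAt ℝ 1 (chartField X p) (σ 0) := by
      rw [hσ0]
      exact ((contDiffOn_chartField hX hr p) y₀ hyt).contDiffAt
        ((eventually_mem_target_of_range_mem_nhds hp).mono fun y hy => hy.1)
    exact L.contDiff.contDiffAt.comp 0
      (h1.comp 0 (contDiffAt_const.add L.symm.contDiff.contDiffAt))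
  have hF₀d : HasFDerivAt F₀ ((L : Plane →L[ℝ] ℂ).comp (A.comp (L.symm : ℂ →L[ℝ] Plane))) 0 := by
    have h1 : HasFDerivAt (chartField X p) A (σ 0) := by rwa [hσ0]
    exact (L : Plane →L[ℝ] ℂ).hasFDerivAt.comp 0 (h1.comp 0 (hσd 0))
  obtain ⟨F, K, B, hFK, hFB, hFev⟩ := exists_lipschitz_eventuallyEq hF₀c
  have hFl : ∀ᶠ z in 𝓝 (0 : ℂ), ‖F z - Complex.I * l * z‖ ≤ ε * ‖z‖ := by
    filter_upwards [hFev, (hasFDerivAt_iff_isLittleO.1 hF₀d).def hε] with z hz hz'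
    have e1 : F₀ 0 = 0 := by
      simp only [hF₀]
      rw [hσ0, hX0, map_zero]
    rw [e1, sub_zero, sub_zero] at hz'
    rw [hz]
    have e2 := hL (L.symm z)
    rw [L.apply_symm_apply] at e2
    rw [← e2]
    exact hz'
  obtain ⟨C, hC, hGC⟩ := eventually_abs_chartMetricDeriv_le g p
  obtain ⟨m, hm, hGm⟩ := eventually_chartMetric_ge g p
  rw [← hy₀, hnh] at hGC hGm
  have htar := eventually_mem_target_of_range_mem_nhds hp
  -- A is bounded below because L conjugates it to a multiplication of modulus l.
  have hAc : ∃ c, 0 < c ∧ ∀ u, c * ‖u‖ ≤ ‖A u‖ := by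
    refine ⟨l / ((‖(L.symm : ℂ →L[ℝ] Plane)‖ + 1) * (‖(L : Plane →L[ℝ] ℂ)‖ + 1)), by positivity,
      fun u => ?_⟩
    have e1 : ‖u‖ ≤ (‖(L.symm : ℂ →L[ℝ] Plane)‖ + 1) * ‖L u‖ := by
      have := (L.symm : ℂ →L[ℝ] Plane).le_opNorm (L u)
      simp only [ContinuousLinearEquiv.coe_coe, ContinuousLinearEquiv.symm_apply_apply] at this
      nlinarith [norm_nonneg (L u)]
    have e2 : l * ‖L u‖ ≤ (‖(L : Plane →L[ℝ] ℂ)‖ + 1) * ‖A u‖ := by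
      have h1 := (L : Plane →L[ℝ] ℂ).le_opNorm (A u)
      simp only [ContinuousLinearEquiv.coe_coe] at h1
      rw [hL u, norm_mul, norm_mul, Complex.norm_I, one_mul, Complex.norm_real, Real.norm_eq_abs,
        abs_of_pos hl] at h1
      nlinarith [norm_nonneg (A u)]
    rw [div_mul_eq_mul_div, div_le_iff₀ (by positivity)]
    calc l * ‖u‖ ≤ l * ((‖(L.symm : ℂ →L[ℝ] Plane)‖ + 1) * ‖L u‖) := by gcongr
      _ = (‖(L.symm : ℂ →L[ℝ] Plane)‖ + 1) * (l * ‖L u‖) := by ring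
      _ ≤ (‖(L.symm : ℂ →L[ℝ] Plane)‖ + 1) * ((‖(L : Plane →L[ℝ] ℂ)‖ + 1) * ‖A u‖) := by gcongr
      _ = _ := by ring
  obtain ⟨c, hc0, hAc⟩ := hAc
  obtain ⟨ρ₁, hρ₁, hray⟩ := exists_strictMonoOn_ray (G := chartMetric g p)
    (G' := chartMetricDeriv g p) (X := chartField X p) (A := chartFieldDeriv X p) hC hc0 hm
    (htar.mono fun y hy => (hasFDerivWithinAt_chartMetric g hy.1).hasFDerivAt hy.2)
    (htar.mono fun y hy => (hX.hasFDerivWithinAt hr hy.1).hasFDerivAt hy.2)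
    (chartMetric_symm g p)
    ((hX.continuousWithinAt_chartFieldDeriv hr hyt).continuousAt hp) hX0
    (hGC.mono fun y hy => hy.1) (hGC.mono fun y hy => hy.2) hGm hAc
  have hLρ : ∀ᶠ z in 𝓝 (0 : ℂ), ‖L.symm z‖ < ρ₁ :=
    ((L.symm.continuous.norm).tendsto' 0 0 (by simp)).eventually_lt_const hρ₁
  have hUσ : ∀ᶠ z in 𝓝 (0 : ℂ), (extChartAt (𝓡∂ 2) p).symm (σ z) ∈ U := by
    have h1 : Tendsto (extChartAt (𝓡∂ 2) p).symm (𝓝 y₀) (𝓝 p) := by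
      have := (continuousAt_extChartAt_symm (I := 𝓡∂ 2) p).tendsto
      rwa [(extChartAt (𝓡∂ 2) p).left_inv (mem_extChartAt_source p)] at this
    exact (h1.comp hσc).eventually hU
  obtain ⟨ρ₂, hρ₂, hball⟩ := Metric.eventually_nhds_iff.1
    ((hσc.eventually htar).and (hFev.and (hFl.and (hLρ.and hUσ))))
  have hb : ∀ z : ℂ, ‖z‖ ≤ ρ₂ / 2 → _ := fun z hz =>
    hball (y := z) (by rw [dist_zero_right]; linarith)
  -- The first integral is the squared length of X. On the ball of radius ρ₂ / 2 the cut-off field F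
  -- agrees with X, so the orbits found are orbits of X.
  obtain ⟨V, hV0, hVρ, hV⟩ := exists_periodic_of_firstIntegral hFK hFB hε.le hεl
    (half_pos hρ₂) (fun z hz => (hb z hz).2.2.1)
    (f := fun z => chartMetric g p (σ z) (chartField X p (σ z)) (chartField X p (σ z)))
    (by
      intro z hz
      obtain ⟨⟨h1, h2⟩, -⟩ := hb z (by simpa using hz)
      have hG := ((hasFDerivWithinAt_chartMetric g h1).hasFDerivAt h2).continuousAt
      have hXc := ((hX.hasFDerivWithinAt hr h1).hasFDerivAt h2).continuousAt
      have hs := (hσd z).continuousAt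
      have hG' : ContinuousAt (fun z => chartMetric g p (σ z)) z := hG.comp hs
      have hX' : ContinuousAt (fun z => chartField X p (σ z)) z := hXc.comp hs
      exact ((hG'.clm_apply hX').clm_apply hX').continuousWithinAt)
    (by
      intro z hz hzρ
      have h1 := hray (L.symm z) (by simpa using hz) (hb z hzρ).2.2.2.1.le
      simpa only [hσ, map_smul] using h1)
    (by
      intro z hz t ht
      obtain ⟨⟨h1, h2⟩, h3, -⟩ := hb (z t) ht.le
      refine hK.hasDerivAt_chartMetric_self hX hr (c := fun t => σ (z t)) h1 h2 ?_
      have h4 := (hσd (z t)).comp_hasDerivAt t (hz t)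
      refine h4.congr_deriv ?_
      rw [h3]
      simp [hF₀])
  have hVb : ∀ z ∈ V, ‖z‖ ≤ ρ₂ / 2 := fun z hz => by
    have := hVρ hz
    rw [Metric.mem_ball, dist_zero_right] at this
    exact this.le
  refine ⟨{q | q ∈ (extChartAt (𝓡∂ 2) p).source ∧ L (extChartAt (𝓡∂ 2) p q - y₀) ∈ V}, ?_, ?_, ?_⟩
  · have h1 : Tendsto (fun q => L (extChartAt (𝓡∂ 2) p q - y₀)) (𝓝 p) (𝓝 0) := by
      have h2 : ContinuousAt (fun q => L (extChartAt (𝓡∂ 2) p q - y₀)) p :=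
        L.continuous.continuousAt.comp ((continuousAt_extChartAt p).sub continuousAt_const)
      have h3 := h2.tendsto
      rwa [← hy₀, sub_self, map_zero] at h3
    exact (show ∀ᶠ q in 𝓝 p, q ∈ (extChartAt (𝓡∂ 2) p).source from
      extChartAt_source_mem_nhds p).and (h1.eventually hV0)
  · rintro q ⟨hqs, hqV⟩
    have h1 := (hb _ (hVb _ hqV)).2.2.2.2
    simpa only [hσ, ContinuousLinearEquiv.symm_apply_apply, add_sub_cancel,
      (extChartAt (𝓡∂ 2) p).left_inv hqs] using h1
  · rintro q ⟨hqs, hqV⟩ hqp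
    have hz₀ : L (extChartAt (𝓡∂ 2) p q - y₀) ≠ 0 := by
      intro h
      rw [map_eq_zero_iff _ L.injective, sub_eq_zero] at h
      exact hqp ((extChartAt (𝓡∂ 2) p).injOn hqs (mem_extChartAt_source p) h)
    have hσz₀ : (extChartAt (𝓡∂ 2) p).symm (σ (L (extChartAt (𝓡∂ 2) p q - y₀))) = q := by
      simp only [hσ, ContinuousLinearEquiv.symm_apply_apply, add_sub_cancel,
        (extChartAt (𝓡∂ 2) p).left_inv hqs]
    obtain ⟨z, T, hz0, hz, hzV, hper, hleast, hT, hT1, hT2⟩ := hV _ hqV hz₀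
    have htar' : ∀ t, σ (z t) ∈ (extChartAt (𝓡∂ 2) p).target := fun t =>
      (hb _ (hVb _ (hzV t))).1.1
    refine ⟨fun t => (extChartAt (𝓡∂ 2) p).symm (σ (z t)), T, ?_, ?_, ?_, ?_, hT, hT1, hT2, ?_⟩
    · simp only
      rw [hz0, hσz₀]
    · refine isMIntegralCurve_of_hasVelocityWithin fun t =>
        hasVelocityWithin_chart_symm (c := fun t => σ (z t)) (fun t _ => htar' t) (mem_univ t) ?_
      have h4 := (hσd (z t)).comp_hasDerivAt t (hz t)
      rw [hasDerivWithinAt_univ]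
      refine h4.congr_deriv ?_
      rw [(hb _ (hVb _ (hzV t))).2.1]
      simp [hF₀]
    · intro t
      simp only
      rw [hper t]
    · intro t ht heq
      refine hleast t ht ?_
      have h1 := congrArg (extChartAt (𝓡∂ 2) p) heq
      simp only at h1
      rw [(extChartAt (𝓡∂ 2) p).right_inv (htar' t)] at h1
      rw [← h1]
      simp [hσ]
    · intro t
      refine ⟨(extChartAt (𝓡∂ 2) p).map_target (htar' t), ?_⟩
      simp only
      rw [(extChartAt (𝓡∂ 2) p).right_inv (htar' t)]
      simpa [hσ] using hzV t

end ZerosOfKillingFields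

/-! ### All orbits near a zero have the same period -/

section CommonPeriod

variable {M : Type*} [TopologicalSpace M] [ChartedSpace (EuclideanHalfSpace 2) M]
  [IsManifold (𝓡∂ 2) ∞ M]

/-- At a zero, the rotation of a field by a right angle is differentiated by rotating the
derivative of the field. -/
theorem hasFDerivAt_rotField_of_eq_zero {G : Plane → Plane →L[ℝ] Plane →L[ℝ] ℝ}
    {X : Plane → Plane} {A : Plane →L[ℝ] Plane} {y : Plane} (hG : DifferentiableAt ℝ G y)
    (hX : HasFDerivAt X A y) (hX0 : X y = 0) (hpos : 0 < gramDet (G y)) {κ : ℝ}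
    (hκ : ∀ u, rotField (G y) (A u) = κ • u) :
    HasFDerivAt (fun z => rotField (G z) (X z)) (κ • ContinuousLinearMap.id ℝ Plane) y := by
  have hc : ∀ {f : Plane → Plane}, DifferentiableAt ℝ f y → ∀ v : Plane,
      DifferentiableAt ℝ (fun z => G z (f z) v) y := fun hf v =>
    (hG.clm_apply hf).clm_apply (differentiableAt_const v)
  have hD : DifferentiableAt ℝ (fun z => gramDet (G z)) y := by
    unfold gramDet
    exact ((hc (differentiableAt_const _) _).mul (hc (differentiableAt_const _) _)).sub
      ((hc (differentiableAt_const _) _).mul (hc (differentiableAt_const _) _))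
  have hr := ((hD.sqrt hpos.ne').inv (Real.sqrt_pos.2 hpos).ne').hasFDerivAt
  -- The derivative of G does not contribute because it is multiplied by X y = 0.
  have hq : ∀ v : Plane, ∃ q : Plane →L[ℝ] ℝ, HasFDerivAt (fun z => G z (X z) v) q y ∧
      ∀ u, q u = G y (A u) v := by
    intro v
    refine ⟨_, (hG.hasFDerivAt.clm_apply hX).clm_apply (hasFDerivAt_const v y), fun u => ?_⟩
    simp [hX0]
  obtain ⟨q0, hq0, e0⟩ := hq (planeBasis 0)
  obtain ⟨q1, hq1, e1⟩ := hq (planeBasis 1)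
  have hN := (hq0.smul_const (planeBasis 1)).sub (hq1.smul_const (planeBasis 0))
  have h := hr.smul hN
  unfold rotField
  refine h.congr_fderiv ?_
  ext1 u
  have h1 := hκ u
  unfold rotField at h1
  simp [hX0, e0, e1]
  exact h1

/-- Near a zero in the interior, all orbits of a Killing field have the same period. -/
theorem IsKilling.exists_common_period [T2Space M] {g : SurfaceMetric M} {r : ℕ∞} {X Y : VField M}
    (hX : X.IsC r) (hr : 1 ≤ r) (hK : IsKilling g X) (hXY : X.Commute Y) {p : M} {o : ℝ}
    (ho : o ≠ 0) (hY : ∀ᶠ y in 𝓝[range (𝓡∂ 2)] (extChartAt (𝓡∂ 2) p p),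
      chartField Y p y = o • rotField (chartMetric g p y) (chartField X p y))
    (h0 : X p = 0) (hp : range (𝓡∂ 2) ∈ 𝓝 (extChartAt (𝓡∂ 2) p p)) (hA : linearization X p ≠ 0) :
    ∀ᶠ q in 𝓝[≠] p, IsPeriodicPoint X q (2 * Real.pi / Real.sqrt (linearization X p).det) := by
  set A := linearization X p with hA_def
  set l := Real.sqrt A.det with hl_def
  set y₀ := extChartAt (𝓡∂ 2) p p with hy₀
  have hyt := mem_extChartAt_target (I := 𝓡∂ 2) p
  have hnh : 𝓝[range (𝓡∂ 2)] y₀ = 𝓝 y₀ := nhdsWithin_eq_nhds.2 hp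
  obtain ⟨-, -, hdet, κ, hκ0, hκ⟩ := skew_coordinates (innerAt_symm g p)
    (fun u hu => innerAt_pos g p hu) (hK.linearization_skew h0) hA
  have hl : 0 < l := Real.sqrt_pos.2 hdet
  have hX0 : chartField X p y₀ = 0 := by
    rw [hy₀, chartField_self]
    exact h0
  have hXd : HasFDerivAt (chartField X p) A y₀ := (hX.hasFDerivWithinAt hr hyt).hasFDerivAt hp
  have hG0 : chartMetric g p y₀ = innerAt g p := by
    ext u v
    exact chartMetric_self g p u v
  set W := chartField Y p with hW
  rw [hnh] at hY
  have hWd : HasFDerivAt W ((o * κ) • ContinuousLinearMap.id ℝ Plane) y₀ := by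
    have h1 := (hasFDerivAt_rotField_of_eq_zero
      ((hasFDerivWithinAt_chartMetric g hyt).hasFDerivAt hp).differentiableAt hXd hX0
      (gramDet_pos (chartMetric_symm g p y₀) fun u hu => chartMetric_pos g hyt hu)
      (κ := κ) (by rw [hG0]; exact hκ)).const_smul o
    rw [smul_smul] at h1
    exact h1.congr_of_eventuallyEq hY
  have hW0 : W y₀ = 0 := by
    rw [hY.self_of_nhds, hX0]
    simp [rotField]
  set μ := |o * κ| with hμ_def
  have hμ : 0 < μ := abs_pos.2 (mul_ne_zero ho hκ0)
  -- The sign of k makes k • Y attracting: its linearization at p is -μ times the identity.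
  obtain ⟨k, hk⟩ : ∃ k : ℝ, k * (o * κ) = -μ := by
    refine ⟨-μ / (o * κ), ?_⟩
    have := mul_ne_zero ho hκ0
    field_simp
  have hkWd : HasFDerivAt (fun y => k • W y) ((-μ) • ContinuousLinearMap.id ℝ Plane) y₀ := by
    rw [← hk, ← smul_smul]
    exact hWd.const_smul k
  have hWc : ContDiffAt ℝ 1 (fun y => k • W y) y₀ :=
    ((hXY.right p).contDiffAt hp).const_smul k
  obtain ⟨F, K, B, hFK, hFB, hFev⟩ := exists_lipschitz_eventuallyEq hWc
  have hF0 : F y₀ = 0 := by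
    have h1 : F y₀ = k • W y₀ := hFev.self_of_nhds
    rw [h1, hW0, smul_zero]
  have hFμ : ∀ᶠ y in 𝓝 y₀, ‖F y + μ • (y - y₀)‖ ≤ μ / 2 * ‖y - y₀‖ := by
    filter_upwards [hFev, (hasFDerivAt_iff_isLittleO.1 hkWd).def (half_pos hμ)] with y hy hy'
    rw [hW0, smul_zero, sub_zero, ← hy] at hy'
    simpa using hy'
  obtain ⟨V, hV, -, hVper⟩ := hK.exists_periodic_nhds hX hr h0 hp hA (half_pos hl)
    (half_lt_self hl) (U := univ) univ_mem
  have hsymm : Tendsto (extChartAt (𝓡∂ 2) p).symm (𝓝 y₀) (𝓝 p) := by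
    have := (continuousAt_extChartAt_symm (I := 𝓡∂ 2) p).tendsto
    rwa [(extChartAt (𝓡∂ 2) p).left_inv (mem_extChartAt_source p)] at this
  obtain ⟨R, hR, hball⟩ := Metric.eventually_nhds_iff.1
    ((eventually_mem_target_of_range_mem_nhds hp).and (hFev.and (hFμ.and (hsymm.eventually hV))))
  have hb : ∀ y : Plane, ‖y - y₀‖ ≤ R / 2 → _ := fun y hy =>
    hball (y := y) (by rw [dist_eq_norm]; linarith)
  have hnear : ∀ᶠ q in 𝓝 p, ‖extChartAt (𝓡∂ 2) p q - y₀‖ < R / 2 := by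
    have h1 := Metric.tendsto_nhds.1 (continuousAt_extChartAt (I := 𝓡∂ 2) p).tendsto (R / 2)
      (half_pos hR)
    simpa only [dist_eq_norm] using h1
  rw [eventually_nhdsWithin_iff]
  filter_upwards [hnear, extChartAt_source_mem_nhds (I := 𝓡∂ 2) p] with q hqR hqs hqp
  have hqy : extChartAt (𝓡∂ 2) p q ≠ y₀ := fun h =>
    hqp ((extChartAt (𝓡∂ 2) p).injOn hqs (mem_extChartAt_source p) h)
  -- The orbit of k • Y through q; it stays in the region of periodic X-orbits and tends to p
  -- without reaching it.
  obtain ⟨c, hc0, hc⟩ := exists_global_solution hFK hFB (extChartAt (𝓡∂ 2) p q)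
  obtain ⟨hstay, hlim⟩ := tendsto_of_contracting hμ (fun y hy => (hb y hy).2.2.1) hc
    (by rw [hc0]; exact hqR.le) (by rwa [hc0])
  have hcne : ∀ s, c s ≠ y₀ := ne_of_solution hFK hF0 hc (t₀ := 0) (by rwa [hc0])
  have htar : ∀ s ∈ Ici (0 : ℝ), c s ∈ (extChartAt (𝓡∂ 2) p).target := fun s hs =>
    (hb _ (hstay s hs)).1.1
  have hpne : ∀ s ∈ Ici (0 : ℝ), (extChartAt (𝓡∂ 2) p).symm (c s) ≠ p := by
    intro s hs h
    refine hcne s ?_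
    rw [← (extChartAt (𝓡∂ 2) p).right_inv (htar s hs), h]
  have hex : ∀ s, ∃ γ : ℝ → M, γ 0 = (extChartAt (𝓡∂ 2) p).symm (c s) ∧
      (s ∈ Ici (0 : ℝ) → IsMIntegralCurve γ X) := by
    intro s
    by_cases hs : s ∈ Ici (0 : ℝ)
    · obtain ⟨γ, T, h1, h2, -⟩ := hVper _ (hb _ (hstay s hs)).2.2.2 (hpne s hs)
      exact ⟨γ, h1, fun _ => h2⟩
    · exact ⟨fun _ => (extChartAt (𝓡∂ 2) p).symm (c s), rfl, fun h => absurd h hs⟩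
  choose Γ hΓ0 hΓ using hex
  have hper : ∀ {T s₁ s₂ : ℝ}, s₁ ∈ Ici (0 : ℝ) → s₂ ∈ Ici (0 : ℝ) →
      IsPeriodicPoint X ((extChartAt (𝓡∂ 2) p).symm (c s₁)) T →
      IsPeriodicPoint X ((extChartAt (𝓡∂ 2) p).symm (c s₂)) T := by
    intro T s₁ s₂ hs₁ hs₂ h
    have h1 : (fun s => Γ s 0) = fun s => (extChartAt (𝓡∂ 2) p).symm (c s) := funext hΓ0
    have h2 := IsPeriodicPoint.of_commute hXY (F := fun t s => Γ s t) (S := Ici 0) ordConnected_Ici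
      (k := fun _ => k) continuousOn_const (fun s hs => hΓ s hs) (T := T) (s₁ := s₁) (s₂ := s₂)
      (fun s hs => by
        simp only [h1]
        refine hasVelocityWithin_chart_symm htar hs ?_
        have h3 := (hc s).hasDerivWithinAt (s := Ici 0)
        rwa [(hb _ (hstay s hs)).2.1] at h3) hs₁ hs₂ (by rw [hΓ0]; exact h)
    rwa [hΓ0] at h2
  obtain ⟨γ, T, hγ0, hγ, hγT, hγl, hT, -⟩ := hVper _ (hb _ (hstay 0 le_rfl)).2.2.2
    (hpne 0 self_mem_Ici)
  have hT0 : IsPeriodicPoint X ((extChartAt (𝓡∂ 2) p).symm (c 0)) T := ⟨hT, γ, hγ0, hγ, hγT, hγl⟩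
  -- The period T at q is also the period at c s for large s, which lies in the neighbourhood
  -- belonging to ε. So T satisfies the estimates for every ε, which forces l * T = 2π.
  have hest : ∀ ε, 0 < ε → ε < l → 2 * Real.pi ≤ (l + ε) * T ∧ (l - ε) * T ≤ 2 * Real.pi := by
    intro ε hε hεl
    obtain ⟨V', hV', -, hper'⟩ := hK.exists_periodic_nhds hX hr h0 hp hA hε hεl (U := univ)
      univ_mem
    obtain ⟨s, hsV, hs0⟩ := (((hsymm.comp hlim).eventually hV').and (eventually_ge_atTop 0)).exists
    obtain ⟨γ', T', h1, h2, h3, h4, h5, h6, h7, -⟩ := hper' _ hsV (hpne s hs0)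
    have h8 : IsPeriodicPoint X ((extChartAt (𝓡∂ 2) p).symm (c s)) T' := ⟨h5, γ', h1, h2, h3, h4⟩
    rw [(hper self_mem_Ici hs0 hT0).period_unique hXY.left h8]
    exact ⟨h6, h7⟩
  have hTl : l * T = 2 * Real.pi := by
    have h1 : Tendsto (fun ε : ℝ => (l + ε) * T) (𝓝[>] 0) (𝓝 (l * T)) := by
      have : Continuous fun ε : ℝ => (l + ε) * T := by fun_prop
      exact (this.tendsto' 0 _ (by simp)).mono_left nhdsWithin_le_nhds
    have h2 : Tendsto (fun ε : ℝ => (l - ε) * T) (𝓝[>] 0) (𝓝 (l * T)) := by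
      have : Continuous fun ε : ℝ => (l - ε) * T := by fun_prop
      exact (this.tendsto' 0 _ (by simp)).mono_left nhdsWithin_le_nhds
    have h3 : ∀ᶠ ε in 𝓝[>] (0 : ℝ), 0 < ε ∧ ε < l := Ioo_mem_nhdsGT hl
    exact le_antisymm (le_of_tendsto h2 (h3.mono fun ε hε => (hest ε hε.1 hε.2).2))
      (ge_of_tendsto h1 (h3.mono fun ε hε => (hest ε hε.1 hε.2).1))
  have hTeq : T = 2 * Real.pi / l := by
    rw [eq_div_iff hl.ne']
    linarith
  rw [← hTeq]
  rwa [hc0, (extChartAt (𝓡∂ 2) p).left_inv hqs] at hT0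

end CommonPeriod

/-! ### Conserved quantities along geodesics -/

section Geodesics

variable {M : Type*} [TopologicalSpace M] [ChartedSpace (EuclideanHalfSpace 2) M]
  [IsManifold (𝓡∂ 2) ∞ M]

theorem chartMetricDeriv_symm (g : SurfaceMetric M) {p : M} {y : Plane}
    (hy : y ∈ (extChartAt (𝓡∂ 2) p).target) (w u v : Plane) :
    chartMetricDeriv g p y w u v = chartMetricDeriv g p y w v u := by
  have key : ∀ u v : Plane, ∃ q : Plane →L[ℝ] ℝ, (∀ w, q w = chartMetricDeriv g p y w u v) ∧
      HasFDerivWithinAt (fun z => chartMetric g p z u v) q (range (𝓡∂ 2)) y := by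
    intro u v
    refine ⟨_, fun w => ?_, ((hasFDerivWithinAt_chartMetric g hy).clm_apply
      (hasFDerivWithinAt_const u y _)).clm_apply (hasFDerivWithinAt_const v y _)⟩
    simp
  obtain ⟨q₁, h1, h1'⟩ := key u v
  obtain ⟨q₂, h2, h2'⟩ := key v u
  have h3 : (fun z => chartMetric g p z v u) = fun z => chartMetric g p z u v :=
    funext fun z => chartMetric_symm g p z v u
  rw [h3] at h2'
  rw [← h1, ← h2, (𝓡∂ 2).uniqueDiffOn.eq (extChartAt_target_subset_range p hy) h1' h2']

/-- The velocity of a curve within a set of times. -/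
noncomputable def curveVelocity (γ : ℝ → M) (S : Set ℝ) (t : ℝ) : Plane :=
  derivWithin (extChartAt (𝓡∂ 2) (γ t) ∘ γ) S t

namespace IsGeodesicOn

variable {g : SurfaceMetric M} {γ : ℝ → M} {S : Set ℝ}

theorem hasDerivWithinAt (h : IsGeodesicOn g γ S) {p : M} {t : ℝ} (ht : t ∈ S)
    (hp : γ t ∈ (extChartAt (𝓡∂ 2) p).source) :
    HasDerivWithinAt (extChartAt (𝓡∂ 2) p ∘ γ) (derivWithin (extChartAt (𝓡∂ 2) p ∘ γ) S t) S t :=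
  ((h.contDiff p t ht hp).differentiableWithinAt (by simp)).hasDerivWithinAt

theorem hasDerivWithinAt_derivWithin (h : IsGeodesicOn g γ S) (hS : UniqueDiffOn ℝ S) {p : M}
    {t : ℝ} (ht : t ∈ S) (hp : γ t ∈ (extChartAt (𝓡∂ 2) p).source) :
    HasDerivWithinAt (derivWithin (extChartAt (𝓡∂ 2) p ∘ γ) S)
      (derivWithin (derivWithin (extChartAt (𝓡∂ 2) p ∘ γ) S) S t) S t := by
  have h1 : ContDiffWithinAt ℝ 1 (fun s => fderivWithin ℝ (extChartAt (𝓡∂ 2) p ∘ γ) S s 1) S t :=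
    ((h.contDiff p t ht hp).fderivWithin_right (m := 1) hS (by norm_num) ht).clm_apply
      contDiffWithinAt_const
  exact (h1.differentiableWithinAt one_ne_zero).hasDerivWithinAt

theorem eventually_mem_source (h : IsGeodesicOn g γ S) {p : M} {t : ℝ} (ht : t ∈ S)
    (hp : γ t ∈ (extChartAt (𝓡∂ 2) p).source) :
    ∀ᶠ s in 𝓝[S] t, γ s ∈ (extChartAt (𝓡∂ 2) p).source :=
  (h.continuousOn t ht).preimage_mem_nhdsWithin (extChartAt_source_mem_nhds' hp)

theorem tangentCoordChange_curveVelocity (h : IsGeodesicOn g γ S) (hS : UniqueDiffOn ℝ S) {p : M}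
    {t : ℝ} (ht : t ∈ S) (hp : γ t ∈ (extChartAt (𝓡∂ 2) p).source) :
    tangentCoordChange (𝓡∂ 2) (γ t) p (γ t) (curveVelocity γ S t) =
      derivWithin (extChartAt (𝓡∂ 2) p ∘ γ) S t :=
  ((hasDerivWithinAt_chart_change (mem_extChartAt_source (γ t)) hp (h.continuousOn t ht)
    (h.hasDerivWithinAt ht (mem_extChartAt_source (γ t)))).derivWithin (hS t ht)).symm

theorem innerAt_curveVelocity (h : IsGeodesicOn g γ S) (hS : UniqueDiffOn ℝ S) {p : M}
    {t : ℝ} (ht : t ∈ S) (hp : γ t ∈ (extChartAt (𝓡∂ 2) p).source) :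
    innerAt g (γ t) (curveVelocity γ S t) (curveVelocity γ S t) =
      chartMetric g p (extChartAt (𝓡∂ 2) p (γ t)) (derivWithin (extChartAt (𝓡∂ 2) p ∘ γ) S t)
        (derivWithin (extChartAt (𝓡∂ 2) p ∘ γ) S t) := by
  rw [← h.tangentCoordChange_curveVelocity hS ht hp,
    chartMetric_tangentCoordChange g (mem_extChartAt_source (γ t)) hp, chartMetric_self]

theorem innerAt_field_curveVelocity (h : IsGeodesicOn g γ S) (hS : UniqueDiffOn ℝ S)
    (X : VField M) {p : M} {t : ℝ} (ht : t ∈ S) (hp : γ t ∈ (extChartAt (𝓡∂ 2) p).source) :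
    innerAt g (γ t) (fieldAt X (γ t)) (curveVelocity γ S t) =
      chartMetric g p (extChartAt (𝓡∂ 2) p (γ t)) (chartField X p (extChartAt (𝓡∂ 2) p (γ t)))
        (derivWithin (extChartAt (𝓡∂ 2) p ∘ γ) S t) := by
  rw [← h.tangentCoordChange_curveVelocity hS ht hp, chartField_apply X hp,
    chartMetric_tangentCoordChange g (mem_extChartAt_source (γ t)) hp, chartMetric_self]

set_option maxSynthPendingDepth 3 in
theorem hasDerivWithinAt_metric (h : IsGeodesicOn g γ S) {p : M} {t : ℝ} (ht : t ∈ S)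
    (hp : γ t ∈ (extChartAt (𝓡∂ 2) p).source) :
    HasDerivWithinAt (fun s => chartMetric g p (extChartAt (𝓡∂ 2) p (γ s)))
      (chartMetricDeriv g p (extChartAt (𝓡∂ 2) p (γ t))
        (derivWithin (extChartAt (𝓡∂ 2) p ∘ γ) S t)) S t :=
  (hasFDerivWithinAt_chartMetric g ((extChartAt (𝓡∂ 2) p).map_source hp)).comp_hasDerivWithinAt
    (f := extChartAt (𝓡∂ 2) p ∘ γ) t (h.hasDerivWithinAt ht hp)
    (fun s _ => extChartAt_mem_range p (γ s))

/-- Geodesics have constant speed. -/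
theorem hasDerivWithinAt_speed (h : IsGeodesicOn g γ S) (hS : UniqueDiffOn ℝ S) {t : ℝ}
    (ht : t ∈ S) : HasDerivWithinAt
      (fun s => innerAt g (γ s) (curveVelocity γ S s) (curveVelocity γ S s)) 0 S t := by
  set p := γ t with hp_def
  have hp : γ t ∈ (extChartAt (𝓡∂ 2) p).source := mem_extChartAt_source p
  have hyt := (extChartAt (𝓡∂ 2) p).map_source hp
  set c := extChartAt (𝓡∂ 2) p ∘ γ with hc
  have h2 := h.hasDerivWithinAt_derivWithin hS ht hp
  have hG := h.hasDerivWithinAt_metric ht hp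
  have h3 := hG.clm_apply h2
  have h4 := h3.clm_apply h2
  have hev : ∀ᶠ s in 𝓝[S] t, innerAt g (γ s) (curveVelocity γ S s) (curveVelocity γ S s) =
      chartMetric g p (extChartAt (𝓡∂ 2) p (γ s)) (derivWithin c S s) (derivWithin c S s) := by
    filter_upwards [h.eventually_mem_source ht hp, self_mem_nhdsWithin] with s hs hsS
    exact h.innerAt_curveVelocity hS hsS hs
  refine (h4.congr_of_eventuallyEq hev (hev.self_of_nhdsWithin ht)).congr_deriv ?_
  -- Tested with the velocity, the geodesic equation is half the derivative of the squared speed.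
  have e1 := h.equation p t ht hp c rfl (derivWithin c S t)
  have e2 := chartMetric_symm g p (c t) (derivWithin c S t) (derivWithin (derivWithin c S) S t)
  simp only [hc, Function.comp] at e1 e2 ⊢
  simp only [add_apply]
  linarith

/-- The inner product of a Killing field with the velocity of a geodesic is constant. -/
theorem hasDerivWithinAt_inner_killing (h : IsGeodesicOn g γ S) (hS : UniqueDiffOn ℝ S) {r : ℕ∞}
    {X : VField M} (hX : X.IsC r) (hr : 1 ≤ r) (hK : IsKilling g X) {t : ℝ}
    (ht : t ∈ S) : HasDerivWithinAt
      (fun s => innerAt g (γ s) (fieldAt X (γ s)) (curveVelocity γ S s)) 0 S t := by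
  set p := γ t with hp_def
  have hp : γ t ∈ (extChartAt (𝓡∂ 2) p).source := mem_extChartAt_source p
  have hyt := (extChartAt (𝓡∂ 2) p).map_source hp
  set c := extChartAt (𝓡∂ 2) p ∘ γ with hc
  have h2 := h.hasDerivWithinAt_derivWithin hS ht hp
  have hG := h.hasDerivWithinAt_metric ht hp
  have hXc : HasDerivWithinAt (fun s => chartField X p (extChartAt (𝓡∂ 2) p (γ s)))
      (chartFieldDeriv X p (extChartAt (𝓡∂ 2) p (γ t)) (derivWithin c S t)) S t :=
    (hX.hasFDerivWithinAt hr hyt).comp_hasDerivWithinAt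
      (f := extChartAt (𝓡∂ 2) p ∘ γ) t (h.hasDerivWithinAt ht hp)
      (fun s _ => extChartAt_mem_range p (γ s))
  have h3 := hG.clm_apply hXc
  have h4 := h3.clm_apply h2
  have hev : ∀ᶠ s in 𝓝[S] t, innerAt g (γ s) (fieldAt X (γ s)) (curveVelocity γ S s) =
      chartMetric g p (extChartAt (𝓡∂ 2) p (γ s)) (chartField X p (extChartAt (𝓡∂ 2) p (γ s)))
        (derivWithin c S s) := by
    filter_upwards [h.eventually_mem_source ht hp, self_mem_nhdsWithin] with s hs hsS
    exact h.innerAt_field_curveVelocity hS X hsS hs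
  refine (h4.congr_of_eventuallyEq hev (hev.self_of_nhdsWithin ht)).congr_deriv ?_
  -- The geodesic equation is tested with X and the Killing equation with the velocity twice; half
  -- of the latter supplies the missing terms of the product rule.
  have e1 := h.equation p t ht hp c rfl (chartField X p (c t))
  have e2 := chartMetric_symm g p (c t) (chartField X p (c t)) (derivWithin (derivWithin c S) S t)
  have e3 := hK p (c t) hyt (derivWithin c S t) (derivWithin c S t)
  have e4 := chartMetric_symm g p (c t) (derivWithin c S t)
    (chartFieldDeriv X p (c t) (derivWithin c S t))
  have e5 := chartMetricDeriv_symm g hyt (derivWithin c S t) (chartField X p (c t))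
    (derivWithin c S t)
  unfold lieDerivMetric at e3
  simp only [hc, Function.comp] at e1 e2 e3 e4 e5 ⊢
  simp only [add_apply]
  linarith

theorem eq_of_hasDerivWithinAt_zero {f : ℝ → ℝ} (hf : ∀ t ∈ Icc (0 : ℝ) 1,
    HasDerivWithinAt f 0 (Icc 0 1) t) {t : ℝ} (ht : t ∈ Icc (0 : ℝ) 1) : f t = f 0 := by
  have := (convex_Icc (0 : ℝ) 1).norm_image_sub_le_of_norm_hasDerivWithin_le (C := 0) hf
    (fun _ _ => by simp) (left_mem_Icc.2 zero_le_one) ht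
  rw [zero_mul] at this
  exact sub_eq_zero.1 (norm_le_zero_iff.1 this)

theorem speed_eq (h : IsGeodesicOn g γ (Icc 0 1)) {t : ℝ} (ht : t ∈ Icc (0 : ℝ) 1) :
    innerAt g (γ t) (curveVelocity γ (Icc 0 1) t) (curveVelocity γ (Icc 0 1) t) =
      innerAt g (γ 0) (curveVelocity γ (Icc 0 1) 0) (curveVelocity γ (Icc 0 1) 0) :=
  eq_of_hasDerivWithinAt_zero (fun _ ht => h.hasDerivWithinAt_speed uniqueDiffOn_Icc_zero_one ht) ht

theorem inner_killing_eq (h : IsGeodesicOn g γ (Icc 0 1)) {r : ℕ∞}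
    {X : VField M} (hX : X.IsC r) (hr : 1 ≤ r) (hK : IsKilling g X) {t : ℝ}
    (ht : t ∈ Icc (0 : ℝ) 1) :
    innerAt g (γ t) (fieldAt X (γ t)) (curveVelocity γ (Icc 0 1) t) =
      innerAt g (γ 0) (fieldAt X (γ 0)) (curveVelocity γ (Icc 0 1) 0) :=
  eq_of_hasDerivWithinAt_zero
    (fun _ ht => h.hasDerivWithinAt_inner_killing uniqueDiffOn_Icc_zero_one hX hr hK ht) ht

end IsGeodesicOn

end Geodesics

/-! ### Exponentials of short vectors -/

section ExponentialMap

variable {M : Type*} [TopologicalSpace M] [ChartedSpace (EuclideanHalfSpace 2) M]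
  [IsManifold (𝓡∂ 2) ∞ M]

/-- The exponential of a small nonzero vector is close to, but different from, the base point. -/
theorem exists_isExp_mem [T2Space M] (g : SurfaceMetric M) {p : M} {N : Set M} (hN : N ∈ 𝓝 p) :
    ∃ ε : ℝ, 0 < ε ∧ ∀ v : Plane, v ≠ 0 → innerAt g p v v < ε ^ 2 →
      ∀ q, IsExp g p v q → q ∈ N ∧ q ≠ p := by
  set y₀ := extChartAt (𝓡∂ 2) p p with hy₀
  obtain ⟨C, hC, hGC⟩ := eventually_abs_chartMetricDeriv_le g p
  obtain ⟨m, hm, hGm⟩ := eventually_chartMetric_ge g p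
  have hNy : ∀ᶠ y in 𝓝[range (𝓡∂ 2)] y₀, (extChartAt (𝓡∂ 2) p).symm y ∈ N := by
    have := (continuousAt_extChartAt_symm (I := 𝓡∂ 2) p).tendsto
    rw [(extChartAt (𝓡∂ 2) p).left_inv (mem_extChartAt_source p)] at this
    exact eventually_nhdsWithin_of_eventually_nhds (this.eventually hN)
  have htar : ∀ᶠ y in 𝓝[range (𝓡∂ 2)] y₀, y ∈ (extChartAt (𝓡∂ 2) p).target :=
    extChartAt_target_mem_nhdsWithin p
  obtain ⟨R, hR0, hRt⟩ := ((eventually_mem_nhdsWithin (a := (0 : ℝ)) (s := Ioi 0)).and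
    (eventually_forall_closedBall (htar.and (hGC.and (hGm.and hNy))))).exists
  rw [mem_Ioi] at hR0
  set k := Real.sqrt m with hk
  have hk0 : 0 < k := Real.sqrt_pos.2 hm
  have hk2 : k ^ 2 = m := Real.sq_sqrt hm.le
  set b := Real.sqrt C with hb
  have hb0 : 0 < b := Real.sqrt_pos.2 hC
  have hb2 : b ^ 2 = C := Real.sq_sqrt hC.le
  -- For a geodesic of g-speed e, the geodesic equation bounds the acceleration in the chart by D
  -- e².
  set D := 3 * C / (2 * m) * (1 / m) with hD
  have hD0 : 0 < D := by positivity
  -- The first bound keeps the geodesic in the ball up to time 1; the second prevents the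
  -- acceleration from bringing it back to p.
  refine ⟨min (R * k) (1 / (b * D)), by positivity, fun v hv hve q hq => ?_⟩
  obtain ⟨γ, hγ, hγ0, hγv, hγ1⟩ := hq
  have hS := uniqueDiffOn_Icc_zero_one
  set e := Real.sqrt (innerAt g p v v) with he
  have hvv := innerAt_pos g p hv
  have he0 : 0 < e := Real.sqrt_pos.2 hvv
  have he2 : e ^ 2 = innerAt g p v v := Real.sq_sqrt hvv.le
  have heε : e < min (R * k) (1 / (b * D)) := by
    rw [he, Real.sqrt_lt' (by positivity)]
    exact hve
  have heR : e / k < R := by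
    rw [div_lt_iff₀ hk0]
    exact heε.trans_le (min_le_left _ _)
  have heD : b * D * e < 1 := by
    have := heε.trans_le (min_le_right _ _)
    rw [lt_div_iff₀ (by positivity)] at this
    linarith
  have hv0 : curveVelocity γ (Icc 0 1) 0 = v := by
    unfold curveVelocity
    rw [hγ0]
    exact hγv
  have hspeed : ∀ t ∈ Icc (0 : ℝ) 1, γ t ∈ (extChartAt (𝓡∂ 2) p).source →
      chartMetric g p (extChartAt (𝓡∂ 2) p (γ t))
        (derivWithin (extChartAt (𝓡∂ 2) p ∘ γ) (Icc 0 1) t)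
        (derivWithin (extChartAt (𝓡∂ 2) p ∘ γ) (Icc 0 1) t) = e ^ 2 := by
    intro t ht hts
    rw [← hγ.innerAt_curveVelocity hS ht hts, hγ.speed_eq ht, hv0, hγ0, he2]
  set c := extChartAt (𝓡∂ 2) p ∘ γ with hc
  have hbound : ∀ t ∈ Icc (0 : ℝ) 1, γ t ∈ (extChartAt (𝓡∂ 2) p).source →
      extChartAt (𝓡∂ 2) p (γ t) ∈ Metric.closedBall y₀ R → ‖derivWithin c (Icc 0 1) t‖ ≤ e / k := by
    intro t ht hts htR
    have h1 := (hRt _ ⟨htR, extChartAt_mem_range p (γ t)⟩).2.2.1 (derivWithin c (Icc 0 1) t)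
    rw [hspeed t ht hts, ← hk2, ← mul_pow] at h1
    rw [le_div_iff₀ hk0, mul_comm]
    exact (pow_le_pow_iff_left₀ (by positivity) he0.le two_ne_zero).1 h1
  have hmem := mem_closedBall_of_speed_le (y₀ := y₀) (R := R) (r := 0) (N := e / k)
    (fun y hy => (hRt y hy).1) hγ.continuousOn zero_le_one
    (by rw [hγ0]; exact mem_extChartAt_source p) (by rw [hγ0, ← hy₀, sub_self, norm_zero])
    (by positivity) (by linarith) (v := fun t => derivWithin c (Icc 0 1) t)
    (fun t ht hts htR => ⟨hγ.hasDerivWithinAt ht hts, hbound t ht hts htR⟩)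
  have hacc : ∀ t ∈ Icc (0 : ℝ) 1,
      ‖derivWithin (derivWithin c (Icc 0 1)) (Icc 0 1) t‖ ≤ D * e ^ 2 := by
    intro t ht
    obtain ⟨hts, htR⟩ := hmem t ht
    obtain ⟨-, ⟨-, h2⟩, h3, -⟩ := hRt _ ⟨htR, extChartAt_mem_range p (γ t)⟩
    set a := derivWithin (derivWithin c (Icc 0 1)) (Icc 0 1) t
    set u := derivWithin c (Icc 0 1) t with hu
    have e1 := hγ.equation p t ht hts c rfl a
    have hct : c t = extChartAt (𝓡∂ 2) p (γ t) := rfl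
    rw [hct] at e1
    have e2 := h2 u u a
    have e3 := h2 a u u
    have e4 := h3 a
    have hue := hbound t ht hts htR
    rw [abs_le] at e2 e3
    have e5 : m * ‖a‖ ^ 2 ≤ 3 / 2 * C * ‖u‖ ^ 2 * ‖a‖ := by linarith
    have e6 : ‖u‖ ^ 2 ≤ e ^ 2 * (1 / m) := by
      calc ‖u‖ ^ 2 ≤ (e / k) ^ 2 := by gcongr
        _ = e ^ 2 * (1 / m) := by rw [div_pow, hk2]; ring
    have e7 : m * ‖a‖ ≤ 3 / 2 * C * ‖u‖ ^ 2 := by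
      rcases eq_or_lt_of_le (norm_nonneg a) with h | h
      · rw [← h, mul_zero]
        positivity
      · refine le_of_mul_le_mul_right ?_ h
        linarith
    have e8 : m * ‖a‖ ≤ 3 / 2 * C * (e ^ 2 * (1 / m)) := e7.trans (by gcongr)
    rw [hD]
    have e9 : ‖a‖ ≤ 3 / 2 * C * (e ^ 2 * (1 / m)) / m := by
      rw [le_div_iff₀ hm]
      linarith
    refine e9.trans (le_of_eq ?_)
    field_simp
  have hdc : ∀ t ∈ Icc (0 : ℝ) 1, ‖derivWithin c (Icc 0 1) t - v‖ ≤ D * e ^ 2 := by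
    intro t ht
    have h1 := (convex_Icc (0 : ℝ) 1).norm_image_sub_le_of_norm_hasDerivWithin_le
      (fun t ht => hγ.hasDerivWithinAt_derivWithin hS ht (hmem t ht).1) hacc
      (left_mem_Icc.2 zero_le_one) ht
    rw [← hγv]
    refine h1.trans ?_
    rw [sub_zero, Real.norm_eq_abs, abs_of_nonneg ht.1]
    exact mul_le_of_le_one_right (by positivity) ht.2
  have hc1 : ‖c 1 - y₀ - v‖ ≤ D * e ^ 2 := by
    have h1 := (convex_Icc (0 : ℝ) 1).norm_image_sub_le_of_norm_hasDerivWithin_le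
      (f := fun t => c t - t • v) (f' := fun t => derivWithin c (Icc 0 1) t - v)
      (fun t ht => by
        have h2 := ((hasDerivWithinAt_id t (Icc (0 : ℝ) 1)).smul_const v)
        rw [one_smul] at h2
        exact (hγ.hasDerivWithinAt ht (hmem t ht).1).sub h2) hdc
      (left_mem_Icc.2 zero_le_one) (right_mem_Icc.2 zero_le_one)
    have hc0 : c 0 = y₀ := by
      simp only [hc, Function.comp, hγ0, hy₀]
    simp only [hc0, one_smul, zero_smul, sub_zero, norm_one, mul_one] at h1
    rwa [sub_right_comm] at h1
  obtain ⟨h1s, h1R⟩ := hmem 1 (right_mem_Icc.2 zero_le_one)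
  rw [hγ1] at h1s h1R
  have h2 := (hRt _ ⟨h1R, extChartAt_mem_range p q⟩).2.2.2
  rw [(extChartAt (𝓡∂ 2) p).left_inv h1s] at h2
  refine ⟨h2, ?_⟩
  rintro rfl
  have h3 : c 1 = y₀ := by
    simp only [hc, Function.comp, hγ1, hy₀]
  rw [h3, sub_self, zero_sub, norm_neg] at hc1
  -- If q = p, then ‖v‖ ≤ D e², so e ≤ b ‖v‖ ≤ b D e², against b D e < 1.
  have h4 : e ≤ b * ‖v‖ := by
    have h5 := (hRt y₀ ⟨Metric.mem_closedBall_self hR0.le, extChartAt_mem_range q q⟩).2.1.1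
    have h6 : innerAt g q v v ≤ C * ‖v‖ * ‖v‖ := by
      rw [← chartMetric_self]
      refine (le_abs_self _).trans (((chartMetric g q y₀ v).le_opNorm v).trans ?_)
      gcongr
      exact (chartMetric g q y₀).le_of_opNorm_le h5 v
    rw [← he2, ← hb2] at h6
    refine (pow_le_pow_iff_left₀ he0.le (by positivity) two_ne_zero).1 ?_
    rw [mul_pow]
    linarith
  have h5 : b * ‖v‖ ≤ b * (D * e ^ 2) := by gcongr
  nlinarith

end ExponentialMap

/-! ### Chart independence of the geodesic equation -/

section GeodesicEquation

variable {M : Type*} [TopologicalSpace M] [ChartedSpace (EuclideanHalfSpace 2) M]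
  [IsManifold (𝓡∂ 2) ∞ M]

/-- The transition map between the preferred charts at `p` and `p'`. -/
noncomputable abbrev transitionMap (p p' : M) : Plane → Plane :=
  extChartAt (𝓡∂ 2) p' ∘ (extChartAt (𝓡∂ 2) p).symm

variable {p p' : M} {y : Plane}

theorem contDiffAt_transitionMap (hy : y ∈ (extChartAt (𝓡∂ 2) p).target)
    (hr : range (𝓡∂ 2) ∈ 𝓝 y) (hy' : (extChartAt (𝓡∂ 2) p).symm y ∈ (extChartAt (𝓡∂ 2) p').source) :
    ContDiffAt ℝ ∞ (transitionMap p p') y := by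
  have h1 := (extChartAt (𝓡∂ 2) p).map_target hy
  rw [extChartAt_source] at h1 hy'
  have h2 := contDiffWithinAt_transition (IsManifold.chart_mem_maximalAtlas (I := 𝓡∂ 2) (n := ∞) p)
    (IsManifold.chart_mem_maximalAtlas (I := 𝓡∂ 2) (n := ∞) p') h1 hy'
  have h3 : (chartAt (EuclideanHalfSpace 2) p).extend (𝓡∂ 2) ((extChartAt (𝓡∂ 2) p).symm y) = y :=
    (extChartAt (𝓡∂ 2) p).right_inv hy
  rw [h3] at h2
  exact h2.contDiffAt hr

theorem tangentCoordChange_eq_fderiv (hy : y ∈ (extChartAt (𝓡∂ 2) p).target)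
    (hr : range (𝓡∂ 2) ∈ 𝓝 y) :
    tangentCoordChange (𝓡∂ 2) p p' ((extChartAt (𝓡∂ 2) p).symm y) =
      fderiv ℝ (transitionMap p p') y := by
  rw [tangentCoordChange_def, (extChartAt (𝓡∂ 2) p).right_inv hy, fderivWithin_of_mem_nhds hr]

theorem eventually_mem_transition_source (hy : y ∈ (extChartAt (𝓡∂ 2) p).target)
    (hr : range (𝓡∂ 2) ∈ 𝓝 y) (hy' : (extChartAt (𝓡∂ 2) p).symm y ∈ (extChartAt (𝓡∂ 2) p').source) :
    ∀ᶠ z in 𝓝 y, z ∈ (extChartAt (𝓡∂ 2) p).target ∧ range (𝓡∂ 2) ∈ 𝓝 z ∧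
      (extChartAt (𝓡∂ 2) p).symm z ∈ (extChartAt (𝓡∂ 2) p').source := by
  have h1 := extChartAt_target_mem_nhdsWithin_of_mem (I := 𝓡∂ 2) hy
  rw [nhdsWithin_eq_nhds.2 hr] at h1
  have h2 := (continuousAt_extChartAt_symm'' (I := 𝓡∂ 2) hy).eventually
    ((isOpen_extChartAt_source p').mem_nhds hy')
  exact (show ∀ᶠ z in 𝓝 y, z ∈ (extChartAt (𝓡∂ 2) p).target from h1).and
    ((eventually_mem_nhds_iff.2 hr).and h2)

theorem chartMetric_transitionMap (g : SurfaceMetric M) (hy : y ∈ (extChartAt (𝓡∂ 2) p).target)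
    (hr : range (𝓡∂ 2) ∈ 𝓝 y) (hy' : (extChartAt (𝓡∂ 2) p).symm y ∈ (extChartAt (𝓡∂ 2) p').source)
    (u v : Plane) :
    chartMetric g p' (transitionMap p p' y) (fderiv ℝ (transitionMap p p') y u)
      (fderiv ℝ (transitionMap p p') y v) = chartMetric g p y u v := by
  have h := chartMetric_tangentCoordChange g ((extChartAt (𝓡∂ 2) p).map_target hy) hy' u v
  rw [tangentCoordChange_eq_fderiv hy hr, (extChartAt (𝓡∂ 2) p).right_inv hy] at h
  exact h

set_option maxSynthPendingDepth 3 in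
/-- The transformation of the derivatives of the metric coefficients under a change of charts. -/
theorem chartMetricDeriv_transitionMap (g : SurfaceMetric M)
    (hy : y ∈ (extChartAt (𝓡∂ 2) p).target) (hr : range (𝓡∂ 2) ∈ 𝓝 y)
    (hy' : (extChartAt (𝓡∂ 2) p).symm y ∈ (extChartAt (𝓡∂ 2) p').source) (w u v : Plane) :
    chartMetricDeriv g p y w u v =
      chartMetricDeriv g p' (transitionMap p p' y) (fderiv ℝ (transitionMap p p') y w)
        (fderiv ℝ (transitionMap p p') y u) (fderiv ℝ (transitionMap p p') y v) +
      chartMetric g p' (transitionMap p p' y) (fderiv ℝ (fderiv ℝ (transitionMap p p')) y w u)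
        (fderiv ℝ (transitionMap p p') y v) +
      chartMetric g p' (transitionMap p p' y) (fderiv ℝ (transitionMap p p') y u)
        (fderiv ℝ (fderiv ℝ (transitionMap p p')) y w v) := by
  set Θ := transitionMap p p' with hΘ
  have hΘc := contDiffAt_transitionMap hy hr hy'
  have hline : HasDerivAt (fun s : ℝ => y + s • w) w 0 := by
    have := ((hasDerivAt_id (0 : ℝ)).smul_const w).const_add y
    rwa [one_smul] at this
  have hl0 : y + (0 : ℝ) • w = y := by rw [zero_smul, add_zero]
  have hΘd : HasFDerivAt Θ (fderiv ℝ Θ y) (y + (0 : ℝ) • w) := by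
    rw [hl0]
    exact (hΘc.differentiableAt (by simp)).hasFDerivAt
  have hΘ2 : HasFDerivAt (fderiv ℝ Θ) (fderiv ℝ (fderiv ℝ Θ) y) (y + (0 : ℝ) • w) := by
    rw [hl0]
    exact ((hΘc.fderiv_right (m := ∞) (by simp)).differentiableAt (by simp)).hasFDerivAt
  have hG : HasFDerivAt (chartMetric g p) (chartMetricDeriv g p y) (y + (0 : ℝ) • w) := by
    rw [hl0]
    exact (hasFDerivWithinAt_chartMetric g hy).hasFDerivAt hr
  have hG' : HasFDerivWithinAt (chartMetric g p') (chartMetricDeriv g p' (Θ y)) (range (𝓡∂ 2))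
      (Θ (y + (0 : ℝ) • w)) := by
    rw [hl0]
    exact hasFDerivWithinAt_chartMetric g ((extChartAt (𝓡∂ 2) p').map_source hy')
  have d1 : HasDerivAt (fun s : ℝ => chartMetric g p (y + s • w)) (chartMetricDeriv g p y w) 0 :=
    hG.comp_hasDerivAt (f := fun s : ℝ => y + s • w) 0 hline
  have d2 : HasDerivAt (fun s : ℝ => Θ (y + s • w)) (fderiv ℝ Θ y w) 0 :=
    hΘd.comp_hasDerivAt (f := fun s : ℝ => y + s • w) 0 hline
  have d3 : HasDerivAt (fun s : ℝ => fderiv ℝ Θ (y + s • w)) (fderiv ℝ (fderiv ℝ Θ) y w) 0 :=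
    hΘ2.comp_hasDerivAt (f := fun s : ℝ => y + s • w) 0 hline
  have d4 : HasDerivAt (fun s : ℝ => chartMetric g p' (Θ (y + s • w)))
      (chartMetricDeriv g p' (Θ y) (fderiv ℝ Θ y w)) 0 :=
    hG'.comp_hasDerivAt (f := fun s : ℝ => Θ (y + s • w)) 0 d2
      (Eventually.of_forall fun s => extChartAt_mem_range p' _)
  have d5 : ∀ u : Plane, HasDerivAt (fun s : ℝ => fderiv ℝ Θ (y + s • w) u)
      (fderiv ℝ (fderiv ℝ Θ) y w u) 0 := fun u => by
    have := d3.clm_apply (hasDerivAt_const (0 : ℝ) u)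
    rwa [map_zero, add_zero] at this
  have d6 : HasDerivAt (fun s : ℝ => chartMetric g p (y + s • w) u v)
      (chartMetricDeriv g p y w u v) 0 := by
    have h1 := d1.clm_apply (hasDerivAt_const (0 : ℝ) u)
    rw [map_zero, add_zero] at h1
    have h2 := h1.clm_apply (hasDerivAt_const (0 : ℝ) v)
    rwa [map_zero, add_zero] at h2
  have d7 := d4.clm_apply (d5 u)
  have d8 := d7.clm_apply (d5 v)
  have hev : (fun s : ℝ => chartMetric g p (y + s • w) u v) =ᶠ[𝓝 0] fun s : ℝ =>
      chartMetric g p' (Θ (y + s • w)) (fderiv ℝ Θ (y + s • w) u) (fderiv ℝ Θ (y + s • w) v) := by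
    have ht : Tendsto (fun s : ℝ => y + s • w) (𝓝 0) (𝓝 y) := by
      have := hline.continuousAt.tendsto
      rwa [hl0] at this
    filter_upwards [ht.eventually (eventually_mem_transition_source hy hr hy')] with s hs
    exact (chartMetric_transitionMap g hs.1 hs.2.1 hs.2.2 u v).symm
  have h9 := d6.unique (d8.congr_of_eventuallyEq hev)
  rw [h9, hl0]
  simp only [add_apply]

/-- A curve in the interior which satisfies the geodesic equation in one chart is a geodesic. -/
theorem isGeodesicOn_of_chart (g : SurfaceMetric M) {c u a : ℝ → Plane} {S : Set ℝ}
    (hS : UniqueDiffOn ℝ S) (hc : ∀ t ∈ S, HasDerivWithinAt c (u t) S t)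
    (hu : ∀ t ∈ S, HasDerivWithinAt u (a t) S t) (ha : ContinuousOn a S)
    (htar : ∀ t ∈ S, c t ∈ (extChartAt (𝓡∂ 2) p).target) (hint : ∀ t ∈ S, range (𝓡∂ 2) ∈ 𝓝 (c t))
    (heq : ∀ t ∈ S, ∀ w, chartMetric g p (c t) (a t) w + chartMetricDeriv g p (c t) (u t) (u t) w -
      (1 / 2) * chartMetricDeriv g p (c t) w (u t) (u t) = 0) :
    IsGeodesicOn g (fun t => (extChartAt (𝓡∂ 2) p).symm (c t)) S := by
  have hu1 : ContDiffOn ℝ 1 u S := by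
    rw [show (1 : WithTop ℕ∞) = 0 + 1 by norm_num, contDiffOn_succ_iff_derivWithin hS]
    refine ⟨fun t ht => (hu t ht).differentiableWithinAt, by simp, ?_⟩
    rw [contDiffOn_zero]
    exact ha.congr fun t ht => (hu t ht).derivWithin (hS t ht)
  have hc2 : ContDiffOn ℝ 2 c S := by
    rw [show (2 : WithTop ℕ∞) = 1 + 1 by norm_num, contDiffOn_succ_iff_derivWithin hS]
    exact ⟨fun t ht => (hc t ht).differentiableWithinAt, by simp,
      hu1.congr fun t ht => (hc t ht).derivWithin (hS t ht)⟩
  refine ⟨?_, ?_, ?_⟩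
  · exact (continuousOn_extChartAt_symm p).comp hc2.continuousOn htar
  · intro p' t ht hp'
    have h1 := (contDiffAt_transitionMap (htar t ht) (hint t ht) hp').of_le
      (ENat.LEInfty.out : 2 ≤ ∞)
    exact h1.comp_contDiffWithinAt t (hc2 t ht)
  · rintro p' t ht hp' b rfl w'
    set Θ := transitionMap p p' with hΘ
    have hev : ∀ᶠ s in 𝓝[S] t, s ∈ S ∧ derivWithin (Θ ∘ c) S s = fderiv ℝ Θ (c s) (u s) := by
      filter_upwards [(hc t ht).continuousWithinAt.tendsto.eventually
        (eventually_mem_transition_source (htar t ht) (hint t ht) hp'), self_mem_nhdsWithin]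
        with s hs hsS
      have h1 := ((contDiffAt_transitionMap hs.1 hs.2.1 hs.2.2).differentiableAt
        (by simp)).hasFDerivAt
      exact ⟨hsS, (h1.comp_hasDerivWithinAt s (hc s hsS)).derivWithin (hS s hsS)⟩
    have hb1 := (hev.self_of_nhdsWithin ht).2
    have hΘc := contDiffAt_transitionMap (htar t ht) (hint t ht) hp'
    have hΘ2 : HasFDerivAt (fderiv ℝ Θ) (fderiv ℝ (fderiv ℝ Θ) (c t)) (c t) :=
      ((hΘc.fderiv_right (m := ∞) (by simp)).differentiableAt (by simp)).hasFDerivAt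
    -- The acceleration in the new chart acquires the term D²Θ(u, u).
    have hb2 : derivWithin (derivWithin (Θ ∘ c) S) S t =
        fderiv ℝ (fderiv ℝ Θ) (c t) (u t) (u t) + fderiv ℝ Θ (c t) (a t) := by
      have h1 : HasDerivWithinAt (fun s => fderiv ℝ Θ (c s)) (fderiv ℝ (fderiv ℝ Θ) (c t) (u t))
          S t := hΘ2.comp_hasDerivWithinAt t (hc t ht)
      have h2 := h1.clm_apply (hu t ht)
      exact (h2.congr_of_eventuallyEq (hev.mono fun s hs => hs.2) hb1).derivWithin (hS t ht)
    have hsymm : ∀ v w, fderiv ℝ (fderiv ℝ Θ) (c t) v w = fderiv ℝ (fderiv ℝ Θ) (c t) w v :=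
      hΘc.isSymmSndFDerivAt (by simpa using (ENat.LEInfty.out : 2 ≤ ∞))
    -- DΘ is invertible, so it is enough to test with the images of vectors w.
    obtain ⟨w, rfl⟩ : ∃ w, fderiv ℝ Θ (c t) w = w' := by
      refine ⟨tangentCoordChange (𝓡∂ 2) p' p ((extChartAt (𝓡∂ 2) p).symm (c t)) w', ?_⟩
      rw [← tangentCoordChange_eq_fderiv (htar t ht) (hint t ht)]
      exact tangentCoordChange_comp_inverse ((extChartAt (𝓡∂ 2) p).map_target (htar t ht)) hp' w'
    -- The metric derivatives yield second order terms of Θ. By symmetry of D²Θ, those with D²Θ(u,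
    -- w) cancel, and the one with D²Θ(u, u) is that of the acceleration.
    have e0 := heq t ht w
    have e1 := chartMetricDeriv_transitionMap g (htar t ht) (hint t ht) hp' (u t) (u t) w
    have e2 := chartMetricDeriv_transitionMap g (htar t ht) (hint t ht) hp' w (u t) (u t)
    have e3 := chartMetric_transitionMap g (htar t ht) (hint t ht) hp' (a t) w
    have e4 := chartMetric_symm g p' (Θ (c t)) (fderiv ℝ (fderiv ℝ Θ) (c t) w (u t))
      (fderiv ℝ Θ (c t) (u t))
    have e5 := hsymm (u t) w
    change chartMetric g p' (Θ (c t)) (derivWithin (derivWithin (Θ ∘ c) S) S t) _ +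
      chartMetricDeriv g p' (Θ (c t)) (derivWithin (Θ ∘ c) S t) (derivWithin (Θ ∘ c) S t) _ -
      1 / 2 * chartMetricDeriv g p' (Θ (c t)) _ (derivWithin (Θ ∘ c) S t)
        (derivWithin (Θ ∘ c) S t) = 0
    rw [hb1, hb2, map_add, add_apply]
    rw [← hΘ] at e1 e2 e3
    rw [e5] at e1
    linarith

end GeodesicEquation

/-! ### Existence of geodesics from an interior point -/

section ExistenceOfGeodesics

/-- The vector whose inner products with the standard basis are `a` and `b`. -/
noncomputable def dualVector (B : Plane →L[ℝ] Plane →L[ℝ] ℝ) (a b : ℝ) : Plane :=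
  (gramDet B)⁻¹ •
    ((B (planeBasis 1) (planeBasis 1) * a - B (planeBasis 0) (planeBasis 1) * b) • planeBasis 0 +
      (B (planeBasis 0) (planeBasis 0) * b - B (planeBasis 0) (planeBasis 1) * a) • planeBasis 1)

/-- Cramer's rule for the symmetric matrix of B. It serves to solve the geodesic equation, stated
with a lowered index, for the acceleration. -/
theorem apply_dualVector {B : Plane →L[ℝ] Plane →L[ℝ] ℝ} (hs : ∀ u v, B u v = B v u)
    (hB : gramDet B ≠ 0) (a b : ℝ) (w : Plane) : B (dualVector B a b) w = w 0 * a + w 1 * b := by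
  rw [plane_map (B (dualVector B a b)) w]
  unfold dualVector
  unfold gramDet at hB ⊢
  rw [hs (planeBasis 1) (planeBasis 0)] at hB ⊢
  simp only [map_smul, map_add, add_apply, smul_apply, smul_eq_mul]
  rw [hs (planeBasis 1) (planeBasis 0)]
  linear_combination (w 0 * a + w 1 * b) * inv_mul_cancel₀ hB

variable {M : Type*} [TopologicalSpace M] [ChartedSpace (EuclideanHalfSpace 2) M]
  [IsManifold (𝓡∂ 2) ∞ M]

/-- The acceleration of a geodesic at `y` with velocity `u`, in a chart. -/
noncomputable def geodesicAccel (g : SurfaceMetric M) (p : M) (y u : Plane) : Plane :=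
  dualVector (chartMetric g p y)
    ((1 / 2) * chartMetricDeriv g p y (planeBasis 0) u u - chartMetricDeriv g p y u u (planeBasis 0))
    ((1 / 2) * chartMetricDeriv g p y (planeBasis 1) u u - chartMetricDeriv g p y u u (planeBasis 1))

set_option maxSynthPendingDepth 3 in
theorem apply_geodesicAccel (g : SurfaceMetric M) {p : M} {y : Plane}
    (hy : y ∈ (extChartAt (𝓡∂ 2) p).target) (u w : Plane) :
    chartMetric g p y (geodesicAccel g p y u) w + chartMetricDeriv g p y u u w -
      (1 / 2) * chartMetricDeriv g p y w u u = 0 := by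
  unfold geodesicAccel
  rw [apply_dualVector (chartMetric_symm g p y)
    (gramDet_pos (chartMetric_symm g p y) fun u hu => chartMetric_pos g hy hu).ne',
    plane_map (chartMetricDeriv g p y u u) w, plane_map (chartMetricDeriv g p y) w]
  simp only [add_apply, smul_apply, smul_eq_mul]
  ring

set_option maxSynthPendingDepth 3 in
theorem contDiffAt_geodesicAccel (g : SurfaceMetric M) {p : M} {z : Plane × Plane}
    (hy : z.1 ∈ (extChartAt (𝓡∂ 2) p).target) (hr : range (𝓡∂ 2) ∈ 𝓝 z.1) :
    ContDiffAt ℝ 1 (fun z : Plane × Plane => geodesicAccel g p z.1 z.2) z := by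
  have hG : ContDiffAt ℝ 1 (fun z : Plane × Plane => chartMetric g p z.1) z :=
    (((contDiffWithinAt_chartMetric g hy).contDiffAt hr).of_le (by simp)).comp z contDiffAt_fst
  have hG' : ContDiffAt ℝ 1 (fun z : Plane × Plane => chartMetricDeriv g p z.1) z :=
    (((contDiffWithinAt_chartMetricDeriv g hy).contDiffAt hr).of_le (by simp)).comp z
      contDiffAt_fst
  have h1 : ∀ {a b : Plane × Plane → Plane}, ContDiffAt ℝ 1 a z → ContDiffAt ℝ 1 b z →
      ContDiffAt ℝ 1 (fun z => chartMetric g p z.1 (a z) (b z)) z := fun ha hb =>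
    (hG.clm_apply ha).clm_apply hb
  have h2 : ∀ {a b c : Plane × Plane → Plane}, ContDiffAt ℝ 1 a z → ContDiffAt ℝ 1 b z →
      ContDiffAt ℝ 1 c z →
      ContDiffAt ℝ 1 (fun z => chartMetricDeriv g p z.1 (a z) (b z) (c z)) z := fun ha hb hc =>
    ((hG'.clm_apply ha).clm_apply hb).clm_apply hc
  have hk : ∀ v : Plane, ContDiffAt ℝ 1 (fun _ : Plane × Plane => v) z := fun v => contDiffAt_const
  have hs : ContDiffAt ℝ 1 (fun z : Plane × Plane => z.2) z := contDiffAt_snd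
  have hD : ContDiffAt ℝ 1 (fun z : Plane × Plane => gramDet (chartMetric g p z.1)) z := by
    unfold gramDet
    exact ((h1 (hk _) (hk _)).mul (h1 (hk _) (hk _))).sub ((h1 (hk _) (hk _)).mul (h1 (hk _) (hk _)))
  have hω : ∀ i, ContDiffAt ℝ 1 (fun z : Plane × Plane =>
      (1 / 2) * chartMetricDeriv g p z.1 (planeBasis i) z.2 z.2 -
        chartMetricDeriv g p z.1 z.2 z.2 (planeBasis i)) z := fun i =>
    (contDiffAt_const.mul (h2 (hk _) hs hs)).sub (h2 hs hs (hk _))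
  unfold geodesicAccel dualVector
  exact (hD.inv (gramDet_pos (chartMetric_symm g p z.1)
    fun u hu => chartMetric_pos g hy hu).ne').smul
    (((((h1 (hk _) (hk _)).mul (hω 0)).sub ((h1 (hk _) (hk _)).mul (hω 1))).smul (hk _)).add
      ((((h1 (hk _) (hk _)).mul (hω 1)).sub ((h1 (hk _) (hk _)).mul (hω 0))).smul (hk _)))

/-- The exponential map at an interior point is defined near the origin. -/
theorem exists_isExp (g : SurfaceMetric M) {p : M}
    (hp : range (𝓡∂ 2) ∈ 𝓝 (extChartAt (𝓡∂ 2) p p)) :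
    ∃ ε : ℝ, 0 < ε ∧ ∀ v : Plane, innerAt g p v v < ε ^ 2 → ∃ q, IsExp g p v q := by
  set y₀ := extChartAt (𝓡∂ 2) p p with hy₀
  have hyt := mem_extChartAt_target (I := 𝓡∂ 2) p
  -- The geodesic equation as a first order system for position and velocity; (y₀, 0) is a
  -- stationary point.
  set F₀ : Plane × Plane → Plane × Plane := fun z => (z.2, geodesicAccel g p z.1 z.2) with hF₀
  have hF₀c : ContDiffAt ℝ 1 F₀ (y₀, 0) :=
    contDiffAt_snd.prodMk (contDiffAt_geodesicAccel g hyt hp)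
  obtain ⟨F, K, B, hFK, hFB, hFev⟩ := exists_lipschitz_eventuallyEq hF₀c
  have hF0 : F (y₀, 0) = 0 := by
    have h1 : F (y₀, 0) = F₀ (y₀, 0) := hFev.self_of_nhds
    rw [h1]
    simp [hF₀, geodesicAccel, dualVector]
  have htar : ∀ᶠ z : Plane × Plane in 𝓝 (y₀, 0), z.1 ∈ (extChartAt (𝓡∂ 2) p).target ∧
      range (𝓡∂ 2) ∈ 𝓝 z.1 :=
    (continuous_fst.tendsto' (y₀, (0 : Plane)) y₀ rfl).eventually
      (eventually_mem_target_of_range_mem_nhds hp)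
  obtain ⟨δ, hδ, hball⟩ := Metric.eventually_nhds_iff.1 (hFev.and htar)
  obtain ⟨m, hm, hGm⟩ := eventually_chartMetric_ge g p
  have hGm0 := hGm.self_of_nhdsWithin (extChartAt_mem_range p p)
  set k := Real.sqrt m with hk
  have hk0 : 0 < k := Real.sqrt_pos.2 hm
  have hk2 : k ^ 2 = m := Real.sq_sqrt hm.le
  -- By Gronwall the distance to the stationary solution grows at most by the factor exp K up to
  -- time 1; k converts the length of v for g into its euclidean norm.
  refine ⟨δ * k / Real.exp K, by positivity, fun v hv => ?_⟩
  have hvn : ‖v‖ * Real.exp K < δ := by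
    have h1 := hGm0 v
    rw [chartMetric_self, ← hk2, ← mul_pow] at h1
    have h2 := (pow_lt_pow_iff_left₀ (by positivity) (by positivity) two_ne_zero).1
      (h1.trans_lt hv)
    rw [lt_div_iff₀ (Real.exp_pos _)] at h2
    refine lt_of_mul_lt_mul_right ?_ hk0.le
    linarith
  obtain ⟨z, hz0, hz⟩ := exists_global_solution hFK hFB (y₀, v)
  have hnear : ∀ t ∈ Icc (0 : ℝ) 1, dist (z t) (y₀, 0) < δ := by
    intro t ht
    have h1 := dist_le_of_trajectories_ODE (v := fun _ => F) (K := K) (f := z)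
      (g := fun _ => (y₀, (0 : Plane))) (a := 0) (b := 1) (δ := ‖v‖) (fun _ => hFK)
      (fun t _ => (hz t).continuousAt.continuousWithinAt) (fun t _ => (hz t).hasDerivWithinAt)
      continuousOn_const (fun t _ => by
        rw [hF0]
        exact hasDerivWithinAt_const _ _ _) (by rw [hz0, dist_eq_norm]; simp) t ht
    refine h1.trans_lt (lt_of_le_of_lt ?_ hvn)
    gcongr
    rw [sub_zero]
    exact mul_le_of_le_one_right K.2 ht.2
  have hd : ∀ t, HasDerivAt (fun t => (z t).1) (F (z t)).1 t ∧
      HasDerivAt (fun t => (z t).2) (F (z t)).2 t := fun t =>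
    ⟨(ContinuousLinearMap.fst ℝ Plane Plane).hasFDerivAt.comp_hasDerivAt t (hz t),
      (ContinuousLinearMap.snd ℝ Plane Plane).hasFDerivAt.comp_hasDerivAt t (hz t)⟩
  have hzc : Continuous z := continuous_iff_continuousAt.2 fun t => (hz t).continuousAt
  have hF1 : ∀ t ∈ Icc (0 : ℝ) 1, (F (z t)).1 = (z t).2 ∧
      (F (z t)).2 = geodesicAccel g p (z t).1 (z t).2 := by
    intro t ht
    have h1 := (hball (hnear t ht)).1
    rw [h1]
    exact ⟨rfl, rfl⟩
  have hgeo := isGeodesicOn_of_chart (p := p) (c := fun t => (z t).1) (u := fun t => (z t).2)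
    (a := fun t => (F (z t)).2) g uniqueDiffOn_Icc_zero_one
    (fun t ht => by
      have := (hd t).1.hasDerivWithinAt (s := Icc 0 1)
      rwa [(hF1 t ht).1] at this)
    (fun t ht => (hd t).2.hasDerivWithinAt)
    (continuous_snd.comp (hFK.continuous.comp hzc)).continuousOn
    (fun t ht => (hball (hnear t ht)).2.1) (fun t ht => (hball (hnear t ht)).2.2)
    (fun t ht w => by
      rw [(hF1 t ht).2]
      exact apply_geodesicAccel g (hball (hnear t ht)).2.1 _ w)
  refine ⟨_, _, hgeo, ?_, ?_, rfl⟩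
  · rw [hz0]
    exact (extChartAt (𝓡∂ 2) p).left_inv (mem_extChartAt_source p)
  · have h0 : (0 : ℝ) ∈ Icc (0 : ℝ) 1 := left_mem_Icc.2 zero_le_one
    have h1 := (hd 0).1.hasDerivWithinAt (s := Icc 0 1)
    rw [(hF1 0 h0).1, hz0] at h1
    have h2 : ∀ t ∈ Icc (0 : ℝ) 1, (extChartAt (𝓡∂ 2) p ∘
        fun t => (extChartAt (𝓡∂ 2) p).symm (z t).1) t = (z t).1 := fun t ht =>
      (extChartAt (𝓡∂ 2) p).right_inv (hball (hnear t ht)).2.1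
    exact (h1.congr h2 (h2 0 h0)).derivWithin (uniqueDiffOn_Icc_zero_one 0 h0)

end ExistenceOfGeodesics

/-! ### The period along a geodesic starting at a zero -/

section PeriodsAlongGeodesics

variable {M : Type*} [TopologicalSpace M] [T2Space M] [ChartedSpace (EuclideanHalfSpace 2) M]
  [IsManifold (𝓡∂ 2) ∞ M]

/-- At a zero the only integral curve is constant, so it would already return at time T / 2. -/
theorem IsPeriodicPoint.field_ne_zero {X : VField M} (hX : X.IsChartC1) {q : M} {T : ℝ}
    (h : IsPeriodicPoint X q T) : X q ≠ 0 := by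
  obtain ⟨hT, γ, hγ0, hγ, -, hleast⟩ := h
  intro hq
  have h1 : γ = fun _ => q := hγ.eq_of_isChartC1 hX (isMIntegralCurve_const hq) (t₀ := 0) hγ0
  exact hleast (T / 2) ⟨by linarith, by linarith⟩ (by rw [h1])

set_option maxSynthPendingDepth 3 in
/-- Along a curve which is orthogonal to a Killing field without zeros on it, the period of the
orbits is locally constant. -/
theorem IsGeodesicOn.exists_period_locally_constant {g : SurfaceMetric M} {r : ℕ∞} {X Y : VField M}
    (hX : X.IsC r) (hr : 1 ≤ r) (hXY : X.Commute Y)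
    (hY : ∀ p, ∃ o : ℝ, o ≠ 0 ∧ ∀ᶠ y in 𝓝[range (𝓡∂ 2)] (extChartAt (𝓡∂ 2) p p),
      chartField Y p y = o • rotField (chartMetric g p y) (chartField X p y))
    (hcomp : X.IsComplete) {γ : ℝ → M} (hγ : IsGeodesicOn g γ (Icc 0 1))
    (horth : ∀ t ∈ Icc (0 : ℝ) 1,
      innerAt g (γ t) (fieldAt X (γ t)) (curveVelocity γ (Icc 0 1) t) = 0)
    {s₀ : ℝ} (hs₀ : s₀ ∈ Icc (0 : ℝ) 1) (hne : X (γ s₀) ≠ 0) :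
    ∃ S' ∈ 𝓝[Icc (0 : ℝ) 1] s₀, ∀ s₁ ∈ S', ∀ s₂ ∈ S', ∀ T, IsPeriodicPoint X (γ s₁) T →
      IsPeriodicPoint X (γ s₂) T := by
  set p := γ s₀ with hp
  set y₀ := extChartAt (𝓡∂ 2) p p with hy₀
  obtain ⟨o, ho, hYp⟩ := hY p
  have hyt := mem_extChartAt_target (I := 𝓡∂ 2) p
  have hS := uniqueDiffOn_Icc_zero_one
  have hYc : ∀ᶠ y in 𝓝[range (𝓡∂ 2)] y₀, ContDiffWithinAt ℝ 1 (chartField Y p) (range (𝓡∂ 2)) y := by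
    have h := (hXY.right p).eventually (by simp)
    rwa [insert_eq_of_mem (extChartAt_mem_range p p)] at h
  have hXne : ∀ᶠ y in 𝓝[range (𝓡∂ 2)] y₀, chartField X p y ≠ 0 := by
    refine (hX.hasFDerivWithinAt hr hyt).continuousWithinAt.eventually_ne ?_
    rw [chartField_self]
    exact hne
  have htend : Tendsto (fun t => extChartAt (𝓡∂ 2) p (γ t)) (𝓝[Icc 0 1] s₀)
      (𝓝[range (𝓡∂ 2)] y₀) :=
    tendsto_nhdsWithin_iff.2 ⟨(continuousAt_extChartAt p).comp_continuousWithinAt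
      (f := γ) (hγ.continuousOn s₀ hs₀), Eventually.of_forall fun t => extChartAt_mem_range p _⟩
  obtain ⟨R, hR0, hR⟩ := ((eventually_mem_nhdsWithin (a := (0 : ℝ)) (s := Ioi 0)).and
    (eventually_forall_closedBall ((hγ.eventually_mem_source hs₀ (mem_extChartAt_source p)).and
      (htend.eventually (hYp.and (hYc.and hXne)))))).exists
  set S' := Metric.closedBall s₀ R ∩ Icc (0 : ℝ) 1 with hS'
  have hS'n : S' ∈ 𝓝[Icc (0 : ℝ) 1] s₀ :=
    inter_mem (mem_nhdsWithin_of_mem_nhds (Metric.closedBall_mem_nhds s₀ hR0)) self_mem_nhdsWithin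
  have hS'o : S'.OrdConnected := ((convex_closedBall s₀ R).inter (convex_Icc 0 1)).ordConnected
  set c := extChartAt (𝓡∂ 2) p ∘ γ with hc
  -- In dimension two, a velocity orthogonal to X ≠ 0 is a multiple of Y; k is its coefficient,
  -- written as a quotient so as to be visibly continuous.
  set k : ℝ → ℝ := fun t =>
    chartMetric g p (c t) (derivWithin c (Icc 0 1) t) (chartField Y p (c t)) /
      chartMetric g p (c t) (chartField Y p (c t)) (chartField Y p (c t)) with hk
  have hYne : ∀ t ∈ S', chartField Y p (c t) ≠ 0 := by
    intro t ht
    obtain ⟨h1, h2, -, h3⟩ := hR t ht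
    have ht' := (extChartAt (𝓡∂ 2) p).map_source h1
    change chartField Y p (extChartAt (𝓡∂ 2) p (γ t)) ≠ 0
    rw [h2]
    exact smul_ne_zero ho (rotField_ne_zero (chartMetric_symm g p _)
      (fun u hu => chartMetric_pos g ht' hu) h3)
  have hkc : ContinuousOn k S' := by
    intro t ht
    obtain ⟨h1, h2, h3, h4⟩ := hR t ht
    have ht' := (extChartAt (𝓡∂ 2) p).map_source h1
    have c1 := (hγ.hasDerivWithinAt_metric ht.2 h1).continuousWithinAt
    have c2 := (hγ.hasDerivWithinAt_derivWithin hS ht.2 h1).continuousWithinAt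
    have c3 : ContinuousWithinAt (fun t => chartField Y p (extChartAt (𝓡∂ 2) p (γ t)))
        (Icc 0 1) t :=
      h3.continuousWithinAt.comp (f := c) (hγ.hasDerivWithinAt ht.2 h1).continuousWithinAt
        (fun s _ => extChartAt_mem_range p _)
    exact (((c1.clm_apply c2).clm_apply c3).div ((c1.clm_apply c3).clm_apply c3)
      (chartMetric_pos g ht' (hYne t ht)).ne').mono inter_subset_right
  have hvel : ∀ s ∈ S', HasVelocityWithin Y (k s) γ S' s := by
    intro t ht
    obtain ⟨h1, h2, h3, h4⟩ := hR t ht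
    have ht' := (extChartAt (𝓡∂ 2) p).map_source h1
    refine hasVelocityWithin_of_hasDerivWithinAt h1
      ((hγ.eventually_mem_source ht.2 h1).filter_mono (nhdsWithin_mono t inter_subset_right)) ?_
    have d1 := (hγ.hasDerivWithinAt ht.2 h1).mono (inter_subset_right : S' ⊆ Icc 0 1)
    refine d1.congr_deriv ?_
    have e1 := horth t ht.2
    rw [hγ.innerAt_field_curveVelocity hS X ht.2 h1] at e1
    have e2 := eq_smul_rotField (chartMetric_symm g p _) (fun u hu => chartMetric_pos g ht' hu) h4 e1
    change _ = (chartMetric g p (extChartAt (𝓡∂ 2) p (γ t)) (derivWithin c (Icc 0 1) t)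
        (chartField Y p (extChartAt (𝓡∂ 2) p (γ t))) /
      chartMetric g p (extChartAt (𝓡∂ 2) p (γ t)) (chartField Y p (extChartAt (𝓡∂ 2) p (γ t)))
        (chartField Y p (extChartAt (𝓡∂ 2) p (γ t)))) • _
    rw [h2]
    set ρ := rotField (chartMetric g p (extChartAt (𝓡∂ 2) p (γ t)))
      (chartField X p (extChartAt (𝓡∂ 2) p (γ t))) with hρ
    have hρ0 : ρ ≠ 0 := rotField_ne_zero (chartMetric_symm g p _)
      (fun u hu => chartMetric_pos g ht' hu) h4
    have hρ1 := (chartMetric_pos g ht' hρ0).ne'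
    refine e2.trans ?_
    rw [smul_smul]
    congr 1
    simp only [map_smul, smul_apply, smul_eq_mul]
    field_simp
    rfl
  choose Φ hΦ0 hΦ using hcomp
  have hF0 : (fun s => Φ (γ s) 0) = γ := funext fun s => hΦ0 (γ s)
  refine ⟨S', hS'n, fun s₁ hs₁ s₂ hs₂ T hT => ?_⟩
  have h := IsPeriodicPoint.of_commute hXY (F := fun t s => Φ (γ s) t) hS'o hkc
    (fun s _ => hΦ (γ s)) (fun s hs => by
      simp only [hF0]
      exact hvel s hs) (T := T) hs₁ hs₂ (by rw [hΦ0]; exact hT)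
  rwa [hΦ0] at h

/-- The points of a geodesic starting at a zero of a complete Killing field are zeros or periodic
points of the same period. -/
theorem IsGeodesicOn.zero_or_periodic {g : SurfaceMetric M} {r : ℕ∞} {X Y : VField M}
    (hX : X.IsC r) (hr : 1 ≤ r) (hK : IsKilling g X) (hXY : X.Commute Y)
    (hY : ∀ p, ∃ o : ℝ, o ≠ 0 ∧ ∀ᶠ y in 𝓝[range (𝓡∂ 2)] (extChartAt (𝓡∂ 2) p p),
      chartField Y p y = o • rotField (chartMetric g p y) (chartField X p y))
    (hcomp : X.IsComplete)
    (hper : ∀ p, X p = 0 → ∃ τ, ∀ᶠ q in 𝓝[≠] p, IsPeriodicPoint X q τ)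
    {γ : ℝ → M} (hγ : IsGeodesicOn g γ (Icc 0 1)) {p : M} (hp : γ 0 = p) (h0 : X p = 0)
    (hv : curveVelocity γ (Icc 0 1) 0 ≠ 0) {τ : ℝ} (hτ : ∀ᶠ q in 𝓝[≠] p, IsPeriodicPoint X q τ) :
    ∀ t ∈ Icc (0 : ℝ) 1, X (γ t) = 0 ∨ IsPeriodicPoint X (γ t) τ := by
  have hS := uniqueDiffOn_Icc_zero_one
  have hC1 := hX.isChartC1 hr
  have h0' : X (γ 0) = 0 := by rw [hp]; exact h0
  have horth : ∀ t ∈ Icc (0 : ℝ) 1,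
      innerAt g (γ t) (fieldAt X (γ t)) (curveVelocity γ (Icc 0 1) t) = 0 := by
    intro t ht
    rw [hγ.inner_killing_eq hX hr hK ht]
    have : fieldAt X (γ 0) = 0 := h0'
    rw [this, map_zero]
    rfl
  have hvel : ∀ t ∈ Icc (0 : ℝ) 1, curveVelocity γ (Icc 0 1) t ≠ 0 := by
    intro t ht h
    have h1 := hγ.speed_eq ht
    rw [h, map_zero] at h1
    exact (innerAt_pos g _ hv).ne h1
  -- The speed is a nonzero constant, so near s the curve visits γ s only at s and the punctured
  -- neighbourhoods of zeros can be used.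
  have hleave : ∀ s ∈ Icc (0 : ℝ) 1, ∀ᶠ t in 𝓝[Icc 0 1 \ {s}] s, γ t ≠ γ s := by
    intro s hs
    have h1 := hγ.hasDerivWithinAt hs (mem_extChartAt_source (γ s))
    have h2 := h1.eventually_ne (hvel s hs) (c := extChartAt (𝓡∂ 2) (γ s) (γ s))
    rw [sdiff_eq]
    filter_upwards [h2] with t ht heq
    exact ht (congrArg (extChartAt (𝓡∂ 2) (γ s)) heq)
  set P : ℝ → Prop := fun t => X (γ t) = 0 ∨ IsPeriodicPoint X (γ t) τ with hP
  have hzero : ∀ s ∈ Icc (0 : ℝ) 1, ∀ σ, (∀ᶠ q in 𝓝[≠] (γ s), IsPeriodicPoint X q σ) →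
      ∀ᶠ t in 𝓝[Icc 0 1 \ {s}] s, IsPeriodicPoint X (γ t) σ := by
    intro s hs σ hσ
    have h1 : Tendsto γ (𝓝[Icc 0 1 \ {s}] s) (𝓝[≠] (γ s)) :=
      tendsto_nhdsWithin_iff.2 ⟨(hγ.continuousOn s hs).mono_left
        (nhdsWithin_mono s sdiff_subset), hleave s hs⟩
    exact h1.eventually hσ
  have hfill : ∀ s ∈ Icc (0 : ℝ) 1, X (γ s) = 0 →
      (∀ᶠ t in 𝓝[Icc 0 1 \ {s}] s, IsPeriodicPoint X (γ t) τ) → ∀ᶠ t in 𝓝[Icc 0 1] s, P t := by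
    intro s hs hs0 h
    rw [eventually_nhdsWithin_iff] at h ⊢
    filter_upwards [h] with t ht htS
    by_cases hts : t = s
    · left
      rw [hts]
      exact hs0
    · exact Or.inr (ht ⟨htS, hts⟩)
  -- The property propagated is that P holds on a neighbourhood of s. P at s alone would not do: if
  -- γ s is a zero it holds trivially and says nothing about τ.
  have key := forall_mem_of_frequently_imp_eventually (isPreconnected_Icc (a := (0 : ℝ)) (b := 1))
    (P := fun s => ∀ᶠ t in 𝓝[Icc 0 1] s, P t) (fun s hs hfr => ?_)
    (left_mem_Icc.2 zero_le_one) (frequently_nhdsWithin_of_mem (left_mem_Icc.2 zero_le_one)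
      (hfill 0 (left_mem_Icc.2 zero_le_one) h0'
        (hzero 0 (left_mem_Icc.2 zero_le_one) τ (by rw [hp]; exact hτ))))
  · exact fun t ht => (key t ht).self_of_nhdsWithin ht
  · refine eventually_eventually_nhdsWithin.2 ?_
    by_cases hs0 : X (γ s) = 0
    · obtain ⟨σ, hσ⟩ := hper _ hs0
      have h1 := hzero s hs σ hσ
      -- Points near s and different from s have the period σ of the zero γ s; at one of them P
      -- holds as well, which forces σ = τ.
      have h2 : ∃ t, IsPeriodicPoint X (γ t) σ ∧ P t := by
        have h3 := eventually_nhdsWithin_iff.1 h1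
        obtain ⟨t, ⟨htQ, ht⟩, htS⟩ := ((hfr.and_eventually
          (h3.filter_mono nhdsWithin_le_nhds)).and_eventually self_mem_nhdsWithin).exists
        by_cases hts : t = s
        · rw [hts] at htQ
          have := neBot_nhdsWithin_Icc_diff one_pos hs
          exact (h1.and (htQ.filter_mono (nhdsWithin_mono s sdiff_subset))).exists
        · exact ⟨t, ht ⟨htS, hts⟩, htQ.self_of_nhdsWithin htS⟩
      obtain ⟨t, ht, htP⟩ := h2
      have h4 := htP.resolve_left (ht.field_ne_zero hC1)
      rw [ht.period_unique hC1 h4] at h1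
      exact hfill s hs hs0 h1
    · obtain ⟨S', hS', hT⟩ := hγ.exists_period_locally_constant hX hr hXY hY hcomp horth hs hs0
      have hne : ∀ᶠ t in 𝓝[Icc 0 1] s, X (γ t) ≠ 0 := by
        have h1 : ∀ᶠ y in 𝓝[range (𝓡∂ 2)] (extChartAt (𝓡∂ 2) (γ s) (γ s)),
            chartField X (γ s) y ≠ 0 := by
          refine (hX.hasFDerivWithinAt hr (mem_extChartAt_target _)).continuousWithinAt.eventually_ne
            ?_
          rw [chartField_self]
          exact hs0
        have htend : Tendsto (fun t => extChartAt (𝓡∂ 2) (γ s) (γ t)) (𝓝[Icc 0 1] s)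
            (𝓝[range (𝓡∂ 2)] (extChartAt (𝓡∂ 2) (γ s) (γ s))) :=
          tendsto_nhdsWithin_iff.2 ⟨(continuousAt_extChartAt (γ s)).comp_continuousWithinAt
            (f := γ) (hγ.continuousOn s hs),
            Eventually.of_forall fun t => extChartAt_mem_range (γ s) _⟩
        filter_upwards [htend.eventually h1,
          hγ.eventually_mem_source hs (mem_extChartAt_source (γ s))] with t ht hts h
        exact ht ((chartField_eq_zero_iff X hts).2 h)
      obtain ⟨t, ⟨⟨htQ, htS'⟩, htne⟩, htS⟩ := (((hfr.and_eventually hS').and_eventually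
        hne).and_eventually self_mem_nhdsWithin).exists
      have htP := (htQ.self_of_nhdsWithin htS).resolve_left htne
      filter_upwards [hS'] with t' ht'
      exact Or.inr (hT t htS' t' ht' τ htP)

end PeriodsAlongGeodesics

/-! ### Isolated centers and the conclusion -/

section IsolatedCenters

variable {M : Type*} [TopologicalSpace M] [T2Space M] [ChartedSpace (EuclideanHalfSpace 2) M]
  [IsManifold (𝓡∂ 2) ∞ M]

theorem exists_ne_zero_innerAt_lt (g : SurfaceMetric M) (p : M) {ε : ℝ} (hε : 0 < ε) :
    ∃ v : Plane, v ≠ 0 ∧ innerAt g p v v < ε ^ 2 := by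
  have hc : Continuous fun v : Plane => innerAt g p v v :=
    (innerAt g p).continuous.clm_apply continuous_id
  have h : ∀ᶠ v : Plane in 𝓝 0, innerAt g p v v < ε ^ 2 :=
    hc.continuousAt.eventually_lt continuousAt_const (by simpa using pow_pos hε 2)
  obtain ⟨v, hv, hne⟩ :=
    ((h.filter_mono nhdsWithin_le_nhds).and (self_mem_nhdsWithin (s := {(0 : Plane)}ᶜ))).exists
  exact ⟨v, hne, hv⟩

theorem IsKilling.isIsolatedCenter {g : SurfaceMetric M} {r : ℕ∞} {X Y : VField M}
    (hX : X.IsC r) (hr : 1 ≤ r) (hK : IsKilling g X) (hXY : X.Commute Y) {p : M} {o : ℝ}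
    (ho : o ≠ 0) (hY : ∀ᶠ y in 𝓝[range (𝓡∂ 2)] (extChartAt (𝓡∂ 2) p p),
      chartField Y p y = o • rotField (chartMetric g p y) (chartField X p y))
    (h0 : X p = 0) (hp : range (𝓡∂ 2) ∈ 𝓝 (extChartAt (𝓡∂ 2) p p)) (hA : linearization X p ≠ 0) :
    IsIsolatedCenter X p := by
  have hC1 := hX.isChartC1 hr
  obtain ⟨htr, -, hdet, -⟩ := skew_coordinates (innerAt_symm g p) (fun u hu => innerAt_pos g p hu)
    (hK.linearization_skew h0) hA
  have hl := Real.sqrt_pos.2 hdet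
  refine ⟨h0, ?_, fun U hU => ?_, eigenvalues_of_trace_eq_zero htr hdet⟩
  · exact (hK.exists_common_period hX hr hXY ho hY h0 hp hA).mono fun q hq => hq.field_ne_zero hC1
  · obtain ⟨V, hV, hVU, h⟩ := hK.exists_periodic_nhds hX hr h0 hp hA (half_pos hl)
      (half_lt_self hl) hU
    refine ⟨V, hV, hVU, fun q hq hqp => ?_⟩
    obtain ⟨γ, T, hγ0, hγ, hT, hleast, hT0, -, -, hγV⟩ := h q hq hqp
    refine ⟨T, ⟨hT0, γ, hγ0, hγ, hT, hleast⟩, fun γ' hγ'0 hγ' t => ?_⟩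
    rw [hγ'.eq_of_isChartC1 hC1 hγ (t₀ := 0) (hγ'0.trans hγ0.symm)]
    exact hγV t

end IsolatedCenters

theorem mainTheorem8 {M : Type*} [TopologicalSpace M] [T2Space M] [SecondCountableTopology M]
    [ConnectedSpace M] [ChartedSpace (EuclideanHalfSpace 2) M] [IsManifold (𝓡∂ 2) ∞ M]
    (hM : IsOrientableSurface M) (g : SurfaceMetric M)
    (r : ℕ∞) (hr : 1 ≤ r) (X : VField M) (hX : X.IsC r) (hK : IsKilling g X)
    (hbd : IsTangentToBoundary X) (hzero : ∃ p, X p = 0) :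
    ((∀ p, X p = 0) ∨ ∀ p, X p = 0 → IsIsolatedCenter X p) ∧
    ((∃ p, X p ≠ 0) →
      (∃ q T, IsPeriodicPoint X q T) ∧
      ∀ p, X p = 0 → ∃ τ : ℝ, 0 < τ ∧
        (∃ ε : ℝ, 0 < ε ∧ ∀ v : TangentSpace (𝓡∂ 2) p, v ≠ 0 → g.inner p v v < ε ^ 2 →
          (∃ q, IsExp g p v q) ∧ ∀ q, IsExp g p v q → IsPeriodicPoint X q τ) ∧
        (X.IsComplete → ∀ v : TangentSpace (𝓡∂ 2) p, v ≠ 0 → ∀ q, IsExp g p v q →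
          X q = 0 ∨ IsPeriodicPoint X q τ)) := by
  by_cases hne : ∃ q, X q ≠ 0
  swap
  · exact ⟨Or.inl fun p => not_not.1 fun h => hne ⟨p, h⟩, fun h => absurd h hne⟩
  obtain ⟨Y, hXY, hY⟩ := hK.exists_commute hM hX hr
  have hA : ∀ p, X p = 0 → linearization X p ≠ 0 := fun p h0 =>
    hK.linearization_ne_zero hX hr hne h0
  have hint : ∀ p, X p = 0 → range (𝓡∂ 2) ∈ 𝓝 (extChartAt (𝓡∂ 2) p p) := fun p h0 =>
    hK.range_mem_nhds hX hr hbd hne h0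
  have hper : ∀ p, X p = 0 → ∀ᶠ q in 𝓝[≠] p,
      IsPeriodicPoint X q (2 * Real.pi / Real.sqrt (linearization X p).det) := by
    intro p h0
    obtain ⟨o, ho, hYp⟩ := hY p
    exact hK.exists_common_period hX hr hXY ho hYp h0 (hint p h0) (hA p h0)
  have hexp : ∀ p, X p = 0 → ∃ ε : ℝ, 0 < ε ∧ ∀ v : Plane, v ≠ 0 → innerAt g p v v < ε ^ 2 →
      (∃ q, IsExp g p v q) ∧ ∀ q, IsExp g p v q →
        IsPeriodicPoint X q (2 * Real.pi / Real.sqrt (linearization X p).det) := by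
    intro p h0
    obtain ⟨ε₁, hε₁, h1⟩ := exists_isExp g (hint p h0)
    -- The neighbourhood used consists of p and of points of the common period; the exponential of a
    -- short nonzero vector lies in it and differs from p.
    obtain ⟨ε₂, hε₂, h2⟩ := exists_isExp_mem g (eventually_nhdsWithin_iff.1 (hper p h0))
    refine ⟨min ε₁ ε₂, lt_min hε₁ hε₂, fun v hv hlt => ⟨h1 v (hlt.trans_le ?_), fun q hq => ?_⟩⟩
    · exact pow_le_pow_left₀ (lt_min hε₁ hε₂).le (min_le_left _ _) 2
    · obtain ⟨hqN, hqp⟩ := h2 v hv (hlt.trans_le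
        (pow_le_pow_left₀ (lt_min hε₁ hε₂).le (min_le_right _ _) 2)) q hq
      exact hqN hqp
  refine ⟨Or.inr fun p h0 => ?_, fun _ => ⟨?_, fun p h0 => ⟨_, ?_, hexp p h0, ?_⟩⟩⟩
  · obtain ⟨o, ho, hYp⟩ := hY p
    exact hK.isIsolatedCenter hX hr hXY ho hYp h0 (hint p h0) (hA p h0)
  -- A periodic point is obtained as the exponential of a short nonzero vector at a zero.
  · obtain ⟨p, h0⟩ := hzero
    obtain ⟨ε, hε, h⟩ := hexp p h0
    obtain ⟨v, hv, hlt⟩ := exists_ne_zero_innerAt_lt g p hε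
    obtain ⟨⟨q, hq⟩, h'⟩ := h v hv hlt
    exact ⟨q, _, h' q hq⟩
  · obtain ⟨-, -, hdet, -⟩ := skew_coordinates (innerAt_symm g p)
      (fun u hu => innerAt_pos g p hu) (hK.linearization_skew h0) (hA p h0)
    have := Real.sqrt_pos.2 hdet
    have := Real.pi_pos
    positivity
  · rintro hcomp v hv q ⟨γ, hγ, hγ0, hγv, hγ1⟩
    rw [← hγ1]
    refine hγ.zero_or_periodic hX hr hK hXY hY hcomp (fun p' h0' => ⟨_, hper p' h0'⟩) hγ0 h0 ?_
      (hper p h0) 1 (right_mem_Icc.2 zero_le_one)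
    rw [curveVelocity, hγ0, hγv]
    exact hv
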